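/- Let $\mathbb{T}^4=\mathbb{C}^2/(\mathbb{Z}+i\mathbb{Z})^2$ with complex coordinates $(w,z)=(x_1+iy_1,\,x_2+iy_2)$, and let $\mathbb{T}^2=\mathbb{C}/(\mathbb{Z}+i\mathbb{Z})$ with coordinate $z$. Let $A(w,z)=(w+z,z)$, i.e. in the real coordinates $(x_1,y_1,x_2,y_2)$ $$A=\begin{pmatrix}1&0&1&0\\0&1&0&1\\0&0&1&0\\0&0&0&1\end{pmatrix}.$$ Let $M=\mathbb{T}^4\times\mathbb{R}/\big((p,s)\sim(Ap,s+1)\big)$, which is $\mathbb{T}^4\times[0,1]/\big((p,0)\sim(Ap,1)\big)$, be the suspension of $A$, and let $\mathcal{F}_A$ be the foliation of $M$ whose leaves are the images of the lines $\{p\}\times\mathbb{R}$. A smooth complex-valued form $\alpha$ on $M$ is called basic if $i_X\alpha=i_Xd\alpha=0$ for every vector field $X$ tangent to the leaves, and $H^\bullet(M/\mathcal{F}_A)$ denotes the cohomology of the complex of basic forms (over $\mathbb{C}$). Let $$V=\Big\{(b,c,e)\in C^\infty(\mathbb{T}^2,\mathbb{C})^3 \;:\; \tfrac{\partial b}{\partial\bar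 z}-\tfrac{\partial c}{\partial z}=0,\ \tfrac{\partial c}{\partial\bar z}-\tfrac{\partial e}{\partial z}=0\Big\}.$$ Then $\mathcal{F}_A$ has codimension $4$ and is transversely holomorphic for the complex structure of $\mathbb{T}^4$, and there are $\mathbb{C}$-linear isomorphisms $$H^0(M/\mathcal{F}_A)\cong\mathbb{C},\quad H^1(M/\mathcal{F}_A)\cong\mathbb{C}^2,\quad H^2(M/\mathcal{F}_A)\cong V\oplus\mathbb{C},\quad H^3(M/\mathcal{F}_A)\cong\mathbb{C}^2,\quad H^4(M/\mathcal{F}_A)\cong C^\infty(\mathbb{T}^2,\mathbb{C}),$$ under which the following elements correspond to the classes of the following closed basic forms (written on the covering $\mathbb{C}^2\times\mathbb{R}$ of $M$): $\lambda\mapsto[\lambda]$ in degree $0$; $(\lambda,\mu)\mapsto[\lambda\,dz+\mu\,d\bar z]$ in degree $1$; $((b,c,e),\lambda)\mapsto[b\,dw\wedge dz+c\,(dw\wedge d\bar z+d\bar w\wedge dz)+e\,d\bar w\wedge d\bar z+\lambda\,dz\wedge d\bar z]$ in degree $2$; $(\lambda,\mu)\mapsto[\lambda\,dw\wedge dz\wedge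 d\bar z+\mu\,d\bar w\wedge dz\wedge d\bar z]$ in degree $3$; $g\mapsto[g(z)\,dw\wedge dz\wedge d\bar w\wedge d\bar z]$ in degree $4$. The space $V$ is infinite dimensional. Consequently the basic cohomology is infinite dimensional in degrees $2$ and $4$ but finite dimensional in degree $3$. -/

import Mathlib

open scoped Manifold ContDiff Topology
open Set

section Forms

variable (E : Type*) [NormedAddCommGroup E] [NormedSpace ℝ E]
  (M : Type*) [TopologicalSpace M] [ChartedSpace E M]
  (W : Type*) [NormedAddCommGroup W] [NormedSpace ℝ W]

/-- `W`-valued `k`-forms on `M`, without any regularity: a `k`-linear alternating map on each tangent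
space of `M`. -/
abbrev RoughForm (k : ℕ) : Type _ :=
  (x : M) → (TangentSpace 𝓘(ℝ, E) x) [⋀^Fin k]→L[ℝ] W

end Forms

section Forms

variable {E : Type*} [NormedAddCommGroup E] [NormedSpace ℝ E]
  {M : Type*} [TopologicalSpace M] [ChartedSpace E M]
  {E' : Type*} [NormedAddCommGroup E'] [NormedSpace ℝ E']
  {N : Type*} [TopologicalSpace N] [ChartedSpace E' N]
  {W : Type*} [NormedAddCommGroup W] [NormedSpace ℝ W]

namespace RoughForm

/-- Pullback of a form along a map. -/
noncomputable def pullback {k : ℕ} (f : N → M) (α : RoughForm E M W k) : RoughForm E' N W k :=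
  fun x => (α (f x)).compContinuousLinearMap (mfderiv 𝓘(ℝ, E') 𝓘(ℝ, E) f x)

/-- The expression of a form in a chart, as a form on (an open subset of) the model space. -/
noncomputable def inChart {k : ℕ} (e : OpenPartialHomeomorph M E) (α : RoughForm E M W k) :
    E → E [⋀^Fin k]→L[ℝ] W :=
  fun y => pullback (E' := E) (N := E) e.symm α y

/-- A form is smooth if its expression in every chart of the atlas is smooth. -/
def IsSmooth {k : ℕ} (α : RoughForm E M W k) : Prop :=
  ∀ e ∈ atlas E M, ContDiffOn ℝ ∞ (inChart e α) e.target

/-- The exterior derivative, computed at `x` in the preferred chart at `x`. -/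
noncomputable def d {k : ℕ} (α : RoughForm E M W k) : RoughForm E M W (k + 1) :=
  fun x => ContinuousAlternatingMap.compContinuousLinearMap
    (extDeriv (inChart (chartAt E x) α) (chartAt E x x))
    (mfderiv 𝓘(ℝ, E) 𝓘(ℝ, E) (chartAt E x) x)

theorem inChart_add {k : ℕ} (e : OpenPartialHomeomorph M E) (α β : RoughForm E M W k) :
    inChart e (α + β) = inChart e α + inChart e β := rfl

theorem IsSmooth.zero {k : ℕ} : IsSmooth (0 : RoughForm E M W k) :=
  fun _ _ => contDiffOn_const (c := (0 : E [⋀^Fin k]→L[ℝ] W))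

theorem IsSmooth.add {k : ℕ} {α β : RoughForm E M W k} (hα : IsSmooth α) (hβ : IsSmooth β) :
    IsSmooth (α + β) := fun e he => (hα e he).add (hβ e he)

theorem IsSmooth.differentiableAt {k : ℕ} {α : RoughForm E M W k} (hα : IsSmooth α) (x : M) :
    DifferentiableAt ℝ (inChart (chartAt E x) α) (chartAt E x x) :=
  ((hα _ (chart_mem_atlas E x)).contDiffAt ((chartAt E x).open_target.mem_nhds
    (mem_chart_target E x))).differentiableAt (by simp)

theorem d_add {k : ℕ} {α β : RoughForm E M W k} (hα : IsSmooth α) (hβ : IsSmooth β) :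
    d (α + β) = d α + d β := by
  funext x
  unfold d
  rw [inChart_add, extDeriv_add (hα.differentiableAt x) (hβ.differentiableAt x)]
  rfl

variable [NormedSpace ℂ W] [SMulCommClass ℝ ℂ W]

theorem inChart_smul {k : ℕ} (e : OpenPartialHomeomorph M E) (c : ℂ) (α : RoughForm E M W k) :
    inChart e (c • α) = c • inChart e α := rfl

theorem IsSmooth.smul {k : ℕ} (c : ℂ) {α : RoughForm E M W k} (hα : IsSmooth α) :
    IsSmooth (c • α) := fun e he => (hα e he).const_smul c

theorem d_smul {k : ℕ} (c : ℂ) {α : RoughForm E M W k} (hα : IsSmooth α) :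
    d (c • α) = c • d α := by
  funext x
  have key : extDeriv (c • inChart (chartAt E x) α) (chartAt E x x) =
      c • extDeriv (inChart (chartAt E x) α) (chartAt E x x) := by
    have h := fderiv_const_smul (𝕜 := ℝ) (hα.differentiableAt x) c
    ext v
    simp only [extDeriv, h, ContinuousAlternatingMap.smul_apply,
      ContinuousAlternatingMap.alternatizeUncurryFin_apply, _root_.smul_apply,
      Finset.smul_sum]
    exact Finset.sum_congr rfl fun i _ => smul_comm _ _ _
  unfold d
  rw [inChart_smul, key]
  rfl

end RoughForm
end Forms

/-! ### Foliations -/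

/-- A foliation on the manifold `M`, transversely modelled on the manifold `T`: an open cover `U i`,
submersions `f i : U i → T` with connected fibres (the plaques), and local diffeomorphisms `γ i j`
of `T` with `f j = γ i j ∘ f i` on `U i ∩ U j`. -/
structure Foliation (E : Type*) [NormedAddCommGroup E] [NormedSpace ℝ E]
    (M : Type*) [TopologicalSpace M] [ChartedSpace E M]
    (E' : Type*) [NormedAddCommGroup E'] [NormedSpace ℝ E']
    (T : Type*) [TopologicalSpace T] [ChartedSpace E' T] where
  ι : Type
  U : ι → Set M
  isOpen_U : ∀ i, IsOpen (U i)
  cover : ⋃ i, U i = univ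
  f : ι → M → T
  smooth_f : ∀ i, ContMDiffOn 𝓘(ℝ, E) 𝓘(ℝ, E') ∞ (f i) (U i)
  submersion_f : ∀ i, ∀ x ∈ U i,
    Function.Surjective (mfderiv 𝓘(ℝ, E) 𝓘(ℝ, E') (f i) x)
  connected_plaque : ∀ i, ∀ t ∈ f i '' U i, IsConnected (U i ∩ f i ⁻¹' {t})
  γ : ι → ι → OpenPartialHomeomorph T T
  smooth_γ : ∀ i j, (U i ∩ U j).Nonempty →
    ContMDiffOn 𝓘(ℝ, E') 𝓘(ℝ, E') ∞ (γ i j) (γ i j).source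
  smooth_γ_symm : ∀ i j, (U i ∩ U j).Nonempty →
    ContMDiffOn 𝓘(ℝ, E') 𝓘(ℝ, E') ∞ (γ i j).symm (γ i j).target
  mem_source : ∀ i j, ∀ x ∈ U i ∩ U j, f i x ∈ (γ i j).source
  cocycle : ∀ i j, ∀ x ∈ U i ∩ U j, f j x = γ i j (f i x)

namespace Foliation

variable {E : Type*} [NormedAddCommGroup E] [NormedSpace ℝ E]
  {M : Type*} [TopologicalSpace M] [ChartedSpace E M]
  {E' : Type*} [NormedAddCommGroup E'] [NormedSpace ℝ E']
  {T : Type*} [TopologicalSpace T] [ChartedSpace E' T]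
  (F : Foliation E M E' T)
  {W : Type*} [NormedAddCommGroup W] [NormedSpace ℝ W]

/-- The codimension, that is, the real dimension of the transverse manifold. -/
noncomputable def codimension (_F : Foliation E M E' T) : ℕ := Module.finrank ℝ E'

/-- The foliation is transversely holomorphic for the given complex structure on `T`: the atlas of
`T` is holomorphic, and so are the `γ i j` and their inverses. -/
def IsTransverselyHolomorphic [NormedSpace ℂ E'] [IsScalarTower ℝ ℂ E'] : Prop :=
  IsManifold 𝓘(ℂ, E') ω T ∧ ∀ i j, (F.U i ∩ F.U j).Nonempty →
    MDifferentiableOn 𝓘(ℂ, E') 𝓘(ℂ, E') (F.γ i j) (F.γ i j).source ∧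
    MDifferentiableOn 𝓘(ℂ, E') 𝓘(ℂ, E') (F.γ i j).symm (F.γ i j).target

/-- `v` is tangent to the leaf through `x`, that is, to the plaque through `x`. -/
def IsTangent (x : M) (v : TangentSpace 𝓘(ℝ, E) x) : Prop :=
  ∃ i, x ∈ F.U i ∧ mfderiv 𝓘(ℝ, E) 𝓘(ℝ, E') (F.f i) x v = 0

/-- horizontal: `i_X α = 0` for all `X` tangent -/
def IsHorizontal {k : ℕ} (α : RoughForm E M W k) : Prop :=
  ∀ (x : M) (u : Fin k → TangentSpace 𝓘(ℝ, E) x), (∃ j, F.IsTangent x (u j)) → α x u = 0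

theorem IsHorizontal.add {F : Foliation E M E' T} {k : ℕ} {α β : RoughForm E M W k}
    (hα : F.IsHorizontal α)
    (hβ : F.IsHorizontal β) : F.IsHorizontal (α + β) := fun x u hu => by
  have h1 := hα x u hu
  have h2 := hβ x u hu
  simp [h1, h2]

theorem IsHorizontal.zero {F : Foliation E M E' T} {k : ℕ} :
    F.IsHorizontal (0 : RoughForm E M W k) := fun _ _ _ => rfl

variable [NormedSpace ℂ W] [SMulCommClass ℝ ℂ W]

theorem IsHorizontal.smul {F : Foliation E M E' T} {k : ℕ} (c : ℂ) {α : RoughForm E M W k}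
    (hα : F.IsHorizontal α) : F.IsHorizontal (c • α) := fun x u hu => by
  have h1 := hα x u hu
  simp [h1]

theorem d_zero {k : ℕ} : RoughForm.d (0 : RoughForm E M W k) = 0 := by
  have h := RoughForm.d_smul (0 : ℂ) (RoughForm.IsSmooth.zero (E := E) (M := M) (W := W) (k := k))
  rwa [zero_smul, zero_smul] at h

variable (W)

/-- The smooth basic forms: `i_X α = 0` and `i_X dα = 0` for all `X` tangent to the leaves. -/
def basicForms (k : ℕ) : Submodule ℂ (RoughForm E M W k) where
  carrier := {α | RoughForm.IsSmooth α ∧ F.IsHorizontal α ∧ F.IsHorizontal (RoughForm.d α)}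
  add_mem' := fun hα hβ => ⟨hα.1.add hβ.1, hα.2.1.add hβ.2.1, by
    rw [RoughForm.d_add hα.1 hβ.1]; exact hα.2.2.add hβ.2.2⟩
  zero_mem' := ⟨.zero, .zero, by rw [d_zero]; exact .zero⟩
  smul_mem' := fun c _ hα => ⟨hα.1.smul c, hα.2.1.smul c, by
    rw [RoughForm.d_smul c hα.1]; exact hα.2.2.smul c⟩

/-- The exterior derivative on basic forms. -/
noncomputable def dBasic (k : ℕ) : F.basicForms W k →ₗ[ℂ] RoughForm E M W (k + 1) where
  toFun α := RoughForm.d α.1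
  map_add' α β := RoughForm.d_add α.2.1 β.2.1
  map_smul' c α := RoughForm.d_smul c α.2.1

/-- Closed basic forms. -/
noncomputable def closedForms (k : ℕ) : Submodule ℂ (RoughForm E M W k) :=
  (LinearMap.ker (F.dBasic W k)).map (F.basicForms W k).subtype

/-- Differentials of basic forms of the preceding degree. -/
noncomputable def exactForms : (k : ℕ) → Submodule ℂ (RoughForm E M W k)
  | 0 => ⊥
  | k + 1 => LinearMap.range (F.dBasic W k)

/-- The basic de Rham cohomology, with coefficients in `W`. -/
noncomputable abbrev basicCohomology (k : ℕ) : Type _ :=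
  F.closedForms W k ⧸ (F.exactForms W k).submoduleOf (F.closedForms W k)

end Foliation

/-! ### Quotient manifolds of vector spaces -/

section Cover

variable {E : Type*} [NormedAddCommGroup E]
  {Q : Type*} [TopologicalSpace Q]

/-- `π : E → Q` is a covering of `Q` by a vector space: the charts of `Q` are the local inverses of
`π`, and two points in the same fibre are related by a smooth deck transformation. -/
structure IsUniformization (𝕜 : Type*) [NontriviallyNormedField 𝕜] [NormedSpace 𝕜 E]
    [ChartedSpace E Q] (π : E → Q) : Prop where
  surjective : Function.Surjective π
  chart_symm : ∀ e ∈ atlas E Q, ∀ x ∈ e.target, e.symm x = π x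
  deck : ∀ x y, π x = π y →
    ∃ g : E → E, ContDiff 𝕜 ω g ∧ g x = y ∧ ∀ z, π (g z) = π z

theorem atlas_symm_of_isLocalHomeomorph {π : E → Q} (h : IsLocalHomeomorph π)
    (hs : Function.Surjective π) :
    letI : ChartedSpace E Q := h.chartedSpace hs
    ∀ e ∈ atlas E Q, ∀ x ∈ e.target, e.symm x = π x := by
  rintro e ⟨q, rfl⟩ x _
  simp only [OpenPartialHomeomorph.coe_trans_symm, Function.comp_apply,
    IsLocalHomeomorph.localInverseAt_symm, chartAt_self_eq]
  rfl

namespace IsUniformization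

variable {𝕜 : Type*} [NontriviallyNormedField 𝕜] [NormedSpace 𝕜 E]
    [ChartedSpace E Q] {π : E → Q}
    {E' : Type*} [NormedAddCommGroup E'] [NormedSpace 𝕜 E']
    {N : Type*} [TopologicalSpace N] [ChartedSpace E' N]

theorem isManifold (h : IsUniformization 𝕜 π) : IsManifold 𝓘(𝕜, E) ω Q := by
  refine isManifold_of_contDiffOn _ _ _ fun e e' he he' => ?_
  simp only [modelWithCornersSelf_coe, modelWithCornersSelf_coe_symm, Function.comp_id,
    Function.id_comp, preimage_id, range_id, inter_univ]
  intro x hx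
  have hx1 : x ∈ e.target := by simpa using hx.1
  have hx2 : e.symm x ∈ e'.source := hx.2
  have hy : π x = π (e' (e.symm x)) := by
    rw [← h.chart_symm e' he' _ (e'.map_source hx2), e'.left_inv hx2, h.chart_symm e he x hx1]
  obtain ⟨g, hg, hgx, hgπ⟩ := h.deck _ _ hy
  refine ContDiffAt.contDiffWithinAt ?_
  refine hg.contDiffAt.congr_of_eventuallyEq ?_
  have h1 : ∀ᶠ x' in 𝓝 x, g x' ∈ e'.target := by
    refine hg.continuous.continuousAt.eventually_mem (e'.open_target.mem_nhds ?_)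
    rw [hgx]; exact e'.map_source hx2
  filter_upwards [h1, e.open_target.mem_nhds hx1] with x' h1 h2
  show e' (e.symm x') = g x'
  rw [h.chart_symm e he x' h2, ← hgπ, ← h.chart_symm e' he' _ h1, e'.right_inv h1]

theorem eventuallyEq (h : IsUniformization 𝕜 π) (x : E) : ∃ g : E → E, ContDiff 𝕜 ω g ∧
    g x = chartAt E (π x) (π x) ∧ ∀ᶠ x' in 𝓝 x, π x' = (chartAt E (π x)).symm (g x') := by
  have hy : π x = π (chartAt E (π x) (π x)) := by
    rw [← h.chart_symm _ (chart_mem_atlas E _) _ (mem_chart_target E _),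
      (chartAt E (π x)).left_inv (mem_chart_source E _)]
  obtain ⟨g, hg, hgx, hgπ⟩ := h.deck _ _ hy
  refine ⟨g, hg, hgx, ?_⟩
  have h1 : ∀ᶠ x' in 𝓝 x, g x' ∈ (chartAt E (π x)).target := by
    refine hg.continuous.continuousAt.eventually_mem ((chartAt E (π x)).open_target.mem_nhds ?_)
    rw [hgx]; exact mem_chart_target E _
  filter_upwards [h1] with x' h1
  rw [h.chart_symm _ (chart_mem_atlas E _) _ h1, hgπ]

theorem contMDiff (h : IsUniformization 𝕜 π) : ContMDiff 𝓘(𝕜, E) 𝓘(𝕜, E) ω π := by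
  have := h.isManifold
  intro x
  obtain ⟨g, hg, hgx, hev⟩ := h.eventuallyEq x
  refine ContMDiffAt.congr_of_eventuallyEq ?_ hev
  have h1 : ContMDiffAt 𝓘(𝕜, E) 𝓘(𝕜, E) ω (chartAt E (π x)).symm (g x) :=
    (contMDiffOn_chart_symm (I := 𝓘(𝕜, E)) (n := ω) (x := π x)).contMDiffAt
      ((chartAt E (π x)).open_target.mem_nhds (hgx ▸ mem_chart_target E _))
  exact h1.comp x hg.contMDiff.contMDiffAt

theorem eventually_chart (h : IsUniformization 𝕜 π) (q : Q) :
    ∀ᶠ q' in 𝓝 q, π (chartAt E q q') = q' := by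
  filter_upwards [(chartAt E q).open_source.mem_nhds (mem_chart_source E q)] with q' hq
  rw [← h.chart_symm _ (chart_mem_atlas E _) _ ((chartAt E q).map_source hq),
    (chartAt E q).left_inv hq]

theorem contMDiffAt_of_comp (h : IsUniformization 𝕜 π) {f : Q → N} {q : Q} {n : ℕ∞ω}
    (hf : ∀ y, π y = q → ContMDiffAt 𝓘(𝕜, E) 𝓘(𝕜, E') n (f ∘ π) y) :
    ContMDiffAt 𝓘(𝕜, E) 𝓘(𝕜, E') n f q := by
  have := h.isManifold
  have := this.of_le (m := n) le_top
  have h1 : ContMDiffAt 𝓘(𝕜, E) 𝓘(𝕜, E') n ((f ∘ π) ∘ (chartAt E q : Q → E)) q := by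
    refine ContMDiffAt.comp (g := f ∘ π) q (hf (chartAt E q q) (h.eventually_chart q).self_of_nhds) ?_
    exact (contMDiffOn_chart (I := 𝓘(𝕜, E)) (n := n) (x := q)).contMDiffAt
      ((chartAt E q).open_source.mem_nhds (mem_chart_source E q))
  refine h1.congr_of_eventuallyEq ?_
  filter_upwards [h.eventually_chart q] with q' hq
  simp [hq]

theorem surjective_mfderiv (h : IsUniformization 𝕜 π) (x : E) :
    Function.Surjective (mfderiv 𝓘(𝕜, E) 𝓘(𝕜, E) π x) := by
  have := h.isManifold
  have hd : ∀ y, MDifferentiableAt 𝓘(𝕜, E) 𝓘(𝕜, E) π y := fun y =>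
    (h.contMDiff y).mdifferentiableAt (by simp)
  have key : ∀ q : Q, Function.Surjective (mfderiv 𝓘(𝕜, E) 𝓘(𝕜, E) π (chartAt E q q)) := by
    intro q
    have hc : MDifferentiableAt 𝓘(𝕜, E) 𝓘(𝕜, E) (chartAt E q) q :=
      ((contMDiffOn_chart (I := 𝓘(𝕜, E)) (n := ω) (x := q)).contMDiffAt
        ((chartAt E q).open_source.mem_nhds (mem_chart_source E q))).mdifferentiableAt (by simp)
    have h1 := mfderiv_comp q (hd (chartAt E q q)) hc
    have h2 : mfderiv 𝓘(𝕜, E) 𝓘(𝕜, E) (π ∘ chartAt E q) q =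
        mfderiv 𝓘(𝕜, E) 𝓘(𝕜, E) (id : Q → Q) q :=
      Filter.EventuallyEq.mfderiv_eq (h.eventually_chart q)
    intro v
    refine ⟨mfderiv 𝓘(𝕜, E) 𝓘(𝕜, E) (chartAt E q) q v, ?_⟩
    have h3 := DFunLike.congr_fun (h1.symm.trans h2) v
    rw [mfderiv_id] at h3
    exact h3
  have transfer : ∀ (y z : E) (g : E → E), ContDiff 𝕜 ω g → g y = z → π ∘ g = π →
      Function.Surjective (mfderiv 𝓘(𝕜, E) 𝓘(𝕜, E) π y) →
      Function.Surjective (mfderiv 𝓘(𝕜, E) 𝓘(𝕜, E) π z) := by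
    rintro y z g hg rfl hgπ hs
    have h1 := mfderiv_comp (I' := 𝓘(𝕜, E)) y (hd (g y))
      (hg.contMDiff.contMDiffAt.mdifferentiableAt (by simp))
    have h2 : Function.Surjective (mfderiv 𝓘(𝕜, E) 𝓘(𝕜, E) (π ∘ g) y) := by
      rw [hgπ]; exact hs
    rw [h1] at h2
    exact Function.Surjective.of_comp h2
  have hy : π (chartAt E (π x) (π x)) = π x := (h.eventually_chart (π x)).self_of_nhds
  obtain ⟨g, hg, hgx, hgπ⟩ := h.deck _ _ hy
  exact transfer _ _ g hg hgx (funext hgπ) (key _)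

end IsUniformization

end Cover

/-! ### Tori -/

/-- The lattice `ℤ + ℤ i` in `ℂ`. -/
def intLattice : AddSubgroup ℂ where
  carrier := {z | ∃ m n : ℤ, z = m + n * Complex.I}
  zero_mem' := ⟨0, 0, by simp⟩
  add_mem' := by
    rintro _ _ ⟨m, n, rfl⟩ ⟨m', n', rfl⟩
    exact ⟨m + m', n + n', by push_cast; ring⟩
  neg_mem' := by
    rintro _ ⟨m, n, rfl⟩
    exact ⟨-m, -n, by push_cast; ring⟩

/-- The torus `𝕋² = ℂ / (ℤ + ℤ i)`, with coordinate `z`. -/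
abbrev Torus2 : Type := ℂ ⧸ intLattice

/-- The torus `𝕋⁴ = ℂ² / (ℤ + ℤ i)²`, with coordinates `(w, z)`. -/
abbrev Torus4 : Type := (ℂ × ℂ) ⧸ intLattice.prod intLattice

theorem intLattice_discrete {v : ℂ} (hv : v ∈ intLattice) (h : ‖v‖ < 1) : v = 0 := by
  obtain ⟨m, n, rfl⟩ := hv
  have h1 : |(m : ℝ)| < 1 := by
    simpa using (Complex.abs_re_le_norm _).trans_lt h
  have h2 : |(n : ℝ)| < 1 := by
    simpa using (Complex.abs_im_le_norm _).trans_lt h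
  have h3 : m = 0 := Int.abs_lt_one_iff.1 (by exact_mod_cast h1)
  have h4 : n = 0 := Int.abs_lt_one_iff.1 (by exact_mod_cast h2)
  simp [h3, h4]

theorem intLattice_prod_discrete {v : ℂ × ℂ} (hv : v ∈ intLattice.prod intLattice)
    (h : ‖v‖ < 1) : v = 0 := by
  have hv' := AddSubgroup.mem_prod.1 hv
  exact Prod.ext (intLattice_discrete hv'.1 ((norm_fst_le v).trans_lt h))
    (intLattice_discrete hv'.2 ((norm_snd_le v).trans_lt h))

theorem isLocalHomeomorph_of_isOpenMap {X Y : Type*} [TopologicalSpace X] [TopologicalSpace Y]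
    {f : X → Y} (hc : Continuous f) (ho : IsOpenMap f)
    (hi : ∀ x, ∃ U, IsOpen U ∧ x ∈ U ∧ InjOn f U) : IsLocalHomeomorph f := by
  rw [isLocalHomeomorph_iff_isOpenEmbedding_restrict]
  intro x
  obtain ⟨U, hU, hx, hinj⟩ := hi x
  exact ⟨U, hU.mem_nhds hx, .of_continuous_injective_isOpenMap
    (hc.comp continuous_subtype_val) (injOn_iff_injective.1 hinj) (ho.domRestrict hU)⟩

theorem isLocalHomeomorph_mk {E : Type*} [NormedAddCommGroup E] (S : AddSubgroup E)
    (hS : ∀ v ∈ S, ‖v‖ < 1 → v = 0) : IsLocalHomeomorph (QuotientAddGroup.mk : E → E ⧸ S) := by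
  refine isLocalHomeomorph_of_isOpenMap continuous_quot_mk QuotientAddGroup.isOpenMap_coe
    fun x => ⟨Metric.ball x (1 / 2), Metric.isOpen_ball, Metric.mem_ball_self (by norm_num), ?_⟩
  intro y hy z hz hyz
  have h1 : -y + z ∈ S := QuotientAddGroup.eq.1 hyz
  have h2 : ‖-y + z‖ < 1 := by
    rw [neg_add_eq_sub, ← dist_eq_norm]
    have := dist_triangle_right z y x
    rw [Metric.mem_ball] at hy hz
    linarith
  have h3 := hS _ h1 h2
  rw [neg_add_eq_zero] at h3
  exact h3

theorem uniformization_mk {𝕜 E : Type*} [NontriviallyNormedField 𝕜] [NormedAddCommGroup E]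
    [NormedSpace 𝕜 E] (S : AddSubgroup E)
    (hS : IsLocalHomeomorph (QuotientAddGroup.mk : E → E ⧸ S)) :
    letI : ChartedSpace E (E ⧸ S) := hS.chartedSpace Quotient.mk_surjective
    IsUniformization 𝕜 (QuotientAddGroup.mk : E → E ⧸ S) := by
  let _ : ChartedSpace E (E ⧸ S) := hS.chartedSpace Quotient.mk_surjective
  refine ⟨Quotient.mk_surjective, atlas_symm_of_isLocalHomeomorph hS Quotient.mk_surjective, ?_⟩
  intro x y hxy
  have h1 : -x + y ∈ S := QuotientAddGroup.eq.1 hxy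
  refine ⟨fun z => z + (-x + y), contDiff_id.add contDiff_const, add_neg_cancel_left _ _, fun z => ?_⟩
  exact (QuotientAddGroup.mk_add_of_mem z h1)

theorem isLocalHomeomorph_torus2 : IsLocalHomeomorph (QuotientAddGroup.mk : ℂ → Torus2) :=
  isLocalHomeomorph_mk _ fun _ => intLattice_discrete

theorem isLocalHomeomorph_torus4 : IsLocalHomeomorph (QuotientAddGroup.mk : ℂ × ℂ → Torus4) :=
  isLocalHomeomorph_mk _ fun _ => intLattice_prod_discrete

/-- The charts of `𝕋²` are the local inverses of `ℂ → 𝕋²`. -/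
noncomputable instance : ChartedSpace ℂ Torus2 :=
  isLocalHomeomorph_torus2.chartedSpace Quotient.mk_surjective

/-- The charts of `𝕋⁴` are the local inverses of `ℂ² → 𝕋⁴`. -/
noncomputable instance : ChartedSpace (ℂ × ℂ) Torus4 :=
  isLocalHomeomorph_torus4.chartedSpace Quotient.mk_surjective

theorem uniformization_torus2 (𝕜 : Type*) [NontriviallyNormedField 𝕜] [NormedSpace 𝕜 ℂ] :
    IsUniformization 𝕜 (QuotientAddGroup.mk : ℂ → Torus2) := uniformization_mk _ _

theorem uniformization_torus4 (𝕜 : Type*) [NontriviallyNormedField 𝕜] [NormedSpace 𝕜 (ℂ × ℂ)] :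
    IsUniformization 𝕜 (QuotientAddGroup.mk : ℂ × ℂ → Torus4) := uniformization_mk _ _

instance : IsManifold 𝓘(ℝ, ℂ) ∞ Torus2 :=
  (uniformization_torus2 ℝ).isManifold.of_le le_top

instance : IsManifold 𝓘(ℝ, ℂ × ℂ) ∞ Torus4 :=
  (uniformization_torus4 ℝ).isManifold.of_le le_top

/-- The complex structure of `𝕋⁴`. -/
instance : IsManifold 𝓘(ℂ, ℂ × ℂ) ω Torus4 :=
  (uniformization_torus4 ℂ).isManifold

/-! ### The linear map and its suspension -/

/-- The complex-linear unipotent map `A (w, z) = (w + z, z)` of `ℂ²`. -/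
noncomputable def shear : (ℂ × ℂ) ≃L[ℂ] (ℂ × ℂ) where
  toFun p := (p.1 + p.2, p.2)
  invFun p := (p.1 - p.2, p.2)
  map_add' p q := by ext <;> simp; ring
  map_smul' c p := by ext <;> simp; ring
  left_inv p := by simp
  right_inv p := by simp
  continuous_toFun := by fun_prop
  continuous_invFun := by fun_prop

theorem shear_apply (p : ℂ × ℂ) : shear p = (p.1 + p.2, p.2) := rfl
theorem shear_symm_apply (p : ℂ × ℂ) : shear.symm p = (p.1 - p.2, p.2) := rfl

/-- In the real coordinates `(x₁, y₁, x₂, y₂)`, with `w = x₁ + i y₁` and `z = x₂ + i y₂`, the map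
`shear` is given by the integral matrix of the suspension. -/
theorem shear_matrix (p : ℂ × ℂ) :
    ![(shear p).1.re, (shear p).1.im, (shear p).2.re, (shear p).2.im] =
      (!![1, 0, 1, 0; 0, 1, 0, 1; 0, 0, 1, 0; 0, 0, 0, 1] : Matrix (Fin 4) (Fin 4) ℝ).mulVec
        ![p.1.re, p.1.im, p.2.re, p.2.im] := by
  ext i
  fin_cases i <;> simp [shear_apply, Matrix.mulVec, dotProduct, Fin.sum_univ_four]

theorem map_shear : (intLattice.prod intLattice).map (shear : (ℂ × ℂ) ≃+ (ℂ × ℂ)).toAddMonoidHom =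
    intLattice.prod intLattice := by
  ext p
  rw [AddSubgroup.mem_map]
  constructor
  · rintro ⟨q, hq, rfl⟩
    exact ⟨intLattice.add_mem hq.1 hq.2, hq.2⟩
  · intro hp
    exact ⟨shear.symm p, ⟨intLattice.sub_mem hp.1 hp.2, hp.2⟩, shear.apply_symm_apply p⟩

/-- The automorphism of `𝕋⁴` induced by `A`. -/
noncomputable def torusShear : Torus4 ≃ₜ Torus4 where
  toEquiv := (QuotientAddGroup.congr _ _ (shear : (ℂ × ℂ) ≃+ (ℂ × ℂ)) map_shear).toEquiv
  continuous_toFun := Continuous.quotient_lift (f := fun p => ((shear p : ℂ × ℂ) : Torus4)) (continuous_quot_mk.comp shear.continuous) _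
  continuous_invFun := Continuous.quotient_lift (f := fun p => ((shear.symm p : ℂ × ℂ) : Torus4)) (continuous_quot_mk.comp shear.symm.continuous) _

theorem torusShear_mk (p : ℂ × ℂ) : torusShear (p : Torus4) = (shear p : ℂ × ℂ) := rfl

theorem torusShear_zpow_mk (n : ℤ) (p : ℂ × ℂ) :
    (torusShear ^ n) (p : Torus4) = ((p.1 + n * p.2, p.2) : ℂ × ℂ) := by
  induction n using Int.induction_on generalizing p with
  | zero => simp
  | succ n ih =>
    rw [zpow_add_one, Homeomorph.mul_apply, torusShear_mk, ih, shear_apply]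
    push_cast
    congr 2
    ring
  | pred n ih =>
    rw [zpow_sub_one, Homeomorph.mul_apply]
    have : torusShear⁻¹ (p : Torus4) = (shear.symm p : ℂ × ℂ) := rfl
    rw [this, ih, shear_symm_apply]
    push_cast
    congr 2
    ring

/-- The relation `(p, s) ∼ (Aⁿ p, s + n)` on `𝕋⁴ × ℝ`. -/
def suspensionSetoid : Setoid (Torus4 × ℝ) where
  r x y := ∃ n : ℤ, (torusShear ^ n) x.1 = y.1 ∧ x.2 + n = y.2
  iseqv := {
    refl := fun x => ⟨0, by simp⟩
    symm := by
      rintro x y ⟨n, h1, h2⟩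
      refine ⟨-n, ?_, by push_cast; linarith⟩
      rw [← h1, ← Homeomorph.mul_apply, ← zpow_add]
      simp
    trans := by
      rintro x y z ⟨n, h1, h2⟩ ⟨m, h3, h4⟩
      refine ⟨m + n, ?_, by push_cast; linarith⟩
      rw [← h3, ← h1, ← Homeomorph.mul_apply, ← zpow_add] }

/-- The suspension of `𝕋⁴` by `A`: the 5-manifold `𝕋⁴ × ℝ / (p, s) ∼ (A p, s + 1)`, which is
`𝕋⁴ × [0, 1] / (p, 0) ∼ (A p, 1)`. -/
def Suspension : Type := Quotient suspensionSetoid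

namespace Suspension

instance : TopologicalSpace Suspension := inferInstanceAs (TopologicalSpace (Quotient _))

/-- The quotient map `𝕋⁴ × ℝ → M`. -/
def mk (x : Torus4 × ℝ) : Suspension := Quotient.mk suspensionSetoid x

theorem mk_eq_iff {x y : Torus4 × ℝ} :
    mk x = mk y ↔ ∃ n : ℤ, (torusShear ^ n) x.1 = y.1 ∧ x.2 + n = y.2 := Quotient.eq

theorem mk_surjective : Function.Surjective mk := Quotient.mk_surjective

theorem continuous_mk : Continuous mk := continuous_quotient_mk'

theorem isOpenMap_mk : IsOpenMap mk := by
  intro U hU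
  refine isOpen_coinduced.2 ?_
  have : mk ⁻¹' (mk '' U) = ⋃ n : ℤ, (fun y : Torus4 × ℝ => ((torusShear ^ n) y.1, y.2 + n)) ⁻¹' U := by
    ext y
    simp only [mem_preimage, mem_image, mem_iUnion]
    constructor
    · rintro ⟨x, hx, hxy⟩
      obtain ⟨n, h1, h2⟩ := mk_eq_iff.1 hxy.symm
      exact ⟨n, by rw [h1, h2]; exact hx⟩
    · rintro ⟨n, hn⟩
      exact ⟨_, hn, (mk_eq_iff.2 ⟨n, rfl, rfl⟩).symm⟩
  change IsOpen (mk ⁻¹' (mk '' U))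
  rw [this]
  refine isOpen_iUnion fun n => hU.preimage ?_
  exact ((torusShear ^ n).continuous.comp continuous_fst).prodMk (continuous_snd.add continuous_const)

theorem isLocalHomeomorph_mk : IsLocalHomeomorph mk := by
  refine isLocalHomeomorph_of_isOpenMap continuous_mk isOpenMap_mk fun x =>
    ⟨univ ×ˢ Ioo (x.2 - 1 / 2) (x.2 + 1 / 2), isOpen_univ.prod isOpen_Ioo, ⟨trivial, by constructor <;> linarith⟩, ?_⟩
  rintro y ⟨-, hy⟩ z ⟨-, hz⟩ hyz
  obtain ⟨n, h1, h2⟩ := mk_eq_iff.1 hyz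
  have hn : n = 0 := by
    have h3 : |(n : ℝ)| < 1 := by
      rw [abs_lt]; constructor <;> linarith [hy.1, hy.2, hz.1, hz.2]
    exact Int.abs_lt_one_iff.1 (by exact_mod_cast h3)
  subst hn
  exact Prod.ext (by simpa using h1) (by simpa using h2)

/-- The covering `ℂ² × ℝ → M`. -/
def proj (x : (ℂ × ℂ) × ℝ) : Suspension := mk ((x.1 : Torus4), x.2)

theorem proj_surjective : Function.Surjective proj := by
  intro q
  obtain ⟨⟨p, s⟩, rfl⟩ := mk_surjective q
  obtain ⟨v, rfl⟩ := QuotientAddGroup.mk_surjective p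
  exact ⟨(v, s), rfl⟩

theorem isLocalHomeomorph_proj : IsLocalHomeomorph proj := by
  refine isLocalHomeomorph_mk.comp (f := fun x : (ℂ × ℂ) × ℝ => ((x.1 : Torus4), x.2)) ?_
  refine isLocalHomeomorph_of_isOpenMap
    (isLocalHomeomorph_torus4.continuous.prodMap continuous_id)
    (isLocalHomeomorph_torus4.isOpenMap.prodMap IsOpenMap.id) fun x => ?_
  obtain ⟨U, hU, hUi⟩ := (isLocalHomeomorph_iff_isOpenEmbedding_restrict.1 isLocalHomeomorph_torus4) x.1
  refine ⟨interior U ×ˢ univ, isOpen_interior.prod isOpen_univ, ⟨mem_interior_iff_mem_nhds.2 hU, trivial⟩, ?_⟩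
  rintro y ⟨hy, -⟩ z ⟨hz, -⟩ hyz
  have h1 := (injOn_iff_injective.2 hUi.injective) (interior_subset hy) (interior_subset hz) (congrArg Prod.fst hyz)
  exact Prod.ext h1 (Prod.ext_iff.1 hyz).2

/-- The charts of `M` are the local inverses of the covering `ℂ² × ℝ → M`. -/
noncomputable instance : ChartedSpace ((ℂ × ℂ) × ℝ) Suspension :=
  isLocalHomeomorph_proj.chartedSpace proj_surjective

theorem uniformization_proj : IsUniformization ℝ proj := by
  refine ⟨proj_surjective, atlas_symm_of_isLocalHomeomorph isLocalHomeomorph_proj proj_surjective, ?_⟩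
  intro x y hxy
  obtain ⟨n, h1, h2⟩ := mk_eq_iff.1 hxy
  simp only at h1 h2
  rw [torusShear_zpow_mk] at h1
  have h3 := QuotientAddGroup.eq.1 h1
  refine ⟨fun v => ((v.1.1 + n * v.1.2, v.1.2) + (-(x.1.1 + n * x.1.2, x.1.2) + y.1), v.2 + n), ?_, ?_, ?_⟩
  · fun_prop
  · exact Prod.ext (add_neg_cancel_left _ _) h2
  · intro v
    refine (mk_eq_iff.2 ⟨n, ?_, rfl⟩).symm
    change (torusShear ^ n) (v.1 : Torus4) = _
    rw [torusShear_zpow_mk]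
    exact (QuotientAddGroup.mk_add_of_mem _ h3).symm

instance : IsManifold 𝓘(ℝ, (ℂ × ℂ) × ℝ) ∞ Suspension :=
  uniformization_proj.isManifold.of_le le_top

end Suspension

namespace Suspension

instance : T2Space Torus4 := by
  refine (t2Space_iff_of_isOpenQuotientMap (π := (QuotientAddGroup.mk : ℂ × ℂ → Torus4))
    ⟨QuotientAddGroup.mk_surjective, continuous_quot_mk, QuotientAddGroup.isOpenMap_coe⟩).2 ?_
  have hc : IsClosed ((intLattice.prod intLattice : AddSubgroup (ℂ × ℂ)) : Set (ℂ × ℂ)) := by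
    have : (intLattice : Set ℂ) = Complex.re ⁻¹' (range ((↑) : ℤ → ℝ)) ∩
        Complex.im ⁻¹' (range ((↑) : ℤ → ℝ)) := by
      ext z
      constructor
      · rintro ⟨m, n, rfl⟩
        exact ⟨⟨m, by simp⟩, ⟨n, by simp⟩⟩
      · rintro ⟨⟨m, hm⟩, ⟨n, hn⟩⟩
        exact ⟨m, n, Complex.ext (by simp [hm]) (by simp [hn])⟩
    have h1 : IsClosed (intLattice : Set ℂ) := by
      rw [this]
      have h2 : IsClosed (range ((↑) : ℤ → ℝ)) := Int.isClosedEmbedding_coe_real.isClosed_range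
      exact (h2.preimage Complex.continuous_re).inter (h2.preimage Complex.continuous_im)
    exact h1.prod h1
  have : {q : (ℂ × ℂ) × (ℂ × ℂ) | (q.1 : Torus4) = q.2} = (fun q => -q.1 + q.2) ⁻¹'
      ((intLattice.prod intLattice : AddSubgroup (ℂ × ℂ)) : Set (ℂ × ℂ)) := by
    ext q
    exact QuotientAddGroup.eq
  rw [this]
  exact hc.preimage (by fun_prop)

instance : T2Space Suspension := by
  refine (t2Space_iff_of_isOpenQuotientMap (π := mk)
    ⟨mk_surjective, continuous_mk, isOpenMap_mk⟩).2 ?_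
  have hU : {q : (Torus4 × ℝ) × (Torus4 × ℝ) | mk q.1 = mk q.2} =
      ⋃ n : ℤ, {q : (Torus4 × ℝ) × (Torus4 × ℝ) | (torusShear ^ n) q.1.1 = q.2.1 ∧ q.1.2 + (n : ℝ) = q.2.2} := by
    ext q
    simp [mk_eq_iff]
  rw [hU]
  refine LocallyFinite.isClosed_iUnion ?_ fun n => ?_
  · intro q
    refine ⟨{p | |(p.2.2 - p.1.2) - (q.2.2 - q.1.2)| < 1}, ?_, ?_⟩
    · refine IsOpen.mem_nhds (isOpen_lt (by fun_prop) continuous_const) (by simp)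
    · refine (Set.finite_Icc (⌊q.2.2 - q.1.2 - 1⌋) (⌈q.2.2 - q.1.2 + 1⌉)).subset ?_
      rintro n ⟨p, ⟨-, hp⟩, hp'⟩
      have h3 : p.2.2 - p.1.2 = n := by linarith
      rw [mem_ofPred_eq, h3, abs_lt] at hp'
      constructor
      · exact_mod_cast (Int.floor_le _).trans (by linarith [hp'.1] : _ ≤ (n : ℝ))
      · exact_mod_cast (by linarith [hp'.2] : (n : ℝ) ≤ _).trans (Int.le_ceil _)
  · refine IsClosed.inter (isClosed_eq ?_ (by fun_prop)) (isClosed_eq (by fun_prop) (by fun_prop))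
    exact (torusShear ^ n).continuous.comp (by fun_prop)

instance : CompactSpace Suspension := by
  refine ⟨?_⟩
  have hK : IsCompact (((Icc (0 : ℝ) 1 ×ℂ Icc (0 : ℝ) 1) ×ˢ (Icc (0 : ℝ) 1 ×ℂ Icc (0 : ℝ) 1)) ×ˢ
      Icc (0 : ℝ) 1) :=
    ((isCompact_Icc.reProdIm isCompact_Icc).prod (isCompact_Icc.reProdIm isCompact_Icc)).prod
      isCompact_Icc
  have h1 := hK.image isLocalHomeomorph_proj.continuous
  convert h1
  symm
  rw [eq_univ_iff_forall]
  intro q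
  obtain ⟨⟨p, s⟩, rfl⟩ := mk_surjective q
  have h2 : mk (p, s) = mk ((torusShear ^ (-⌊s⌋)) p, Int.fract s) :=
    mk_eq_iff.2 ⟨-⌊s⌋, rfl, by
      rw [Int.cast_neg, ← sub_eq_add_neg]
      exact Int.self_sub_floor s⟩
  rw [h2]
  obtain ⟨v, hv⟩ := QuotientAddGroup.mk_surjective ((torusShear ^ (-⌊s⌋)) p)
  let r : ℂ → ℂ := fun z => ⟨Int.fract z.re, Int.fract z.im⟩
  have hr : ∀ z, -z + r z ∈ intLattice := fun z => ⟨-⌊z.re⌋, -⌊z.im⌋, by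
    have h3 := Int.self_sub_floor z.re
    have h4 := Int.self_sub_floor z.im
    apply Complex.ext
    · simp only [r, Complex.add_re, Complex.neg_re, Complex.mul_re, Complex.intCast_re,
        Complex.intCast_im, Complex.I_re, Complex.I_im]
      push_cast
      linarith
    · simp only [r, Complex.add_im, Complex.neg_im, Complex.mul_im, Complex.intCast_re,
        Complex.intCast_im, Complex.I_re, Complex.I_im]
      push_cast
      linarith⟩
  have hr' : ∀ z, r z ∈ (Icc (0 : ℝ) 1 ×ℂ Icc (0 : ℝ) 1) := fun z =>
    ⟨⟨Int.fract_nonneg _, (Int.fract_lt_one _).le⟩, ⟨Int.fract_nonneg _, (Int.fract_lt_one _).le⟩⟩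
  refine ⟨((r v.1, r v.2), Int.fract s), ⟨⟨hr' _, hr' _⟩,
    Int.fract_nonneg _, (Int.fract_lt_one _).le⟩, ?_⟩
  rw [← hv]
  refine congrArg (fun p => mk (p, Int.fract s)) ?_
  have h5 : -v + (r v.1, r v.2) ∈ intLattice.prod intLattice := ⟨hr _, hr _⟩
  exact (QuotientAddGroup.eq.2 h5).symm

/-- The part of `M` over the open arc `(a, a + 1/2)` of the circle `ℝ / ℤ`. -/
def chartDomain (a : ℝ) : Set Suspension := mk '' (univ ×ˢ Ioo a (a + 1 / 2))

/-- The projection to `𝕋⁴` along the lines `{p} × ℝ`, cut open at `a`: the class of `(p, s)` with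
`s ∈ [a, a + 1)` goes to `p`. -/
noncomputable def transverseProj (a : ℝ) : Suspension → Torus4 :=
  Quotient.lift (fun x => (torusShear ^ (-⌊x.2 - a⌋)) x.1) <| by
    rintro x y ⟨n, h1, h2⟩
    have h3 : y.2 - a = x.2 - a + n := by linarith
    change (torusShear ^ (-⌊x.2 - a⌋)) x.1 = (torusShear ^ (-⌊y.2 - a⌋)) y.1
    rw [h3, ← h1, Int.floor_add_intCast, ← Homeomorph.mul_apply, ← zpow_add]
    congr 2
    ring

theorem transverseProj_mk (a : ℝ) (x : Torus4 × ℝ) :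
    transverseProj a (mk x) = (torusShear ^ (-⌊x.2 - a⌋)) x.1 := rfl

theorem transverseProj_of_mem {a : ℝ} {x : Torus4 × ℝ} (hx : x.2 ∈ Ioo a (a + 1 / 2)) :
    transverseProj a (mk x) = x.1 := by
  have : ⌊x.2 - a⌋ = 0 := by
    rw [Int.floor_eq_iff]
    constructor <;> push_cast <;> linarith [hx.1, hx.2]
  rw [transverseProj_mk, this]
  simp

theorem contMDiffOn_transverseProj (a : ℝ) :
    ContMDiffOn 𝓘(ℝ, (ℂ × ℂ) × ℝ) 𝓘(ℝ, ℂ × ℂ) ∞ (transverseProj a) (chartDomain a) := by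
  rintro q ⟨⟨p, s⟩, ⟨-, hs⟩, rfl⟩
  refine ContMDiffAt.contMDiffWithinAt ?_
  refine uniformization_proj.contMDiffAt_of_comp fun y hy => ?_
  obtain ⟨n, h1, h2⟩ := mk_eq_iff.1 hy
  simp only at h1 h2 hs
  have hev : transverseProj a ∘ proj =ᶠ[𝓝 y] fun x =>
      (((x.1.1 + (n : ℂ) * x.1.2, x.1.2) : ℂ × ℂ) : Torus4) := by
    have hn : ∀ᶠ x : (ℂ × ℂ) × ℝ in 𝓝 y, x.2 + n ∈ Ioo a (a + 1 / 2) := by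
      refine ContinuousAt.eventually_mem (by fun_prop) (isOpen_Ioo.mem_nhds ?_)
      rw [h2]; exact hs
    filter_upwards [hn] with x hx
    have hfl : -⌊x.2 - a⌋ = n := by
      rw [neg_eq_iff_eq_neg, Int.floor_eq_iff]
      constructor <;> push_cast <;> linarith [hx.1, hx.2]
    change (torusShear ^ (-⌊x.2 - a⌋)) (x.1 : Torus4) = _
    rw [hfl, torusShear_zpow_mk]
  refine ContMDiffAt.congr_of_eventuallyEq ?_ hev
  refine ContMDiffAt.comp (g := (QuotientAddGroup.mk : ℂ × ℂ → Torus4)) y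
    (((uniformization_torus4 ℝ).contMDiff.of_le le_top).contMDiffAt) ?_
  refine ContDiffAt.contMDiffAt ?_
  fun_prop

theorem surjective_mfderiv_transverseProj (a : ℝ) (q : Suspension) (hq : q ∈ chartDomain a) :
    Function.Surjective (mfderiv 𝓘(ℝ, (ℂ × ℂ) × ℝ) 𝓘(ℝ, ℂ × ℂ) (transverseProj a) q) := by
  have hsm := contMDiffOn_transverseProj a
  have hopen : IsOpen (chartDomain a) := isOpenMap_mk _ (isOpen_univ.prod isOpen_Ioo)
  have hd := (hsm.contMDiffAt (hopen.mem_nhds hq)).mdifferentiableAt (by simp)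
  obtain ⟨⟨p, s⟩, ⟨-, hs⟩, rfl⟩ := hq
  obtain ⟨v, rfl⟩ := QuotientAddGroup.mk_surjective p
  have hev : transverseProj a ∘ proj =ᶠ[𝓝 (v, s)] (QuotientAddGroup.mk : ℂ × ℂ → Torus4) ∘ Prod.fst := by
    have hn : ∀ᶠ x : (ℂ × ℂ) × ℝ in 𝓝 (v, s), x.2 ∈ Ioo a (a + 1 / 2) :=
      ContinuousAt.eventually_mem (by fun_prop) (isOpen_Ioo.mem_nhds hs)
    filter_upwards [hn] with x hx
    exact transverseProj_of_mem hx
  have h1 := mfderiv_comp (I' := 𝓘(ℝ, (ℂ × ℂ) × ℝ)) (f := proj) (v, s) hd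
    ((uniformization_proj.contMDiff _).mdifferentiableAt (by simp))
  have h2 := mfderiv_comp (I := 𝓘(ℝ, (ℂ × ℂ) × ℝ)) (I' := 𝓘(ℝ, ℂ × ℂ)) (I'' := 𝓘(ℝ, ℂ × ℂ))
    (g := (QuotientAddGroup.mk : ℂ × ℂ → Torus4)) (f := Prod.fst) (v, s)
    (((uniformization_torus4 ℝ).contMDiff _).mdifferentiableAt (by simp))
    (contDiff_fst.contMDiff.contMDiffAt.mdifferentiableAt (n := 1) (by simp))
  have h3 := hev.mfderiv_eq (I := 𝓘(ℝ, (ℂ × ℂ) × ℝ)) (I' := 𝓘(ℝ, ℂ × ℂ))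
  have h4 : Function.Surjective (mfderiv 𝓘(ℝ, (ℂ × ℂ) × ℝ) 𝓘(ℝ, ℂ × ℂ)
      ((QuotientAddGroup.mk : ℂ × ℂ → Torus4) ∘ Prod.fst) ((v, s) : (ℂ × ℂ) × ℝ)) := by
    rw [h2]
    refine ((uniformization_torus4 ℝ).surjective_mfderiv v).comp ?_
    rw [mfderiv_eq_fderiv, fderiv_fst]
    exact Prod.fst_surjective
  have h5 : Function.Surjective ((mfderiv 𝓘(ℝ, (ℂ × ℂ) × ℝ) 𝓘(ℝ, ℂ × ℂ) (transverseProj a) (proj (v, s))).comp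
      (mfderiv 𝓘(ℝ, (ℂ × ℂ) × ℝ) 𝓘(ℝ, (ℂ × ℂ) × ℝ) proj (v, s))) := by
    rw [← h1, h3]; exact h4
  exact Function.Surjective.of_comp h5

theorem contMDiff_torusShear_zpow (n : ℤ) :
    ContMDiff 𝓘(ℝ, ℂ × ℂ) 𝓘(ℝ, ℂ × ℂ) ∞ (torusShear ^ n) := by
  intro q
  refine (uniformization_torus4 ℝ).contMDiffAt_of_comp fun y _ => ?_
  have : (torusShear ^ n) ∘ (QuotientAddGroup.mk : ℂ × ℂ → Torus4) =
      (QuotientAddGroup.mk : ℂ × ℂ → Torus4) ∘ fun x => (x.1 + (n : ℂ) * x.2, x.2) :=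
    funext fun x => torusShear_zpow_mk n x
  rw [this]
  refine ContMDiffAt.comp y
    (((uniformization_torus4 ℝ).contMDiff.of_le le_top).contMDiffAt) ?_
  refine ContDiffAt.contMDiffAt ?_
  fun_prop

/-- The suspension foliation on `M`, whose leaves are the images of the lines `{p} × ℝ`. Its
holonomy pseudogroup on `𝕋⁴` is generated by `A`. -/
noncomputable def foliation : Foliation ((ℂ × ℂ) × ℝ) Suspension (ℂ × ℂ) Torus4 where
  ι := ℝ
  U := chartDomain
  isOpen_U a := isOpenMap_mk _ (isOpen_univ.prod isOpen_Ioo)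
  cover := by
    rw [eq_univ_iff_forall]
    intro q
    obtain ⟨⟨p, s⟩, rfl⟩ := mk_surjective q
    exact mem_iUnion.2 ⟨s - 1 / 4, _, ⟨trivial, by constructor <;> simp only <;> linarith⟩, rfl⟩
  f := transverseProj
  smooth_f := contMDiffOn_transverseProj
  submersion_f := surjective_mfderiv_transverseProj
  connected_plaque a t _ := by
    have : chartDomain a ∩ transverseProj a ⁻¹' {t} = mk '' ({t} ×ˢ Ioo a (a + 1 / 2)) := by
      ext q
      constructor
      · rintro ⟨⟨x, hx, rfl⟩, ht⟩
        rw [mem_preimage, transverseProj_of_mem hx.2] at ht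
        exact ⟨x, ⟨ht, hx.2⟩, rfl⟩
      · rintro ⟨x, hx, rfl⟩
        refine ⟨⟨x, ⟨trivial, hx.2⟩, rfl⟩, ?_⟩
        rw [mem_preimage, transverseProj_of_mem hx.2]
        exact hx.1
    rw [this]
    exact (isConnected_singleton.prod (isConnected_Ioo (by linarith))).image _
      continuous_mk.continuousOn
  γ a b := (torusShear ^ round (b - a)).toOpenPartialHomeomorph
  smooth_γ a b _ := (contMDiff_torusShear_zpow _).contMDiffOn
  smooth_γ_symm a b _ := by
    have h : ⇑(torusShear ^ round (b - a)).toOpenPartialHomeomorph.symm =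
        ⇑(torusShear ^ (-round (b - a))) := by rw [zpow_neg]; rfl
    rw [h]
    exact (contMDiff_torusShear_zpow _).contMDiffOn
  mem_source _ _ _ _ := trivial
  cocycle a b q hq := by
    obtain ⟨⟨x, hx, rfl⟩, ⟨y, hy, hxy⟩⟩ := hq
    obtain ⟨n, h1, h2⟩ := mk_eq_iff.1 hxy.symm
    have hn : round (b - a) = n := by
      rw [round_eq, Int.floor_eq_iff]
      constructor <;> linarith [hx.2.1, hx.2.2, hy.2.1, hy.2.2]
    rw [transverseProj_of_mem hx.2, ← hxy, transverseProj_of_mem hy.2, hn, ← h1]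
    rfl

end Suspension

/-! ### Smooth functions on `𝕋²` and the space `V` -/

/-- The space `C^∞(𝕋², ℂ)`. -/
def SmoothTorus2 : Submodule ℂ (Torus2 → ℂ) where
  carrier := {g | ContMDiff 𝓘(ℝ, ℂ) 𝓘(ℝ, ℂ) ∞ g}
  add_mem' := fun hf hg => hf.add hg
  zero_mem' := contMDiff_const
  smul_mem' := fun c _ hf =>
    ((contDiff_const_smul (𝕜 := ℝ) (n := ∞) (F := ℂ) c).contMDiff).comp hf

/-- A function on `𝕋²`, seen as a periodic function on `ℂ`. -/
def periodic (g : SmoothTorus2) (z : ℂ) : ℂ := g.1 (z : Torus2)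

theorem contDiff_periodic (g : SmoothTorus2) : ContDiff ℝ ∞ (periodic g) :=
  contMDiff_iff_contDiff.1
    (ContMDiff.comp g.2 ((uniformization_torus2 ℝ).contMDiff.of_le le_top))

theorem differentiable_periodic (g : SmoothTorus2) : Differentiable ℝ (periodic g) :=
  (contDiff_periodic g).differentiable (by simp)

/-- The operator `∂ / ∂z = (∂ / ∂x - i ∂ / ∂y) / 2`. -/
noncomputable def wirtinger (g : ℂ → ℂ) (z : ℂ) : ℂ :=
  (fderiv ℝ g z 1 - Complex.I * fderiv ℝ g z Complex.I) / 2

/-- The operator `∂ / ∂z̄ = (∂ / ∂x + i ∂ / ∂y) / 2`. -/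
noncomputable def wirtingerBar (g : ℂ → ℂ) (z : ℂ) : ℂ :=
  (fderiv ℝ g z 1 + Complex.I * fderiv ℝ g z Complex.I) / 2

theorem fderiv_periodic_add (f g : SmoothTorus2) (z v : ℂ) :
    fderiv ℝ (periodic (f + g)) z v = fderiv ℝ (periodic f) z v + fderiv ℝ (periodic g) z v := by
  have : periodic (f + g) = periodic f + periodic g := rfl
  rw [this, fderiv_add (differentiable_periodic f z) (differentiable_periodic g z)]
  rfl

theorem fderiv_periodic_smul (c : ℂ) (g : SmoothTorus2) (z v : ℂ) :
    fderiv ℝ (periodic (c • g)) z v = c * fderiv ℝ (periodic g) z v := by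
  have : periodic (c • g) = c • periodic g := rfl
  rw [this, fderiv_const_smul (differentiable_periodic g z)]
  rfl

theorem fderiv_periodic_zero (z v : ℂ) : fderiv ℝ (periodic 0) z v = 0 := by
  have h := fderiv_periodic_smul 0 0 z v
  rwa [zero_smul, zero_mul] at h

/-- The space `V` of triples `(b, c, e)` of smooth functions on `𝕋²` with
`∂b/∂z̄ = ∂c/∂z` and `∂c/∂z̄ = ∂e/∂z`. -/
def spaceV : Submodule ℂ (SmoothTorus2 × SmoothTorus2 × SmoothTorus2) where
  carrier := {p | ∀ z,
    wirtingerBar (periodic p.1) z - wirtinger (periodic p.2.1) z = 0 ∧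
    wirtingerBar (periodic p.2.1) z - wirtinger (periodic p.2.2) z = 0}
  add_mem' := by
    intro p q hp hq z
    obtain ⟨h1, h2⟩ := hp z
    obtain ⟨h3, h4⟩ := hq z
    simp only [wirtinger, wirtingerBar, Prod.fst_add, Prod.snd_add, fderiv_periodic_add] at *
    constructor
    · linear_combination h1 + h3
    · linear_combination h2 + h4
  zero_mem' := by
    intro z
    simp [wirtinger, wirtingerBar, fderiv_periodic_zero]
  smul_mem' := by
    intro c p hp z
    obtain ⟨h1, h2⟩ := hp z
    simp only [wirtinger, wirtingerBar, Prod.smul_fst, Prod.smul_snd, fderiv_periodic_smul] at *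
    constructor
    · linear_combination c * h1
    · linear_combination c * h2

/-! ### Representatives of cohomology classes -/

namespace Suspension

/-- The covector `dw` on the covering `ℂ² × ℝ` of `M`, which has coordinates `((w, z), s)`. -/
def dw (u : (ℂ × ℂ) × ℝ) : ℂ := u.1.1

/-- The covector `dz`. -/
def dz (u : (ℂ × ℂ) × ℝ) : ℂ := u.1.2

/-- The covector `dw̄`. -/
def dwBar (u : (ℂ × ℂ) × ℝ) : ℂ := (starRingEnd ℂ) u.1.1

/-- The covector `dz̄`. -/
def dzBar (u : (ℂ × ℂ) × ℝ) : ℂ := (starRingEnd ℂ) u.1.2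

/-- The wedge product `θ₁ ∧ … ∧ θₖ` of covectors, evaluated on `u₁, …, uₖ`. -/
noncomputable def wedge {k : ℕ} (θ : Fin k → ((ℂ × ℂ) × ℝ → ℂ)) (u : Fin k → (ℂ × ℂ) × ℝ) : ℂ :=
  Matrix.det (Matrix.of fun i j => θ i (u j))

/-- The basic class `h` contains a closed basic form whose pullback to `ℂ² × ℝ`, at the point `x`,
takes the value `η x u` on `u₁, …, uₖ`. -/
def IsRepresentedBy {k : ℕ} (h : foliation.basicCohomology ℂ k)
    (η : (ℂ × ℂ) × ℝ → (Fin k → (ℂ × ℂ) × ℝ) → ℂ) : Prop :=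
  ∃ α : foliation.closedForms ℂ k, Submodule.Quotient.mk α = h ∧
    ∀ x (u : Fin k → (ℂ × ℂ) × ℝ), RoughForm.pullback proj α.1 x u = η x u

end Suspension

/-! ### Smoothness of parametric integrals -/

/-! Pulled back to the covering `ℂ² × ℝ`, a basic form has no `ds` component and does not depend on
`s`, and it is invariant under the deck transformations, which combine lattice translations with
`(w, z) ↦ (w + n z, z)`. Being lattice periodic and independent of `s`, its values on fixed vectors
are bounded (`exists_bound_lift`).

Two observations determine the basic complex. First, fix a point and vectors `u`. The value of the
form on `Aⁿ u` is a polynomial in `n`, because `A` is unipotent. By deck invariance it is also the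
value on `u` at another point, so it is bounded in `n`, hence constant. Thus the form is invariant
under `A` at each point separately (`lift_shear`), and its coefficients are `A`-invariant functions
on `𝕋⁴`. Second, a continuous `A`-invariant function depends on `z` alone (`eq_of_shear_invariant`),
because arbitrarily close to any `z` there are fibres in which two prescribed values of `w` lie on
one orbit.

The basic complex is therefore `C^∞(𝕋²)` tensored with the `A`-invariant covectors, of dimensions 1,
2, 4, 2, 1 in degrees 0 to 4 (`InvariantBasis.exists_form_eq` and `basisZero` to `basisFour`). In
coefficients the differentials are `f ↦ (∂f, ∂̄f)`, then `(b, e) ↦ ∂e - ∂̄b` in the `dz ∧ dz̄` slot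
only, then `(b, c, e, g) ↦ (∂̄b - ∂c, ∂̄c - ∂e)`, then zero.

What remains is analysis on `𝕋²`. Closed 1-forms are constant forms plus differentials
(`exists_wirtinger_primitive`). Every function is a constant plus some `∂̄b - ∂c`, every pair is a
constant pair plus some `(∂̄b - ∂c, ∂̄c - ∂e)` (`exists_wirtinger_divergence_pair`), and no nonzero
constant has the form `∂̄b - ∂c` (`eq_zero_of_wirtinger_divergence`). Degree 2 keeps the whole
kernel `V`, because exact forms only meet the `dz ∧ dz̄` coefficient; degree 4 keeps all functions,
because nothing is exact there; in degree 3 only constants survive. The characters of `𝕋²` in the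
real part of `z` show that `V` and `C^∞(𝕋²)` are infinite dimensional. -/

/-- Differentiation under the integral sign: the partial derivative is continuous, hence bounded on
the compact product of a closed ball and `[0, 1]`, and that bound dominates. -/
theorem hasFDerivAt_integral_param {E F : Type} [NormedAddCommGroup E] [NormedSpace ℝ E]
    [ProperSpace E] [NormedAddCommGroup F] [NormedSpace ℝ F]
    {G : E × ℝ → F} (hG : ContDiff ℝ 1 G) (p : E) :
    HasFDerivAt (fun p => ∫ t in (0 : ℝ)..1, G (p, t))
      (∫ t in (0 : ℝ)..1, (fderiv ℝ G (p, t)).comp (ContinuousLinearMap.inl ℝ E ℝ)) p := by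
  have hc : Continuous fun q : E × ℝ => (fderiv ℝ G q).comp (ContinuousLinearMap.inl ℝ E ℝ) :=
    (hG.continuous_fderiv (by simp)).clm_comp continuous_const
  obtain ⟨C, hC⟩ := ((isCompact_closedBall p 1).prod (isCompact_Icc (a := (0 : ℝ)) (b := 1))).exists_bound_of_continuousOn
    hc.continuousOn
  refine intervalIntegral.hasFDerivAt_integral_of_dominated_of_fderiv_le (𝕜 := ℝ)
    (F := fun p t => G (p, t)) (bound := fun _ => C)
    (F' := fun p t => (fderiv ℝ G (p, t)).comp (ContinuousLinearMap.inl ℝ E ℝ))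
    (Metric.ball_mem_nhds p one_pos) ?_ ?_ ?_ ?_ ?_ ?_
  · refine Filter.Eventually.of_forall fun q => ?_
    exact (hG.continuous.comp (by fun_prop : Continuous fun t : ℝ => (q, t))).aestronglyMeasurable
  · exact (hG.continuous.comp (by fun_prop : Continuous fun t : ℝ => (p, t))).intervalIntegrable _ _
  · exact (hc.comp (by fun_prop : Continuous fun t : ℝ => (p, t))).aestronglyMeasurable
  · refine Filter.Eventually.of_forall fun t ht q hq => hC (q, t) ⟨Metric.ball_subset_closedBall hq, ?_⟩
    rw [uIoc_of_le zero_le_one] at ht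
    exact ⟨ht.1.le, ht.2⟩
  · exact intervalIntegrable_const
  · refine Filter.Eventually.of_forall fun t _ q _ => ?_
    exact ((hG.differentiable one_ne_zero (q, t)).hasFDerivAt).comp q (hasFDerivAt_prodMk_left q t)

/-- Induction on the order: the derivative is again a parametric integral, now with values in `E
→L[ℝ] F`. This is why `F` and `G` are quantified after `n`. -/
theorem contDiff_nat_integral_param {E : Type} [NormedAddCommGroup E] [NormedSpace ℝ E]
    [ProperSpace E] (n : ℕ) : ∀ {F : Type} [NormedAddCommGroup F] [NormedSpace ℝ F]
    {G : E × ℝ → F}, ContDiff ℝ ∞ G →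
    ContDiff ℝ n (fun p => ∫ t in (0 : ℝ)..1, G (p, t)) := by
  induction n with
  | zero =>
    intro F _ _ G hG
    refine contDiff_zero.2 (continuous_iff_continuousAt.2 fun p => ?_)
    exact (hasFDerivAt_integral_param (hG.of_le (by simp)) p).continuousAt
  | succ n ih =>
    intro F _ _ G hG
    refine (contDiff_succ_iff_hasFDerivAt (n := n)).2
      ⟨_, ?_, hasFDerivAt_integral_param (hG.of_le (by simp))⟩
    refine ih (G := fun q => (fderiv ℝ G q).comp (ContinuousLinearMap.inl ℝ E ℝ)) ?_
    exact (hG.fderiv_right (m := ∞) (by simp)).clm_comp contDiff_const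

theorem contDiff_integral_param {E F : Type} [NormedAddCommGroup E] [NormedSpace ℝ E]
    [ProperSpace E] [NormedAddCommGroup F] [NormedSpace ℝ F]
    {G : E × ℝ → F} (hG : ContDiff ℝ ∞ G) :
    ContDiff ℝ ∞ (fun p => ∫ t in (0 : ℝ)..1, G (p, t)) :=
  contDiff_infty.2 fun n => contDiff_nat_integral_param n hG

/-! ### Smooth doubly periodic functions on `ℂ` -/

/-- Smooth functions on `ℂ` with periods `1` and `i`. -/
structure IsSmoothPeriodic (f : ℂ → ℂ) : Prop where
  contDiff : ContDiff ℝ ∞ f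
  add_one : ∀ z, f (z + 1) = f z
  add_I : ∀ z, f (z + Complex.I) = f z

namespace IsSmoothPeriodic

variable {f g : ℂ → ℂ}

theorem differentiable (hf : IsSmoothPeriodic f) : Differentiable ℝ f :=
  hf.contDiff.differentiable (by simp)

theorem const (c : ℂ) : IsSmoothPeriodic fun _ => c := ⟨contDiff_const, fun _ => rfl, fun _ => rfl⟩

theorem add (hf : IsSmoothPeriodic f) (hg : IsSmoothPeriodic g) :
    IsSmoothPeriodic fun z => f z + g z :=
  ⟨hf.contDiff.add hg.contDiff, fun z => by rw [hf.add_one, hg.add_one],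
    fun z => by rw [hf.add_I, hg.add_I]⟩

theorem const_mul (hf : IsSmoothPeriodic f) (c : ℂ) : IsSmoothPeriodic fun z => c * f z :=
  ⟨contDiff_const.mul hf.contDiff, fun z => by rw [hf.add_one], fun z => by rw [hf.add_I]⟩

theorem fderiv_apply (hf : IsSmoothPeriodic f) (v : ℂ) :
    IsSmoothPeriodic fun z => fderiv ℝ f z v := by
  refine ⟨(hf.contDiff.fderiv_right (m := ∞) (by simp)).clm_apply contDiff_const,
    fun z => ?_, fun z => ?_⟩
  · rw [← fderiv_comp_add_right, funext hf.add_one]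
  · rw [← fderiv_comp_add_right, funext hf.add_I]

/-- The reflection exchanging the two real coordinates. -/
theorem swap (hf : IsSmoothPeriodic f) :
    IsSmoothPeriodic fun z => f (Complex.I * (starRingEnd ℂ) z) := by
  refine ⟨hf.contDiff.comp (contDiff_const.mul Complex.conjCLE.contDiff), fun z => ?_, fun z => ?_⟩
  · rw [map_add, mul_add, map_one, mul_one, hf.add_I]
  · rw [map_add, mul_add, Complex.conj_I, mul_neg, Complex.I_mul_I, neg_neg, hf.add_one]

theorem fderiv_swap (hf : IsSmoothPeriodic f) (z v : ℂ) :
    fderiv ℝ (fun z => f (Complex.I * (starRingEnd ℂ) z)) z v =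
      fderiv ℝ f (Complex.I * (starRingEnd ℂ) z) (Complex.I * (starRingEnd ℂ) v) := by
  have h1 : HasFDerivAt (fun z => Complex.I * (starRingEnd ℂ) z)
      (((ContinuousLinearMap.mul ℝ ℂ Complex.I).comp (Complex.conjCLE : ℂ →L[ℝ] ℂ))) z :=
    ((ContinuousLinearMap.mul ℝ ℂ Complex.I).comp (Complex.conjCLE : ℂ →L[ℝ] ℂ)).hasFDerivAt
  have h2 := (hf.differentiable (Complex.I * (starRingEnd ℂ) z)).hasFDerivAt.comp z h1
  exact congrArg (fun L : ℂ →L[ℝ] ℂ => L v) h2.fderiv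

end IsSmoothPeriodic

theorem swap_swap (z : ℂ) :
    Complex.I * (starRingEnd ℂ) (Complex.I * (starRingEnd ℂ) z) = z := by
  rw [map_mul, Complex.conj_conj, Complex.conj_I, ← mul_assoc, mul_neg, Complex.I_mul_I]; simp

/-- A primitive in the first real coordinate of a periodic function minus its average. -/
theorem exists_primitive_re {h : ℂ → ℂ} (hh : IsSmoothPeriodic h) :
    ∃ P, IsSmoothPeriodic P ∧
      (∀ z, fderiv ℝ P z 1 = h z - ∫ t in (0 : ℝ)..1, h (t + z.im * Complex.I)) ∧
      ∀ s : ℝ, (∀ z, h (z + s * Complex.I) = h z) → ∀ z, P (z + s * Complex.I) = P z := by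
  let m : ℂ → ℂ := fun z => ∫ t in (0 : ℝ)..1, h (t + z.im * Complex.I)
  -- This is `∫₀ˣ h(t, y) dt - x m(y)` with `z = x + i y`, rescaled so that the interval is fixed
  -- and smoothness in `z` follows from `contDiff_integral_param`. The unscaled form is recovered in
  -- `hP`.
  let P : ℂ → ℂ := fun z =>
    z.re * (∫ t in (0 : ℝ)..1, h (((z.re * t : ℝ) : ℂ) + z.im * Complex.I)) - z.re * m z
  have hre : ContDiff ℝ ∞ fun z : ℂ => (z.re : ℂ) :=
    Complex.ofRealCLM.contDiff.comp Complex.reCLM.contDiff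
  have him : ContDiff ℝ ∞ fun z : ℂ => (z.im : ℂ) :=
    Complex.ofRealCLM.contDiff.comp Complex.imCLM.contDiff
  have hofReal : ContDiff ℝ ∞ fun t : ℝ => (t : ℂ) := Complex.ofRealCLM.contDiff
  have hm : ContDiff ℝ ∞ m := by
    refine contDiff_integral_param (G := fun q : ℂ × ℝ => h (q.2 + q.1.im * Complex.I)) ?_
    refine hh.contDiff.comp ?_
    exact (hofReal.comp contDiff_snd).add ((him.comp contDiff_fst).mul contDiff_const)
  have hPs : ContDiff ℝ ∞ P := by
    refine (hre.mul ?_).sub (hre.mul hm)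
    refine contDiff_integral_param
      (G := fun q : ℂ × ℝ => h (((q.1.re * q.2 : ℝ) : ℂ) + q.1.im * Complex.I)) ?_
    refine hh.contDiff.comp ?_
    refine ContDiff.add ?_ ((him.comp contDiff_fst).mul contDiff_const)
    simp only [Complex.ofReal_mul]
    exact (hre.comp contDiff_fst).mul (hofReal.comp contDiff_snd)
  have hP : ∀ z, P z = (∫ t in (0 : ℝ)..z.re, h (t + z.im * Complex.I)) - z.re * m z := by
    intro z
    have := intervalIntegral.smul_integral_comp_mul_left (a := 0) (b := 1)
      (fun t : ℝ => h (t + z.im * Complex.I)) z.re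
    rw [mul_zero, mul_one, Complex.real_smul] at this
    simp only [P]
    rw [this]
  have hcont : ∀ z : ℂ, Continuous fun t : ℝ => h (t + z.im * Complex.I) := fun z =>
    hh.contDiff.continuous.comp (by fun_prop)
  have hper : ∀ z : ℂ, Function.Periodic (fun t : ℝ => h (t + z.im * Complex.I)) 1 := fun z t => by
    have := hh.add_one (t + z.im * Complex.I)
    simp only [Complex.ofReal_add, Complex.ofReal_one]
    rw [← this]; congr 1; ring
  -- The primitive inherits every vertical period of `h`, for real `s`. With `s = 1` this gives the
  -- period `i`; with all `s` it says that `P` is independent of `y` whenever `h` is.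
  have hind : ∀ s : ℝ, (∀ z, h (z + s * Complex.I) = h z) → ∀ z, P (z + s * Complex.I) = P z := by
    intro s hs z
    have h1 : (z + s * Complex.I).re = z.re := by simp
    have h2 : (z + s * Complex.I).im = z.im + s := by simp
    have h3 : ∀ x : ℂ, h (x + ((z.im + s : ℝ) : ℂ) * Complex.I) = h (x + z.im * Complex.I) := by
      intro x
      rw [← hs (x + z.im * Complex.I)]; congr 1; push_cast; ring
    simp only [P, m, h1, h2, h3]
  refine ⟨P, ⟨hPs, fun z => ?_, fun z => ?_⟩, fun z => ?_, hind⟩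
  · rw [hP, hP]
    have h1 : (z + 1).re = z.re + 1 := by simp
    have h2 : (z + 1).im = z.im := by simp
    have h3 : m (z + 1) = m z := by simp only [m, h2]
    rw [h3, h1, h2, ← intervalIntegral.integral_add_adjacent_intervals
      (b := z.re) ((hcont z).intervalIntegrable _ _) ((hcont z).intervalIntegrable _ _),
      (hper z).intervalIntegral_add_eq z.re 0, zero_add]
    push_cast
    simp only [m]
    ring
  · have := hind 1 (fun z => by simpa using hh.add_I z) z
    simpa using this
  · have hd : DifferentiableAt ℝ P z := hPs.differentiable (by simp) z
    rw [← hd.lineDeriv_eq_fderiv]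
    refine HasDerivAt.deriv ?_
    have h0 : ∀ t : ℝ, P (z + t • (1 : ℂ)) =
        (∫ r in (0 : ℝ)..(z.re + t), h (r + z.im * Complex.I)) - (z.re + t) * m z := by
      intro t
      have h1 : (z + t • (1 : ℂ)).re = z.re + t := by simp
      have h2 : (z + t • (1 : ℂ)).im = z.im := by simp
      rw [hP]
      simp only [m, h1, h2, Complex.ofReal_add]
    simp only [h0]
    refine HasDerivAt.sub ?_ ?_
    · have h1 := intervalIntegral.integral_hasDerivAt_right
        ((hcont z).intervalIntegrable 0 (z.re + 0))
        ((hcont z).stronglyMeasurableAtFilter _ _) (hcont z).continuousAt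
      have h2 := HasDerivAt.comp_const_add z.re (0 : ℝ) h1
      simpa using h2
    · have h1 : HasDerivAt (fun t : ℝ => ((z.re : ℂ) + t) * m z) (1 * m z) 0 := by
        refine HasDerivAt.mul_const ?_ _
        exact (Complex.ofRealCLM.hasDerivAt (x := (0 : ℝ))).const_add _
      simpa using h1

/-- A periodic function is a constant plus a divergence `∂P/∂x + ∂Q/∂y` with `Q` independent
of `x`. -/
theorem exists_divergence {h : ℂ → ℂ} (hh : IsSmoothPeriodic h) :
    ∃ (P Q : ℂ → ℂ) (c : ℂ), IsSmoothPeriodic P ∧ IsSmoothPeriodic Q ∧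
      (∀ z, fderiv ℝ Q z 1 = 0) ∧
      ∀ z, h z = fderiv ℝ P z 1 + fderiv ℝ Q z Complex.I + c := by
  obtain ⟨P, hP, hPd, -⟩ := exists_primitive_re hh
  set m : ℂ → ℂ := fun z => ∫ t in (0 : ℝ)..1, h (t + z.im * Complex.I) with hm
  have hmeq : m = fun z => h z + (-1) * fderiv ℝ P z 1 := by
    funext z; rw [hPd]; ring
  have hms : IsSmoothPeriodic m := hmeq ▸ hh.add ((hP.fderiv_apply 1).const_mul (-1))
  have hmx : ∀ (s : ℝ) z, m (z + s) = m z := fun s z => by simp [m]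
  -- After subtracting `∂P/∂x` only the mean `m` along `x` is left, a function of `y`. It is
  -- integrated in `y` by conjugating with the reflection. Since `m` is invariant under all real
  -- translations, so is the resulting `Q`; the constant `c` is the mean of `m`.
  obtain ⟨R, hR, hRd, hRi⟩ := exists_primitive_re hms.swap
  have hRi' : ∀ (s : ℝ) z, R (z + s * Complex.I) = R z := fun s => hRi s fun z => by
    rw [map_add, map_mul, Complex.conj_ofReal, Complex.conj_I, mul_add]
    rw [show Complex.I * (s * -Complex.I) = (s : ℂ) by linear_combination (-s : ℂ) * Complex.I_mul_I]
    exact hmx _ _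
  refine ⟨P, fun z => R (Complex.I * (starRingEnd ℂ) z), ∫ t in (0 : ℝ)..1, m (t * Complex.I),
    hP, hR.swap, fun z => ?_, fun z => ?_⟩
  · rw [hR.fderiv_swap, map_one, mul_one, ← (hR.differentiable _).lineDeriv_eq_fderiv]
    simp only [lineDeriv, Complex.real_smul, hRi', deriv_const]
  · rw [hR.fderiv_swap, Complex.conj_I, mul_neg, Complex.I_mul_I, neg_neg, hRd, swap_swap, hPd]
    have h1 : ∀ t : ℝ, m (Complex.I * (starRingEnd ℂ) ((t : ℂ) +
        (Complex.I * (starRingEnd ℂ) z).im * Complex.I)) = m (t * Complex.I) := by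
      intro t
      simp [m]
    simp only [h1]
    ring

/-- `exists_divergence` with the two real coordinates exchanged. The pair of equations below needs
one decomposition of each kind. -/
theorem exists_divergence_swap {h : ℂ → ℂ} (hh : IsSmoothPeriodic h) :
    ∃ (R S : ℂ → ℂ) (c : ℂ), IsSmoothPeriodic R ∧ IsSmoothPeriodic S ∧
      (∀ z, fderiv ℝ S z Complex.I = 0) ∧
      ∀ z, h z = fderiv ℝ R z Complex.I + fderiv ℝ S z 1 + c := by
  obtain ⟨P, Q, c, hP, hQ, hQx, hd⟩ := exists_divergence hh.swap
  have hI : Complex.I * (starRingEnd ℂ) Complex.I = 1 := by simp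
  have h1 : Complex.I * (starRingEnd ℂ) 1 = Complex.I := by simp
  refine ⟨_, _, c, hP.swap, hQ.swap, fun z => ?_, fun z => ?_⟩
  · rw [hQ.fderiv_swap, hI, hQx]
  · rw [hQ.fderiv_swap, hP.fderiv_swap, hI, h1, ← hd, swap_swap]

/-! ### The operators `∂/∂z` and `∂/∂z̄` on periodic functions, and the equations they enter. -/

theorem fderiv_eq_wirtinger {f : ℂ → ℂ} (z v : ℂ) :
    fderiv ℝ f z v = wirtinger f z * v + wirtingerBar f z * (starRingEnd ℂ) v := by
  have h1 : v = v.re • (1 : ℂ) + v.im • Complex.I := by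
    simp [Complex.re_add_im]
  have h2 : fderiv ℝ f z v = v.re * fderiv ℝ f z 1 + v.im * fderiv ℝ f z Complex.I := by
    conv_lhs => rw [h1]
    rw [map_add, map_smul, map_smul, Complex.real_smul, Complex.real_smul]
  rw [h2, wirtinger, wirtingerBar]
  have hc : (starRingEnd ℂ) v = v.re - v.im * Complex.I := by
    apply Complex.ext <;> simp
  have hv : v = v.re + v.im * Complex.I := (Complex.re_add_im v).symm
  rw [hc]
  nth_rewrite 3 [hv]
  linear_combination ((v.im : ℂ) * fderiv ℝ f z Complex.I) * Complex.I_mul_I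

theorem wirtinger_const_mul_add {f g : ℂ → ℂ} (hf : IsSmoothPeriodic f) (hg : IsSmoothPeriodic g)
    (a b z : ℂ) : wirtinger (fun z => a * f z + b * g z) z =
      a * wirtinger f z + b * wirtinger g z := by
  have h : ∀ v, fderiv ℝ (fun z => a * f z + b * g z) z v =
      a * fderiv ℝ f z v + b * fderiv ℝ g z v := fun v => by
    rw [fderiv_fun_add ((hf.differentiable z).const_mul a) ((hg.differentiable z).const_mul b),
      fderiv_const_mul (hf.differentiable z), fderiv_const_mul (hg.differentiable z)]
    rfl
  rw [wirtinger, h, h, wirtinger, wirtinger]; ring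

theorem wirtingerBar_const_mul_add {f g : ℂ → ℂ} (hf : IsSmoothPeriodic f)
    (hg : IsSmoothPeriodic g) (a b z : ℂ) : wirtingerBar (fun z => a * f z + b * g z) z =
      a * wirtingerBar f z + b * wirtingerBar g z := by
  have h : ∀ v, fderiv ℝ (fun z => a * f z + b * g z) z v =
      a * fderiv ℝ f z v + b * fderiv ℝ g z v := fun v => by
    rw [fderiv_fun_add ((hf.differentiable z).const_mul a) ((hg.differentiable z).const_mul b),
      fderiv_const_mul (hf.differentiable z), fderiv_const_mul (hg.differentiable z)]
    rfl
  rw [wirtingerBar, h, h, wirtingerBar, wirtingerBar]; ring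

/-- Modulo constants, every periodic function is `∂b/∂z̄ - ∂c/∂z`. -/
theorem exists_wirtinger_divergence {g : ℂ → ℂ} (hg : IsSmoothPeriodic g) :
    ∃ (b c : ℂ → ℂ) (l : ℂ), IsSmoothPeriodic b ∧ IsSmoothPeriodic c ∧
      ∀ z, g z = l + (wirtingerBar b z - wirtinger c z) := by
  obtain ⟨P, Q, l, hP, hQ, -, hd⟩ := exists_divergence hg
  -- Since `∂̄b - ∂c = ∂ₓ((b - c)/2) + ∂ᵧ(i(b + c)/2)`, the functions `b` and `c` are obtained by
  -- solving `(b - c)/2 = P` and `i(b + c)/2 = Q`.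
  refine ⟨fun z => 1 * P z + (-Complex.I) * Q z, fun z => (-1) * P z + (-Complex.I) * Q z, l,
    (hP.const_mul _).add (hQ.const_mul _), (hP.const_mul _).add (hQ.const_mul _), fun z => ?_⟩
  rw [wirtingerBar_const_mul_add hP hQ, wirtinger_const_mul_add hP hQ, hd]
  simp only [wirtinger, wirtingerBar]
  linear_combination (fderiv ℝ Q z Complex.I) * Complex.I_mul_I

/-- Modulo constants, every pair of periodic functions is `(∂b/∂z̄ - ∂c/∂z, ∂c/∂z̄ - ∂e/∂z)`. -/
theorem exists_wirtinger_divergence_pair {p q : ℂ → ℂ} (hp : IsSmoothPeriodic p)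
    (hq : IsSmoothPeriodic q) :
    ∃ (b c e : ℂ → ℂ) (l m : ℂ), IsSmoothPeriodic b ∧ IsSmoothPeriodic c ∧ IsSmoothPeriodic e ∧
      ∀ z, p z = l + (wirtingerBar b z - wirtinger c z) ∧
        q z = m + (wirtingerBar c z - wirtinger e z) := by
  -- Put `b = U + T/2`, `e = U - T/2`, `c = W`. Up to constants, the sum and the difference of the
  -- two equations are `p + q = ∂ₓT/2 + i ∂ᵧ(U + W)` and `p - q = ∂ₓ(U - W) + (i/2) ∂ᵧT`. The same
  -- `T` occurs in both, and `T = Q + S` serves both: `Q` is independent of `x` and drops out of the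
  -- first, `S` is independent of `y` and drops out of the second. Then `U + W = -(i/2) R` and `U -
  -- W = (i/2) P`.
  obtain ⟨P, Q, k, hP, hQ, hQx, hd⟩ :=
    exists_divergence ((hp.const_mul (-2 * Complex.I)).add (hq.const_mul (2 * Complex.I)))
  obtain ⟨R, S, k', hR, hS, hSy, hd'⟩ :=
    exists_divergence_swap ((hp.const_mul 2).add (hq.const_mul 2))
  have hT := (hQ.const_mul 1).add (hS.const_mul 1)
  have hU := (hP.const_mul (Complex.I / 4)).add (hR.const_mul (-Complex.I / 4))
  have hW := (hP.const_mul (-Complex.I / 4)).add (hR.const_mul (-Complex.I / 4))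
  refine ⟨_, _, _, k' / 4 + Complex.I * k / 4, k' / 4 - Complex.I * k / 4,
    (hU.const_mul 1).add (hT.const_mul (1 / 2)), hW.const_mul 1 |>.add (hT.const_mul 0),
    (hU.const_mul 1).add (hT.const_mul (-1 / 2)), fun z => ?_⟩
  rw [wirtingerBar_const_mul_add hU hT, wirtinger_const_mul_add hU hT,
    wirtingerBar_const_mul_add hW hT, wirtinger_const_mul_add hW hT,
    wirtingerBar_const_mul_add hP hR, wirtinger_const_mul_add hP hR,
    wirtingerBar_const_mul_add hP hR, wirtinger_const_mul_add hP hR,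
    wirtingerBar_const_mul_add hQ hS]
  have h1 := hd z
  have h2 := hd' z
  have h3 := hQx z
  have h4 := hSy z
  have hI := Complex.I_mul_I
  rw [wirtinger_const_mul_add hQ hS]
  simp only [wirtinger, wirtingerBar]
  constructor
  · linear_combination (1 / 4) * h2 + (Complex.I / 4) * h1 - (1 / 4) * h3 - (Complex.I / 4) * h4 +
      ((p z - q z) / 2 + fderiv ℝ R z Complex.I / 4) * hI
  · linear_combination (1 / 4) * h2 - (Complex.I / 4) * h1 - (1 / 4) * h3 + (Complex.I / 4) * h4 +
      (-(p z - q z) / 2 + fderiv ℝ R z Complex.I / 4) * hI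

/-- A constant of the form `∂b/∂z̄ - ∂c/∂z` vanishes. -/
theorem eq_zero_of_wirtinger_divergence {b c : ℂ → ℂ} (hb : IsSmoothPeriodic b)
    (hc : IsSmoothPeriodic c) {l : ℂ} (h : ∀ z, wirtingerBar b z - wirtinger c z = l) :
    l = 0 := by
  -- The expression `∂̄b - ∂c` is the real divergence `∂ₓf + ∂ᵧg`. By the divergence theorem on the
  -- unit square its integral is a sum of boundary terms, which cancel by periodicity.
  let f : ℂ → ℂ := fun z => (1 / 2) * b z + (-1 / 2) * c z
  let g : ℂ → ℂ := fun z => (Complex.I / 2) * b z + (Complex.I / 2) * c z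
  have hf : IsSmoothPeriodic f := (hb.const_mul _).add (hc.const_mul _)
  have hg : IsSmoothPeriodic g := (hb.const_mul _).add (hc.const_mul _)
  have hfg : ∀ z, fderiv ℝ f z 1 + fderiv ℝ g z Complex.I = l := by
    intro z
    rw [← h z, fderiv_eq_wirtinger, fderiv_eq_wirtinger, wirtinger_const_mul_add hb hc,
      wirtinger_const_mul_add hb hc, wirtingerBar_const_mul_add hb hc,
      wirtingerBar_const_mul_add hb hc, map_one, Complex.conj_I]
    linear_combination (wirtinger b z + wirtinger c z - wirtingerBar b z - wirtingerBar c z) / 2 *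
      Complex.I_mul_I
  let ι : ℝ × ℝ →L[ℝ] ℂ := Complex.equivRealProdCLM.symm
  have hι : ∀ x y : ℝ, ι (x, y) = x + y * Complex.I := fun x y =>
    Complex.equivRealProdCLM_symm_apply (x, y)
  have hι1 : ι (1, 0) = 1 := by simp [hι]
  have hι2 : ι (0, 1) = Complex.I := by simp [hι]
  have key := MeasureTheory.integral2_divergence_prod_of_hasFDerivAt (f ∘ ι) (g ∘ ι)
    (fun x => (fderiv ℝ f (ι x)).comp ι) (fun x => (fderiv ℝ g (ι x)).comp ι) 0 0 1 1
    (hf.contDiff.continuous.comp ι.continuous).continuousOn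
    (hg.contDiff.continuous.comp ι.continuous).continuousOn
    (fun x _ => (hf.differentiable _).hasFDerivAt.comp x ι.hasFDerivAt)
    (fun x _ => (hg.differentiable _).hasFDerivAt.comp x ι.hasFDerivAt)
    (by
      simp only [ContinuousLinearMap.comp_apply, hι1, hι2, hfg]
      refine MeasureTheory.integrableOn_const ?_ ?_
      · exact ((isCompact_uIcc.prod isCompact_uIcc).measure_lt_top).ne
      · simp)
  have e1 : ∀ x : ℝ, f (ι (1, x)) = f (ι (0, x)) := fun x => by
    rw [hι, hι, ← hf.add_one (((0 : ℝ) : ℂ) + _)]; congr 1; push_cast; ring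
  have e2 : ∀ x : ℝ, g (ι (x, 1)) = g (ι (x, 0)) := fun x => by
    rw [hι, hι, ← hg.add_I ((x : ℂ) + ((0 : ℝ) : ℂ) * _)]; congr 1; push_cast; ring
  simp only [ContinuousLinearMap.comp_apply, hι1, hι2, hfg, Function.comp_apply, e1, e2] at key
  simpa using key

/-- The first cohomology of `𝕋²`: a closed `1`-form `b dz + e dz̄` is the sum of a constant form and
the differential of a function. -/
theorem exists_wirtinger_primitive {b e : ℂ → ℂ} (hb : IsSmoothPeriodic b)
    (he : IsSmoothPeriodic e) (h : ∀ z, wirtingerBar b z - wirtinger e z = 0) :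
    ∃ (f : ℂ → ℂ) (l m : ℂ), IsSmoothPeriodic f ∧
      ∀ z, b z = l + wirtinger f z ∧ e z = m + wirtingerBar f z := by
  let conjL : ℂ →L[ℝ] ℂ := (Complex.conjCLE : ℂ →L[ℝ] ℂ)
  let idL : ℂ →L[ℝ] ℂ := ContinuousLinearMap.id ℝ ℂ
  let η : (ℂ → ℂ →L[ℝ] ℂ) := fun z => b z • idL + e z • conjL
  have hηs : ContDiff ℝ ∞ η :=
    (hb.contDiff.smul contDiff_const).add (he.contDiff.smul contDiff_const)
  have hηv : ∀ z v, η z v = b z * v + e z * (starRingEnd ℂ) v := fun z v => rfl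
  have hηd : ∀ z v w, fderiv ℝ η z v w =
      fderiv ℝ b z v * w + fderiv ℝ e z v * (starRingEnd ℂ) w := by
    intro z v w
    have h1 : HasFDerivAt η _ z :=
      ((hb.differentiable z).hasFDerivAt.smul_const idL).add
        ((he.differentiable z).hasFDerivAt.smul_const conjL)
    rw [h1.fderiv]
    rfl
  -- Poincaré lemma on `ℂ` for `b dz + e dz̄`. The hypothesis `h` is the symmetry of the derivative,
  -- that is, closedness.
  obtain ⟨F, hF⟩ := Convex.exists_forall_hasFDerivAt_of_fderiv_symmetric convex_univ isOpen_univ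
    (hηs.differentiable (by simp)).differentiableOn (fun z _ v w => by
      rw [hηd, hηd, fderiv_eq_wirtinger, fderiv_eq_wirtinger (f := e),
        fderiv_eq_wirtinger (f := b) z w, fderiv_eq_wirtinger (f := e) z w]
      linear_combination ((starRingEnd ℂ) v * w - (starRingEnd ℂ) w * v) * h z)
  have hF' : ∀ z, HasFDerivAt F (η z) z := fun z => hF z (mem_univ z)
  have hFd : Differentiable ℝ F := fun z => (hF' z).differentiableAt
  have hFs : ContDiff ℝ ∞ F := by
    refine contDiff_infty_iff_fderiv.2 ⟨hFd, ?_⟩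
    rw [funext fun z => (hF' z).fderiv]
    exact hηs
  have hshift : ∀ a : ℂ, (∀ z, η (z + a) = η z) → ∀ z, F (z + a) - F z = F a - F 0 := by
    intro a ha z
    have hd : ∀ z, HasFDerivAt (fun z => F (z + a) - F z) (0 : ℂ →L[ℝ] ℂ) z := fun z => by
      have := ((hasFDerivAt_comp_add_right a).2 (hF' (z + a))).sub (hF' z)
      rwa [ha, sub_self] at this
    have := is_const_of_fderiv_eq_zero (fun z => (hd z).differentiableAt)
      (fun z => (hd z).fderiv) z 0
    simpa using this
  have h1 := hshift 1 fun z => by ext v; rw [hηv, hηv, hb.add_one, he.add_one]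
  have hI := hshift Complex.I fun z => by ext v; rw [hηv, hηv, hb.add_I, he.add_I]
  set p := F 1 - F 0
  set q := F Complex.I - F 0
  -- The increments of `F` along `1` and `i` are constants `p` and `q`. The real-linear map `l z + m
  -- z̄` taking the values `p` at `1` and `q` at `i` is subtracted to make `F` periodic.
  let l : ℂ := (p - Complex.I * q) / 2
  let m : ℂ := (p + Complex.I * q) / 2
  let f : ℂ → ℂ := fun z => F z - (l • idL + m • conjL) z
  have hL : ∀ z, (l • idL + m • conjL) z = l * z + m * (starRingEnd ℂ) z := fun z => rfl
  have hfp : IsSmoothPeriodic f := by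
    refine ⟨hFs.sub (ContinuousLinearMap.contDiff _), fun z => ?_, fun z => ?_⟩
    · simp only [f, hL, map_add, map_one, l, m]
      linear_combination h1 z
    · simp only [f, hL, map_add, Complex.conj_I, l, m]
      linear_combination hI z + q * Complex.I_mul_I
  have hfd : ∀ z, fderiv ℝ f z = η z - (l • idL + m • conjL) := fun z =>
    ((hF' z).sub (ContinuousLinearMap.hasFDerivAt _)).fderiv
  have hfv : ∀ z v, fderiv ℝ f z v = (b z - l) * v + (e z - m) * (starRingEnd ℂ) v := by
    intro z v
    rw [hfd, sub_apply, hηv, hL]; ring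
  refine ⟨f, l, m, hfp, fun z => ?_⟩
  rw [wirtinger, wirtingerBar, hfv, hfv, map_one, Complex.conj_I]
  constructor
  · linear_combination (b z - l - (e z - m)) / 2 * Complex.I_mul_I
  · linear_combination (-(b z - l) + (e z - m)) / 2 * Complex.I_mul_I

/-! ### Smooth functions on `𝕋²` as periodic functions -/

theorem isSmoothPeriodic_periodic (g : SmoothTorus2) : IsSmoothPeriodic (periodic g) := by
  have h : ∀ v ∈ intLattice, ∀ z, periodic g (z + v) = periodic g z := fun v hv z =>
    congrArg g.1 (QuotientAddGroup.mk_add_of_mem z hv)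
  exact ⟨contDiff_periodic g, h 1 ⟨1, 0, by simp⟩, h Complex.I ⟨0, 1, by simp⟩⟩

theorem IsSmoothPeriodic.add_mem {f : ℂ → ℂ} (hf : IsSmoothPeriodic f) {v : ℂ}
    (hv : v ∈ intLattice) (z : ℂ) : f (z + v) = f z := by
  obtain ⟨m, n, rfl⟩ := hv
  have h1 : Function.Periodic f 1 := hf.add_one
  have h2 : Function.Periodic f Complex.I := hf.add_I
  rw [← add_assoc]
  have h3 := h2.int_mul n (z + m)
  have h4 := h1.int_mul m z
  rw [mul_one] at h4
  rw [h3, h4]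

theorem exists_periodic_eq {f : ℂ → ℂ} (hf : IsSmoothPeriodic f) :
    ∃ g : SmoothTorus2, periodic g = f := by
  let g : Torus2 → ℂ := Quotient.lift f fun x y hxy => by
    have h := hf.add_mem (QuotientAddGroup.leftRel_apply.1 hxy) x
    rw [← h, add_neg_cancel_left]
  refine ⟨⟨g, fun q => ?_⟩, rfl⟩
  exact (uniformization_torus2 ℝ).contMDiffAt_of_comp fun y _ => hf.contDiff.contMDiff y

theorem periodic_injective : Function.Injective periodic := by
  intro f g h
  refine Subtype.ext (funext fun q => ?_)
  obtain ⟨z, rfl⟩ := QuotientAddGroup.mk_surjective q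
  exact congrFun h z

theorem periodic_add (f g : SmoothTorus2) (z : ℂ) :
    periodic (f + g) z = periodic f z + periodic g z := rfl

theorem periodic_smul (c : ℂ) (g : SmoothTorus2) (z : ℂ) :
    periodic (c • g) z = c * periodic g z := rfl

/-- The constant functions on `𝕋²`. -/
def constTorus2 (c : ℂ) : SmoothTorus2 := ⟨fun _ => c, contMDiff_const⟩

theorem periodic_const (c z : ℂ) : periodic (constTorus2 c) z = c := rfl

/-! ### Forms on the suspension as forms on its covering -/

namespace RoughForm

/-- All tangent spaces unfold to the model space, so values at equal points can be compared there
without a transport between dependent types. -/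
theorem apply_congr {E : Type*} [NormedAddCommGroup E] [NormedSpace ℝ E]
    {M : Type*} [TopologicalSpace M] [ChartedSpace E M]
    {W : Type*} [NormedAddCommGroup W] [NormedSpace ℝ W] {k : ℕ} (α : RoughForm E M W k) {p q : M}
    (h : p = q) : (α p : E [⋀^Fin k]→L[ℝ] W) = α q := by
  subst h; rfl

theorem pullback_congr_of_eventuallyEq {E : Type*} [NormedAddCommGroup E] [NormedSpace ℝ E]
    {M : Type*} [TopologicalSpace M] [ChartedSpace E M]
    {E' : Type*} [NormedAddCommGroup E'] [NormedSpace ℝ E']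
    {N : Type*} [TopologicalSpace N] [ChartedSpace E' N]
    {W : Type*} [NormedAddCommGroup W] [NormedSpace ℝ W] {k : ℕ} {f g : N → M} {x : N}
    (h : f =ᶠ[𝓝 x] g) (α : RoughForm E M W k) :
    pullback (E' := E') f α x = pullback g α x := by
  have h1 : (mfderiv 𝓘(ℝ, E') 𝓘(ℝ, E) f x : E' →L[ℝ] E) = mfderiv 𝓘(ℝ, E') 𝓘(ℝ, E) g x :=
    h.mfderiv_eq
  have h2 : (α (f x) : E [⋀^Fin k]→L[ℝ] W) = α (g x) :=
    apply_congr α h.self_of_nhds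
  exact congrArg₂ (fun (a : E [⋀^Fin k]→L[ℝ] W) (L : E' →L[ℝ] E) =>
    a.compContinuousLinearMap L) h2 h1

end RoughForm

namespace Suspension

/-- The covering space `ℂ² × ℝ` of the suspension. -/
abbrev Cov : Type := (ℂ × ℂ) × ℝ

/-- The linear part `((w, z), s) ↦ ((w + n z, z), s)` of the deck transformations. -/
noncomputable def shearCLM (n : ℤ) : Cov →L[ℝ] Cov :=
  let w : Cov →L[ℝ] ℂ := (ContinuousLinearMap.fst ℝ ℂ ℂ).comp (ContinuousLinearMap.fst ℝ (ℂ × ℂ) ℝ)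
  let z : Cov →L[ℝ] ℂ := (ContinuousLinearMap.snd ℝ ℂ ℂ).comp (ContinuousLinearMap.fst ℝ (ℂ × ℂ) ℝ)
  ((w + (n : ℝ) • z).prod z).prod (ContinuousLinearMap.snd ℝ (ℂ × ℂ) ℝ)

theorem shearCLM_apply (n : ℤ) (u : Cov) :
    shearCLM n u = ((u.1.1 + n * u.1.2, u.1.2), u.2) := by
  simp [shearCLM]

/-- The deck transformations of `proj`. -/
noncomputable def deck (n : ℤ) (l : ℂ × ℂ) (x : Cov) : Cov := shearCLM n x + (l, (n : ℝ))

theorem deck_apply (n : ℤ) (l : ℂ × ℂ) (x : Cov) :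
    deck n l x = ((x.1.1 + n * x.1.2 + l.1, x.1.2 + l.2), x.2 + n) := by
  rw [deck, shearCLM_apply]; rfl

theorem contDiff_deck (n : ℤ) (l : ℂ × ℂ) {r : ℕ∞ω} : ContDiff ℝ r (deck n l) :=
  (shearCLM n).contDiff.add contDiff_const

theorem hasFDerivAt_deck (n : ℤ) (l : ℂ × ℂ) (x : Cov) :
    HasFDerivAt (deck n l) (shearCLM n) x :=
  (shearCLM n).hasFDerivAt.add_const _

theorem proj_deck (n : ℤ) {l : ℂ × ℂ} (hl : l ∈ intLattice.prod intLattice) (x : Cov) :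
    proj (deck n l x) = proj x := by
  refine (mk_eq_iff.2 ⟨n, ?_, ?_⟩).symm
  · change (torusShear ^ n) (x.1 : Torus4) = _
    rw [torusShear_zpow_mk, deck_apply]
    exact (QuotientAddGroup.mk_add_of_mem _ hl).symm
  · rw [deck_apply]

theorem exists_deck {x y : Cov} (h : proj x = proj y) :
    ∃ n : ℤ, ∃ l ∈ intLattice.prod intLattice, deck n l x = y := by
  obtain ⟨n, h1, h2⟩ := mk_eq_iff.1 h
  simp only at h1 h2
  rw [torusShear_zpow_mk] at h1
  refine ⟨n, _, QuotientAddGroup.eq.1 h1, ?_⟩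
  rw [deck_apply]
  exact Prod.ext (add_neg_cancel_left (x.1.1 + n * x.1.2, x.1.2) y.1) h2

/-- The inverse of a chart is a restriction of `proj`, and two points of one fibre differ by a deck
transformation. So the preferred chart after `proj` is locally a deck transformation. This reduces
all later chart computations to invariance on the covering. -/
theorem exists_deck_eventuallyEq (x : Cov) : ∃ n : ℤ, ∃ l ∈ intLattice.prod intLattice,
    chartAt Cov (proj x) ∘ proj =ᶠ[𝓝 x] deck n l ∧
    deck n l x ∈ (chartAt Cov (proj x)).target := by
  have h := uniformization_proj
  have h0 : proj x = proj (chartAt Cov (proj x) (proj x)) := by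
    rw [← h.chart_symm _ (chart_mem_atlas _ _) _ (mem_chart_target _ _),
      (chartAt Cov (proj x)).left_inv (mem_chart_source _ _)]
  obtain ⟨n, l, hl, hx⟩ := exists_deck h0
  have hmem : deck n l x ∈ (chartAt Cov (proj x)).target := hx ▸ mem_chart_target _ _
  refine ⟨n, l, hl, ?_, hmem⟩
  filter_upwards [(contDiff_deck n l (r := 0)).continuous.continuousAt.eventually_mem
    ((chartAt Cov (proj x)).open_target.mem_nhds hmem)] with y hy
  rw [Function.comp_apply, ← proj_deck n hl y, ← h.chart_symm _ (chart_mem_atlas _ _) _ hy,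
    (chartAt Cov (proj x)).right_inv hy]

theorem mdifferentiableAt_proj (x : Cov) :
    MDifferentiableAt 𝓘(ℝ, Cov) 𝓘(ℝ, Cov) proj x :=
  (uniformization_proj.contMDiff x).mdifferentiableAt (by simp)

theorem mfderiv_chart_comp_mfderiv_proj {x : Cov} {n : ℤ} {l : ℂ × ℂ}
    (h : chartAt Cov (proj x) ∘ proj =ᶠ[𝓝 x] deck n l) :
    (mfderiv 𝓘(ℝ, Cov) 𝓘(ℝ, Cov) (chartAt Cov (proj x)) (proj x)).comp
      (mfderiv 𝓘(ℝ, Cov) 𝓘(ℝ, Cov) proj x) = shearCLM n := by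
  have hc : MDifferentiableAt 𝓘(ℝ, Cov) 𝓘(ℝ, Cov) (chartAt Cov (proj x)) (proj x) :=
    ((contMDiffOn_chart (I := 𝓘(ℝ, Cov)) (n := ∞) (x := proj x)).contMDiffAt
      ((chartAt Cov (proj x)).open_source.mem_nhds (mem_chart_source _ _))).mdifferentiableAt
      (by simp)
  rw [← mfderiv_comp x hc (mdifferentiableAt_proj x)]
  have h1 := h.mfderiv_eq (I := 𝓘(ℝ, Cov)) (I' := 𝓘(ℝ, Cov))
  rw [mfderiv_eq_fderiv (f := deck n l), (hasFDerivAt_deck n l x).fderiv] at h1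
  exact h1

variable {k : ℕ}

/-- The pullback of a form to the covering. -/
noncomputable def lift (α : RoughForm Cov Suspension ℂ k) : Cov → Cov [⋀^Fin k]→L[ℝ] ℂ :=
  fun x => RoughForm.pullback (E' := Cov) (N := Cov) proj α x

theorem lift_add (α β : RoughForm Cov Suspension ℂ k) : lift (α + β) = lift α + lift β := rfl

theorem lift_smul (c : ℂ) (α : RoughForm Cov Suspension ℂ k) : lift (c • α) = c • lift α := rfl

theorem lift_apply (α : RoughForm Cov Suspension ℂ k) (x : Cov) (u : Fin k → Cov) :
    lift α x u = (α (proj x) : Cov [⋀^Fin k]→L[ℝ] ℂ)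
      (fun i => (mfderiv 𝓘(ℝ, Cov) 𝓘(ℝ, Cov) proj x : Cov →L[ℝ] Cov) (u i)) := rfl

/-- Both `proj` and its derivative at each point are surjective, so identities of forms may be
checked on the covering. -/
theorem lift_injective : Function.Injective (lift (k := k)) := by
  intro α β h
  funext q
  obtain ⟨x, rfl⟩ := proj_surjective q
  refine ContinuousAlternatingMap.ext fun u => ?_
  choose v hv using fun i => uniformization_proj.surjective_mfderiv x (u i)
  have h1 : lift α x v = lift β x v := DFunLike.congr_fun (congrFun h x) v
  have h2 : (fun i => (mfderiv 𝓘(ℝ, Cov) 𝓘(ℝ, Cov) proj x : Cov →L[ℝ] Cov) (v i)) = u := funext hv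
  rw [← h2]
  exact h1

/-- Forms on the covering that are invariant under the deck transformations. -/
def IsDeckInvariant (η : Cov → Cov [⋀^Fin k]→L[ℝ] ℂ) : Prop :=
  ∀ (n : ℤ), ∀ l ∈ intLattice.prod intLattice, ∀ x,
    (η (deck n l x)).compContinuousLinearMap (shearCLM n) = η x

theorem isDeckInvariant_lift (α : RoughForm Cov Suspension ℂ k) : IsDeckInvariant (lift α) := by
  intro n l hl x
  have h1 : proj ∘ deck n l = proj := funext fun y => proj_deck n hl y
  have h2 : (mfderiv 𝓘(ℝ, Cov) 𝓘(ℝ, Cov) proj (deck n l x) : Cov →L[ℝ] Cov).comp (shearCLM n) =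
      mfderiv 𝓘(ℝ, Cov) 𝓘(ℝ, Cov) proj x := by
    have h3 := mfderiv_comp (I := 𝓘(ℝ, Cov)) (I' := 𝓘(ℝ, Cov)) (I'' := 𝓘(ℝ, Cov)) x
      (mdifferentiableAt_proj (deck n l x))
      ((contDiff_deck n l (r := 1)).contMDiff.contMDiffAt.mdifferentiableAt (by simp))
    have h4 : (mfderiv 𝓘(ℝ, Cov) 𝓘(ℝ, Cov) (proj ∘ deck n l) x : Cov →L[ℝ] Cov) =
        mfderiv 𝓘(ℝ, Cov) 𝓘(ℝ, Cov) proj x :=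
      (Filter.EventuallyEq.of_eq h1).mfderiv_eq
    rw [mfderiv_eq_fderiv, (hasFDerivAt_deck n l x).fderiv] at h3
    exact h3.symm.trans h4
  have h5 : (α (proj (deck n l x)) : Cov [⋀^Fin k]→L[ℝ] ℂ) = α (proj x) :=
    RoughForm.apply_congr α (proj_deck n hl x)
  refine ContinuousAlternatingMap.ext fun u => ?_
  change (α (proj (deck n l x)) : Cov [⋀^Fin k]→L[ℝ] ℂ) (fun i =>
    ((mfderiv 𝓘(ℝ, Cov) 𝓘(ℝ, Cov) proj (deck n l x) : Cov →L[ℝ] Cov).comp (shearCLM n)) (u i)) = _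
  rw [h2, h5, lift_apply]
  rfl

theorem inChart_eq_lift {e : OpenPartialHomeomorph Suspension Cov} (he : e ∈ atlas Cov Suspension)
    (α : RoughForm Cov Suspension ℂ k) {y : Cov} (hy : y ∈ e.target) :
    RoughForm.inChart e α y = lift α y := by
  refine RoughForm.pullback_congr_of_eventuallyEq ?_ α
  filter_upwards [e.open_target.mem_nhds hy] with y' hy'
  exact uniformization_proj.chart_symm e he y' hy'

theorem isSmooth_of_contDiff_lift {α : RoughForm Cov Suspension ℂ k}
    (h : ContDiff ℝ ∞ (lift α)) : RoughForm.IsSmooth α := fun _ he =>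
  h.contDiffOn.congr fun _ hy => inChart_eq_lift he α hy

/-- Smoothness of `α` is known only on chart targets, which need not contain `x`. A deck
transformation moves `x` into one, and invariance brings the smoothness back. -/
theorem contDiff_lift {α : RoughForm Cov Suspension ℂ k} (h : RoughForm.IsSmooth α) :
    ContDiff ℝ ∞ (lift α) := by
  rw [contDiff_iff_contDiffAt]
  intro x
  obtain ⟨n, l, hl, -, hmem⟩ := exists_deck_eventuallyEq x
  have h1 : ContDiffAt ℝ ∞ (lift α) (deck n l x) := by
    refine ((h _ (chart_mem_atlas Cov (proj x))).contDiffAt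
      ((chartAt Cov (proj x)).open_target.mem_nhds hmem)).congr_of_eventuallyEq ?_
    filter_upwards [(chartAt Cov (proj x)).open_target.mem_nhds hmem] with y hy
    exact (inChart_eq_lift (chart_mem_atlas _ _) α hy).symm
  have h2 : lift α = fun y => ContinuousAlternatingMap.compContinuousLinearMapCLM (shearCLM n)
      (lift α (deck n l y)) := funext fun y => (isDeckInvariant_lift α n l hl y).symm
  rw [h2]
  exact (ContinuousLinearMap.contDiff _).contDiffAt.comp x
    (h1.comp x (contDiff_deck n l).contDiffAt)

/-- The differential is computed in a chart, at the image of `x` under a deck transformation.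
Naturality of `extDeriv` under that map, together with invariance of the lift, returns the
computation to `x`. -/
theorem lift_d {α : RoughForm Cov Suspension ℂ k} (h : RoughForm.IsSmooth α) :
    lift (RoughForm.d α) = extDeriv (lift α) := by
  funext x
  obtain ⟨n, l, hl, hev, hmem⟩ := exists_deck_eventuallyEq x
  have hd : Differentiable ℝ (lift α) := (contDiff_lift h).differentiable (by simp)
  have h1 : extDeriv (lift α) x =
      (extDeriv (lift α) (deck n l x)).compContinuousLinearMap (shearCLM n) := by
    have h2 := extDeriv_pullback (r := ∞) (hd (deck n l x)) (contDiff_deck n l).contDiffAt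
      (by
        rw [minSmoothness_of_isRCLikeNormedField]
        exact WithTop.coe_le_coe.2 le_top)
    rw [(hasFDerivAt_deck n l x).fderiv] at h2
    rw [← h2]
    congr 1
    funext y
    rw [(hasFDerivAt_deck n l y).fderiv, isDeckInvariant_lift α n l hl y]
  have h3 : chartAt Cov (proj x) (proj x) = deck n l x := hev.self_of_nhds
  have h4 : extDeriv (RoughForm.inChart (chartAt Cov (proj x)) α) (chartAt Cov (proj x) (proj x)) =
      extDeriv (lift α) (deck n l x) := by
    rw [h3]
    refine Filter.EventuallyEq.extDeriv_eq ?_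
    filter_upwards [(chartAt Cov (proj x)).open_target.mem_nhds hmem] with y hy
    exact inChart_eq_lift (chart_mem_atlas _ _) α hy
  have h5 := mfderiv_chart_comp_mfderiv_proj hev
  rw [h1, ← h4, ← h5]
  rfl

/-- The form on the suspension defined by a form on the covering. -/
noncomputable def descend (η : Cov → Cov [⋀^Fin k]→L[ℝ] ℂ) : RoughForm Cov Suspension ℂ k :=
  fun q => (η (chartAt Cov q q)).compContinuousLinearMap
    (mfderiv 𝓘(ℝ, Cov) 𝓘(ℝ, Cov) (chartAt Cov q) q)

theorem lift_descend {η : Cov → Cov [⋀^Fin k]→L[ℝ] ℂ} (h : IsDeckInvariant η) :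
    lift (descend η) = η := by
  funext x
  obtain ⟨n, l, hl, hev, -⟩ := exists_deck_eventuallyEq x
  have h3 : chartAt Cov (proj x) (proj x) = deck n l x := hev.self_of_nhds
  rw [← h n l hl x, ← h3, ← mfderiv_chart_comp_mfderiv_proj hev]
  rfl

/-! ### Tangent vectors of the foliation and basic forms, seen on the covering. -/

theorem transverseProj_comp_proj_eventuallyEq {a : ℝ} {x : Cov} (hx : proj x ∈ chartDomain a) :
    ∃ n : ℤ, transverseProj a ∘ proj =ᶠ[𝓝 x]
      (QuotientAddGroup.mk : ℂ × ℂ → Torus4) ∘ fun y => (shearCLM n y).1 := by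
  obtain ⟨⟨p, s⟩, ⟨-, hs⟩, hx⟩ := hx
  obtain ⟨n, -, h2⟩ := mk_eq_iff.1 hx.symm
  simp only at h2 hs
  refine ⟨n, ?_⟩
  have hn : ∀ᶠ y : Cov in 𝓝 x, y.2 + n ∈ Ioo a (a + 1 / 2) := by
    refine ContinuousAt.eventually_mem (by fun_prop) (isOpen_Ioo.mem_nhds ?_)
    rw [h2]; exact hs
  filter_upwards [hn] with y hy
  have hfl : -⌊y.2 - a⌋ = n := by
    rw [neg_eq_iff_eq_neg, Int.floor_eq_iff]
    constructor <;> push_cast <;> linarith [hy.1, hy.2]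
  change (torusShear ^ (-⌊y.2 - a⌋)) (y.1 : Torus4) = _
  rw [hfl, torusShear_zpow_mk, Function.comp_apply, shearCLM_apply]

/-- On the covering the transverse projection is locally the first projection, followed by an
invertible shear and the covering of `𝕋⁴`. The derivative of the latter is surjective between spaces
of equal finite dimension, hence injective. -/
theorem mfderiv_transverseProj_eq_zero_iff {a : ℝ} {x : Cov} (hx : proj x ∈ chartDomain a)
    (u : Cov) : mfderiv 𝓘(ℝ, Cov) 𝓘(ℝ, ℂ × ℂ) (transverseProj a) (proj x)
      (mfderiv 𝓘(ℝ, Cov) 𝓘(ℝ, Cov) proj x u) = 0 ↔ u.1 = 0 := by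
  obtain ⟨n, hev⟩ := transverseProj_comp_proj_eventuallyEq hx
  have hopen : IsOpen (chartDomain a) := isOpenMap_mk _ (isOpen_univ.prod isOpen_Ioo)
  have hd := ((contMDiffOn_transverseProj a).contMDiffAt (hopen.mem_nhds hx)).mdifferentiableAt
    (by simp)
  let S : Cov →L[ℝ] ℂ × ℂ := (ContinuousLinearMap.fst ℝ (ℂ × ℂ) ℝ).comp (shearCLM n)
  have h1 := mfderiv_comp (I' := 𝓘(ℝ, Cov)) (f := proj) x hd (mdifferentiableAt_proj x)
  have h2 := mfderiv_comp (I := 𝓘(ℝ, Cov)) (I' := 𝓘(ℝ, ℂ × ℂ)) (I'' := 𝓘(ℝ, ℂ × ℂ))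
    (g := (QuotientAddGroup.mk : ℂ × ℂ → Torus4)) (f := S) x
    (((uniformization_torus4 ℝ).contMDiff _).mdifferentiableAt (by simp))
    (S.contDiff.contMDiff.contMDiffAt.mdifferentiableAt (n := 1) (by simp))
  have h3 := hev.mfderiv_eq (I := 𝓘(ℝ, Cov)) (I' := 𝓘(ℝ, ℂ × ℂ))
  let T : ℂ × ℂ →L[ℝ] ℂ × ℂ :=
    mfderiv 𝓘(ℝ, ℂ × ℂ) 𝓘(ℝ, ℂ × ℂ) (QuotientAddGroup.mk : ℂ × ℂ → Torus4) (S x)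
  have hT : Function.Injective T :=
    (LinearMap.injective_iff_surjective (f := (T : ℂ × ℂ →ₗ[ℝ] ℂ × ℂ))).2
      ((uniformization_torus4 ℝ).surjective_mfderiv (S x))
  have h4 : mfderiv 𝓘(ℝ, Cov) 𝓘(ℝ, ℂ × ℂ) (transverseProj a) (proj x)
      (mfderiv 𝓘(ℝ, Cov) 𝓘(ℝ, Cov) proj x u) = T (S u) := by
    have h5 : (mfderiv 𝓘(ℝ, Cov) 𝓘(ℝ, ℂ × ℂ) S x : Cov →L[ℝ] ℂ × ℂ) = S := by
      rw [mfderiv_eq_fderiv, S.fderiv]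
    have h6 : (mfderiv 𝓘(ℝ, Cov) 𝓘(ℝ, ℂ × ℂ)
        ((QuotientAddGroup.mk : ℂ × ℂ → Torus4) ∘ S) x : Cov →L[ℝ] ℂ × ℂ) = T.comp S := by
      conv_rhs => rw [← h5]
      exact h2
    have h7 : (mfderiv 𝓘(ℝ, Cov) 𝓘(ℝ, ℂ × ℂ) (transverseProj a ∘ proj) x : Cov →L[ℝ] ℂ × ℂ) =
        T.comp S := h3.trans h6
    exact DFunLike.congr_fun (h1.symm.trans h7) u
  rw [h4]
  have h8 : T (S u) = 0 ↔ S u = 0 := by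
    refine ⟨fun h => hT (h.trans T.map_zero.symm), fun h => by rw [h, map_zero]⟩
  refine h8.trans ?_
  change (shearCLM n u).1 = 0 ↔ _
  rw [shearCLM_apply]
  constructor
  · intro h
    have hz : u.1.2 = 0 := congrArg Prod.snd h
    have hw : u.1.1 + n * u.1.2 = 0 := congrArg Prod.fst h
    rw [hz, mul_zero, add_zero] at hw
    exact Prod.ext hw hz
  · intro h
    simp [h]

theorem isTangent_iff (x u : Cov) :
    foliation.IsTangent (proj x) (mfderiv 𝓘(ℝ, Cov) 𝓘(ℝ, Cov) proj x u) ↔ u.1 = 0 := by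
  constructor
  · rintro ⟨a, ha, h⟩
    exact (mfderiv_transverseProj_eq_zero_iff ha u).1 h
  · intro h
    -- The arcs have length `1/2`, so this one is centred at `x.2`.
    have ha : proj x ∈ chartDomain (x.2 - 1 / 4) :=
      ⟨_, ⟨trivial, by constructor <;> simp only <;> linarith⟩, rfl⟩
    exact ⟨_, ha, (mfderiv_transverseProj_eq_zero_iff ha u).2 h⟩

theorem isHorizontal_iff (α : RoughForm Cov Suspension ℂ k) : foliation.IsHorizontal α ↔
    ∀ x (u : Fin k → Cov), (∃ j, (u j).1 = 0) → lift α x u = 0 := by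
  constructor
  · rintro h x u ⟨j, hj⟩
    exact h (proj x) _ ⟨j, (isTangent_iff x (u j)).2 hj⟩
  · rintro h q u ⟨j, hj⟩
    obtain ⟨x, rfl⟩ := proj_surjective q
    choose v hv using fun i => uniformization_proj.surjective_mfderiv x (u i)
    have h1 := h x v ⟨j, (isTangent_iff x (v j)).1 (by rw [hv]; exact hj)⟩
    have h2 : (fun i => (mfderiv 𝓘(ℝ, Cov) 𝓘(ℝ, Cov) proj x : Cov →L[ℝ] Cov) (v i)) = u :=
      funext hv
    rw [← h2]
    exact h1

/-- From here on the quotient and the foliation enter only through deck invariance and the vanishing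
of the form and its differential on vertical vectors. -/
theorem mem_basicForms_iff {α : RoughForm Cov Suspension ℂ k} : α ∈ foliation.basicForms ℂ k ↔
    ContDiff ℝ ∞ (lift α) ∧
    (∀ x (u : Fin k → Cov), (∃ j, (u j).1 = 0) → lift α x u = 0) ∧
    ∀ x (u : Fin (k + 1) → Cov), (∃ j, (u j).1 = 0) → extDeriv (lift α) x u = 0 := by
  constructor
  · rintro ⟨h1, h2, h3⟩
    exact ⟨contDiff_lift h1, (isHorizontal_iff α).1 h2, lift_d h1 ▸ (isHorizontal_iff _).1 h3⟩
  · rintro ⟨h1, h2, h3⟩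
    have h4 := isSmooth_of_contDiff_lift h1
    exact ⟨h4, (isHorizontal_iff α).2 h2, (isHorizontal_iff _).2 (lift_d h4 ▸ h3)⟩

end Suspension

/-! ### The coefficients of basic forms -/

/-- A polynomial with complex coefficients that is bounded on `ℕ` is constant. -/
theorem Polynomial.eval_eq_of_bounded (p : Polynomial ℂ) {C : ℝ}
    (h : ∀ n : ℕ, ‖p.eval (n : ℂ)‖ ≤ C) (a b : ℂ) : p.eval a = p.eval b := by
  by_cases hd : 0 < p.degree
  · exfalso
    have h1 := p.tendsto_norm_atTop hd (l := Filter.atTop) (z := fun n : ℕ => (n : ℂ))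
      (by simpa using tendsto_natCast_atTop_atTop)
    obtain ⟨n, hn⟩ := (h1.eventually_gt_atTop C).exists
    exact absurd (h n) (not_le.2 hn)
  · rw [Polynomial.eq_C_of_degree_le_zero (not_lt.1 hd)]; simp

/-- Multilinear expansion over the subsets of slots that receive `v i`: each such slot contributes
one factor `t`. -/
theorem ContinuousAlternatingMap.exists_polynomial {E : Type*} [NormedAddCommGroup E]
    [NormedSpace ℝ E] {k : ℕ} (θ : E [⋀^Fin k]→L[ℝ] ℂ) (u v : Fin k → E) :
    ∃ p : Polynomial ℂ, ∀ t : ℝ, θ (fun i => u i + t • v i) = p.eval (t : ℂ) := by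
  refine ⟨∑ s : Finset (Fin k), Polynomial.C (θ (s.piecewise v u)) * Polynomial.X ^ s.card,
    fun t => ?_⟩
  have h1 : (fun i => u i + t • v i) = (fun i => t • v i) + u := by
    funext i; rw [Pi.add_apply, add_comm]
  have h2 := θ.toMultilinearMap.map_add_univ (fun i => t • v i) u
  rw [h1, Polynomial.eval_finsetSum]
  refine h2.trans (Finset.sum_congr rfl fun s _ => ?_)
  have h3 : s.piecewise (fun i => t • v i) u =
      s.piecewise (fun i => t • s.piecewise v u i) (s.piecewise v u) := by
    funext i
    by_cases hi : i ∈ s <;> simp [hi]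
  rw [h3]
  have h4 := θ.toMultilinearMap.map_piecewise_smul (fun _ => t) (s.piecewise v u) s
  refine h4.trans ?_
  rw [Finset.prod_const, Polynomial.eval_mul, Polynomial.eval_C, Polynomial.eval_pow,
    Polynomial.eval_X, Complex.real_smul, Complex.ofReal_pow, mul_comm]
  rfl

/-- A continuous function on `𝕋⁴` that is invariant under the shear only depends on `z`. -/
theorem eq_of_shear_invariant {f : ℂ × ℂ → ℂ} (hf : Continuous f)
    (h : ∀ (n : ℕ), ∀ l ∈ intLattice, ∀ w z, f (w + n * z + l, z) = f (w, z)) (w w' z : ℂ) :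
    f (w, z) = f (w', z) := by
  let r : ℂ → ℂ := fun z => ⌊z.re⌋ + ⌊z.im⌋ * Complex.I
  have hr : ∀ z, r z ∈ intLattice := fun z => ⟨_, _, rfl⟩
  have hr2 : ∀ z, ‖r z - z‖ ≤ 2 := by
    intro z
    refine (Complex.norm_le_abs_re_add_abs_im _).trans ?_
    have h1 : (r z - z).re = -Int.fract z.re := by
      simp only [r, Complex.sub_re, Complex.add_re, Complex.mul_re, Complex.intCast_re,
        Complex.intCast_im, Complex.I_re, Complex.I_im, Int.fract]
      ring
    have h2 : (r z - z).im = -Int.fract z.im := by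
      simp only [r, Complex.sub_im, Complex.add_im, Complex.mul_im, Complex.intCast_re,
        Complex.intCast_im, Complex.I_re, Complex.I_im, Int.fract]
      ring
    rw [h1, h2, abs_neg, abs_neg, Int.abs_fract, Int.abs_fract]
    linarith [Int.fract_lt_one z.re, Int.fract_lt_one z.im]
  -- Rounding to the lattice makes `ζ n` lie within `2 / (n + 1)` of `z`, while `w + (n + 1) ζ n =
  -- w' + l n`. Hence `w` and `w'` lie on one orbit in the fibre over `ζ n`, and continuity passes
  -- the equality to `z`.
  let l : ℕ → ℂ := fun n => r (((n : ℂ) + 1) * z - (w' - w))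
  let ζ : ℕ → ℂ := fun n => (w' - w + l n) / (n + 1)
  have hn : ∀ n : ℕ, (n : ℂ) + 1 ≠ 0 := fun n => by exact_mod_cast n.succ_ne_zero
  have hζ : Filter.Tendsto ζ Filter.atTop (𝓝 z) := by
    rw [tendsto_iff_norm_sub_tendsto_zero]
    have h0 : Filter.Tendsto (fun n : ℕ => 2 * (1 / ((n : ℝ) + 1))) Filter.atTop (𝓝 0) := by
      simpa using tendsto_one_div_add_atTop_nhds_zero_nat.const_mul (2 : ℝ)
    refine squeeze_zero (fun n => norm_nonneg _) (fun n => ?_) h0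
    have h1 : ζ n - z = (l n - (((n : ℂ) + 1) * z - (w' - w))) / (n + 1) := by
      simp only [ζ]
      field_simp [hn n]
      ring
    have h2 : ‖(n : ℂ) + 1‖ = n + 1 := by
      rw [show (n : ℂ) + 1 = ((n + 1 : ℕ) : ℂ) by push_cast; rfl, Complex.norm_natCast]
      push_cast; rfl
    rw [h1, norm_div, h2, div_eq_mul_one_div]
    exact mul_le_mul_of_nonneg_right (hr2 _) (by positivity)
  have hinv : ∀ n, f (w, ζ n) = f (w', ζ n) := by
    intro n
    have h1 := h (n + 1) 0 intLattice.zero_mem w (ζ n)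
    have h2 := h 0 (l n) (hr _) w' (ζ n)
    rw [← h1, ← h2]
    congr 2
    push_cast
    simp only [ζ]
    rw [mul_div_cancel₀ _ (hn n)]
    ring
  have t1 := (hf.tendsto (w, z)).comp ((tendsto_const_nhds (x := w)).prodMk_nhds hζ)
  have t2 := (hf.tendsto (w', z)).comp ((tendsto_const_nhds (x := w')).prodMk_nhds hζ)
  refine tendsto_nhds_unique t1 (t2.congr fun n => (hinv n).symm)

/-! ### Basic forms are pointwise shear invariant and depend only on `z`. -/

namespace Suspension

variable {k : ℕ} {α : RoughForm Cov Suspension ℂ k}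

theorem contDiff_lift_apply (hα : α ∈ foliation.basicForms ℂ k) (u : Fin k → Cov) :
    ContDiff ℝ ∞ fun x => lift α x u :=
  (ContinuousAlternatingMap.apply ℝ Cov ℂ u).contDiff.comp (mem_basicForms_iff.1 hα).1

theorem lift_apply_eq_of_fst_eq (hα : α ∈ foliation.basicForms ℂ k) (p : ℂ × ℂ) (s s' : ℝ)
    (u : Fin k → Cov) : lift α (p, s) u = lift α (p, s') u := by
  obtain ⟨h1, h2, h3⟩ := mem_basicForms_iff.1 hα
  let e : Cov := (0, 1)
  have hd : Differentiable ℝ fun x => lift α x u := (contDiff_lift_apply hα u).differentiable (by simp)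
  have key : ∀ x, fderiv ℝ (fun x => lift α x u) x e = 0 := by
    intro x
    -- In `dα(∂ₛ, u)` every term except the derivative along `∂ₛ` keeps `∂ₛ` as an argument of `α`,
    -- so it vanishes. The condition `i_X dα = 0` then gives independence of `s`.
    have h4 := h3 x (Fin.cons e u : Fin (k + 1) → Cov) ⟨0, rfl⟩
    rw [extDeriv_apply (h1.differentiable (by simp) x), Fin.sum_univ_succ] at h4
    have h5 : ∀ i : Fin k, (fun y => lift α y (i.succ.removeNth (Fin.cons e u : Fin (k + 1) → Cov))) =
        fun _ => 0 := by
      intro i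
      funext y
      have hk : 0 < k := i.pos
      refine h2 y _ ⟨⟨0, hk⟩, ?_⟩
      rw [Fin.removeNth_apply, Fin.succAbove_of_castSucc_lt _ _ (Fin.castSucc_lt_succ_iff.2 (Fin.mk_le_of_le_val (Nat.zero_le _)))]
      rfl
    simp only [h5, Fin.removeNth_zero, Fin.tail_cons, Fin.cons_zero, Fin.val_zero, pow_zero,
      one_smul, fderiv_fun_const, Pi.zero_apply, zero_apply, smul_zero, Finset.sum_const_zero,
      add_zero] at h4
    exact h4
  have h6 : ∀ t : ℝ, HasDerivAt (fun t : ℝ => lift α (p, t) u) 0 t := by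
    intro t
    have h7 : HasDerivAt (fun t : ℝ => ((p, t) : Cov)) e t :=
      (hasDerivAt_const t p).prodMk (hasDerivAt_id t)
    have h8 := (hd (p, t)).hasFDerivAt.comp_hasDerivAt t h7
    rwa [key] at h8
  exact is_const_of_deriv_eq_zero (fun t => (h6 t).differentiableAt) (fun t => (h6 t).deriv) s s'

theorem lift_deck_apply (n : ℤ) {l : ℂ × ℂ} (hl : l ∈ intLattice.prod intLattice) (x : Cov)
    (u : Fin k → Cov) : lift α (deck n l x) (fun i => shearCLM n (u i)) = lift α x u :=
  DFunLike.congr_fun (isDeckInvariant_lift α n l hl x) u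

/-- Only the translations `n = 0` are used: they leave `u` unchanged, so the coefficient is lattice
periodic. Being independent of `s` as well, it is bounded by its values on a compact cell. -/
theorem exists_bound_lift (hα : α ∈ foliation.basicForms ℂ k) (u : Fin k → Cov) :
    ∃ C, ∀ x, ‖lift α x u‖ ≤ C := by
  have hK : IsCompact (((Icc (0 : ℝ) 1 ×ℂ Icc (0 : ℝ) 1) ×ˢ (Icc (0 : ℝ) 1 ×ℂ Icc (0 : ℝ) 1)) ×ˢ
      ({0} : Set ℝ)) :=
    ((isCompact_Icc.reProdIm isCompact_Icc).prod (isCompact_Icc.reProdIm isCompact_Icc)).prod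
      isCompact_singleton
  obtain ⟨C, hC⟩ := hK.exists_bound_of_continuousOn
    (contDiff_lift_apply hα u).continuous.continuousOn
  refine ⟨C, fun x => ?_⟩
  let r : ℂ → ℂ := fun z => ⟨Int.fract z.re, Int.fract z.im⟩
  have hr : ∀ z, r z - z ∈ intLattice := fun z => ⟨-⌊z.re⌋, -⌊z.im⌋, by
    apply Complex.ext <;> simp [r]⟩
  have hr' : ∀ z, r z ∈ (Icc (0 : ℝ) 1 ×ℂ Icc (0 : ℝ) 1) := fun z =>
    ⟨⟨Int.fract_nonneg _, (Int.fract_lt_one _).le⟩, ⟨Int.fract_nonneg _, (Int.fract_lt_one _).le⟩⟩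
  have h1 := lift_deck_apply (α := α) 0 (l := (r x.1.1 - x.1.1, r x.1.2 - x.1.2))
    ⟨hr _, hr _⟩ x u
  simp only [shearCLM_apply, Int.cast_zero, zero_mul, add_zero, deck_apply, add_sub_cancel] at h1
  rw [← h1, lift_apply_eq_of_fst_eq hα _ _ 0]
  exact hC _ ⟨⟨hr' _, hr' _⟩, rfl⟩

/-- This is where unipotence enters. On the vectors `Aᵐ u` the value is a polynomial in `m`; moving
the shear from the vectors to the base point bounds it by a constant depending only on `u`. A
bounded polynomial is constant, so its value at `n` is its value at `0`. -/
theorem lift_shear (hα : α ∈ foliation.basicForms ℂ k) (n : ℤ) (x : Cov) (u : Fin k → Cov) :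
    lift α x (fun i => shearCLM n (u i)) = lift α x u := by
  obtain ⟨C, hC⟩ := exists_bound_lift hα u
  obtain ⟨p, hp⟩ := (lift α x).exists_polynomial u fun i => (((u i).1.2, 0), 0)
  have hshear : ∀ m : ℤ, lift α x (fun i => shearCLM m (u i)) = p.eval (m : ℂ) := by
    intro m
    rw [show (m : ℂ) = ((m : ℝ) : ℂ) by push_cast; rfl, ← hp]
    congr 1
    funext i
    rw [shearCLM_apply]
    refine Prod.ext (Prod.ext ?_ ?_) ?_ <;> simp
  have hb : ∀ m : ℕ, ‖p.eval (m : ℂ)‖ ≤ C := by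
    intro m
    have h1 := hshear m
    -- The deck transformation with `-m` undoes the shear of the vectors, at the cost of moving the
    -- base point, which the bound `C` does not see.
    have h2 := lift_deck_apply (α := α) (-m : ℤ) (l := 0) (zero_mem _) x
      (fun i => shearCLM m (u i))
    have h3 : ∀ i, shearCLM (-m : ℤ) (shearCLM m (u i)) = u i := fun i => by
      simp [shearCLM_apply]
    simp only [h3] at h2
    rw [Int.cast_natCast] at h1
    rw [← h1, ← h2]
    exact hC _
  rw [hshear, p.eval_eq_of_bounded hb n 0, ← Int.cast_zero, ← hshear]
  simp [shearCLM_apply]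

theorem lift_apply_deck (hα : α ∈ foliation.basicForms ℂ k) (n : ℤ) {l : ℂ × ℂ}
    (hl : l ∈ intLattice.prod intLattice) (x : Cov) (u : Fin k → Cov) :
    lift α (deck n l x) u = lift α x u := by
  rw [← lift_deck_apply n hl x u, lift_shear hα]

/-- Pointwise invariance turns deck invariance of the form into invariance of each coefficient as a
function, to which `eq_of_shear_invariant` applies. -/
theorem lift_eq (hα : α ∈ foliation.basicForms ℂ k) (x : Cov) :
    lift α x = lift α ((0, x.1.2), 0) := by
  refine ContinuousAlternatingMap.ext fun u => ?_
  rw [← Prod.mk.eta (p := x), lift_apply_eq_of_fst_eq hα x.1 x.2 0 u]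
  refine eq_of_shear_invariant (f := fun p => lift α (p, 0) u)
    ((contDiff_lift_apply hα u).continuous.comp (by fun_prop)) (fun n l hl w z => ?_) x.1.1 0 x.1.2
  have h1 := lift_apply_deck hα n (l := (l, 0)) ⟨hl, zero_mem _⟩ ((w, z), 0) u
  rw [deck_apply] at h1
  simp only [Int.cast_natCast, add_zero, zero_add] at h1
  rw [lift_apply_eq_of_fst_eq hα _ _ 0] at h1
  exact h1

theorem isSmoothPeriodic_lift (hα : α ∈ foliation.basicForms ℂ k) (u : Fin k → Cov) :
    IsSmoothPeriodic fun z => lift α ((0, z), 0) u := by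
  have h : ∀ v ∈ intLattice, ∀ z, lift α ((0, z + v), 0) u = lift α ((0, z), 0) u := by
    intro v hv z
    have h1 := lift_apply_deck hα 0 (l := (0, v)) ⟨zero_mem _, hv⟩ ((0, z), 0) u
    rw [deck_apply] at h1
    simpa using h1
  refine ⟨(contDiff_lift_apply hα u).comp (by fun_prop), h 1 ⟨1, 0, by simp⟩,
    h Complex.I ⟨0, 1, by simp⟩⟩

end Suspension

/-! ### Derivatives of smooth functions on `𝕋²` -/

theorem isSmoothPeriodic_wirtinger {f : ℂ → ℂ} (hf : IsSmoothPeriodic f) :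
    IsSmoothPeriodic (wirtinger f) := by
  have := ((hf.fderiv_apply 1).const_mul (1 / 2)).add
    ((hf.fderiv_apply Complex.I).const_mul (-Complex.I / 2))
  convert this using 2 with z
  rw [wirtinger]; ring

theorem isSmoothPeriodic_wirtingerBar {f : ℂ → ℂ} (hf : IsSmoothPeriodic f) :
    IsSmoothPeriodic (wirtingerBar f) := by
  have := ((hf.fderiv_apply 1).const_mul (1 / 2)).add
    ((hf.fderiv_apply Complex.I).const_mul (Complex.I / 2))
  convert this using 2 with z
  rw [wirtingerBar]; ring

/-- The operator `∂/∂z` on functions on `𝕋²`. -/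
noncomputable def delZ (g : SmoothTorus2) : SmoothTorus2 :=
  (exists_periodic_eq (isSmoothPeriodic_wirtinger (isSmoothPeriodic_periodic g))).choose

/-- The operator `∂/∂z̄` on functions on `𝕋²`. -/
noncomputable def delZBar (g : SmoothTorus2) : SmoothTorus2 :=
  (exists_periodic_eq (isSmoothPeriodic_wirtingerBar (isSmoothPeriodic_periodic g))).choose

theorem periodic_delZ (g : SmoothTorus2) (z : ℂ) :
    periodic (delZ g) z = wirtinger (periodic g) z :=
  congrFun (exists_periodic_eq
    (isSmoothPeriodic_wirtinger (isSmoothPeriodic_periodic g))).choose_spec z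

theorem periodic_delZBar (g : SmoothTorus2) (z : ℂ) :
    periodic (delZBar g) z = wirtingerBar (periodic g) z :=
  congrFun (exists_periodic_eq
    (isSmoothPeriodic_wirtingerBar (isSmoothPeriodic_periodic g))).choose_spec z

theorem periodic_zero (z : ℂ) : periodic 0 z = 0 := rfl

theorem periodic_sub (f g : SmoothTorus2) (z : ℂ) :
    periodic (f - g) z = periodic f z - periodic g z := rfl

theorem smoothTorus2_ext {f g : SmoothTorus2} (h : ∀ z, periodic f z = periodic g z) : f = g :=
  periodic_injective (funext h)

theorem wirtinger_const (c z : ℂ) : wirtinger (periodic (constTorus2 c)) z = 0 := by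
  have : periodic (constTorus2 c) = fun _ => c := rfl
  simp [wirtinger, this]

theorem wirtingerBar_const (c z : ℂ) : wirtingerBar (periodic (constTorus2 c)) z = 0 := by
  have : periodic (constTorus2 c) = fun _ => c := rfl
  simp [wirtingerBar, this]

namespace Suspension

/-! ### Forms with coefficients depending on `z` -/

/-- A basis of the `k`-covectors on the covering that are horizontal and invariant under the shear,
with its dual basis. -/
structure InvariantBasis (k m : ℕ) where
  T : Fin m → Cov [⋀^Fin k]→L[ℝ] ℂ
  coeff : Fin m → (Cov [⋀^Fin k]→L[ℝ] ℂ) →L[ℝ] ℂ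
  horizontal : ∀ j (u : Fin k → Cov), (∃ i, (u i).1 = 0) → T j u = 0
  shear : ∀ j (n : ℤ) (u : Fin k → Cov), T j (fun i => shearCLM n (u i)) = T j u
  coeff_sum : ∀ (c : Fin m → ℂ) j, coeff j (∑ i, c i • T i) = c j
  sum_coeff : ∀ θ : Cov [⋀^Fin k]→L[ℝ] ℂ, (∀ u : Fin k → Cov, (∃ i, (u i).1 = 0) → θ u = 0) →
    (∀ u : Fin k → Cov, θ (fun i => shearCLM 1 (u i)) = θ u) → θ = ∑ i, coeff i θ • T i

variable {k m : ℕ} (B : InvariantBasis k m)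

/-- The form on the covering with given coefficients. -/
noncomputable def InvariantBasis.coverForm (g : Fin m → SmoothTorus2) (x : Cov) :
    Cov [⋀^Fin k]→L[ℝ] ℂ :=
  ∑ j, periodic (g j) x.1.2 • B.T j

namespace InvariantBasis

theorem coverForm_apply (g : Fin m → SmoothTorus2) (x : Cov) (u : Fin k → Cov) :
    B.coverForm g x u = ∑ j, periodic (g j) x.1.2 * B.T j u := by
  simp [coverForm, ContinuousAlternatingMap.sum_apply]

theorem contDiff_coverForm (g : Fin m → SmoothTorus2) : ContDiff ℝ ∞ (B.coverForm g) :=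
  ContDiff.sum fun j _ =>
    ((contDiff_periodic (g j)).comp (contDiff_snd.comp contDiff_fst)).smul contDiff_const

theorem isDeckInvariant_coverForm (g : Fin m → SmoothTorus2) :
    IsDeckInvariant (B.coverForm g) := by
  intro n l hl x
  refine ContinuousAlternatingMap.ext fun u => ?_
  have h1 : ∀ j, periodic (g j) (deck n l x).1.2 = periodic (g j) x.1.2 := fun j => by
    rw [deck_apply]
    exact (isSmoothPeriodic_periodic (g j)).add_mem hl.2 _
  rw [ContinuousAlternatingMap.compContinuousLinearMap_apply, coverForm_apply, coverForm_apply]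
  refine Finset.sum_congr rfl fun j _ => ?_
  rw [h1]
  exact congrArg _ (B.shear j n u)

theorem coverForm_injective : Function.Injective B.coverForm := by
  intro g g' h
  funext j
  refine smoothTorus2_ext fun z => ?_
  have h1 := congrArg (B.coeff j) (congrFun h ((0, z), 0))
  rwa [coverForm, coverForm, B.coeff_sum (fun j => periodic (g j) z),
    B.coeff_sum (fun j => periodic (g' j) z)] at h1

/-- The covectors `T j` are constant, so the differential is `∑ dgⱼ ∧ Tⱼ` with `dgⱼ = ∂gⱼ dz + ∂̄gⱼ
dz̄`. -/
theorem extDeriv_coverForm_apply (g : Fin m → SmoothTorus2) (x : Cov) (u : Fin (k + 1) → Cov) :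
    extDeriv (B.coverForm g) x u = ∑ i : Fin (k + 1), (-1) ^ (i : ℕ) * ∑ j,
      (periodic (delZ (g j)) x.1.2 * dz (u i) + periodic (delZBar (g j)) x.1.2 * dzBar (u i)) *
        B.T j (i.removeNth u) := by
  rw [extDeriv_apply ((B.contDiff_coverForm g).differentiable (by simp) x)]
  refine Finset.sum_congr rfl fun i _ => ?_
  have h1 : HasFDerivAt (fun y => B.coverForm g y (i.removeNth u)) (∑ j,
      (B.T j (i.removeNth u)) • ((fderiv ℝ (periodic (g j)) x.1.2).comp
        ((ContinuousLinearMap.snd ℝ ℂ ℂ).comp (ContinuousLinearMap.fst ℝ (ℂ × ℂ) ℝ)))) x := by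
    simp only [coverForm_apply]
    refine HasFDerivAt.fun_sum fun j _ => ?_
    refine HasFDerivAt.mul_const ?_ _
    exact (differentiable_periodic (g j) _).hasFDerivAt.comp x
      ((ContinuousLinearMap.snd ℝ ℂ ℂ).comp (ContinuousLinearMap.fst ℝ (ℂ × ℂ) ℝ)).hasFDerivAt
  rw [h1.fderiv]
  have h2 : ∀ j, fderiv ℝ (periodic (g j)) x.1.2 (u i).1.2 =
      periodic (delZ (g j)) x.1.2 * dz (u i) + periodic (delZBar (g j)) x.1.2 * dzBar (u i) :=
    fun j => by rw [fderiv_eq_wirtinger, periodic_delZ, periodic_delZBar]; rfl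
  simp only [← h2, sum_apply, smul_apply, smul_eq_mul, ContinuousLinearMap.comp_apply,
    ContinuousLinearMap.coe_fst', ContinuousLinearMap.coe_snd', zsmul_eq_mul]
  push_cast
  congr 1
  exact Finset.sum_congr rfl fun j _ => mul_comm _ _

theorem coverForm_horizontal (g : Fin m → SmoothTorus2) (x : Cov) (u : Fin k → Cov)
    (hu : ∃ i, (u i).1 = 0) : B.coverForm g x u = 0 := by
  rw [coverForm_apply]
  exact Finset.sum_eq_zero fun j _ => by rw [B.horizontal j u hu, mul_zero]

theorem extDeriv_coverForm_horizontal (g : Fin m → SmoothTorus2) (x : Cov)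
    (u : Fin (k + 1) → Cov) (hu : ∃ i, (u i).1 = 0) : extDeriv (B.coverForm g) x u = 0 := by
  obtain ⟨i₀, hi₀⟩ := hu
  rw [extDeriv_coverForm_apply]
  refine Finset.sum_eq_zero fun i _ => mul_eq_zero_of_right _ (Finset.sum_eq_zero fun j _ => ?_)
  by_cases hi : i₀ = i
  · subst hi
    have h1 : dz (u i₀) = 0 := congrArg Prod.snd hi₀
    have h2 : dzBar (u i₀) = 0 := by
      change (starRingEnd ℂ) (u i₀).1.2 = 0
      rw [hi₀]; exact map_zero _
    rw [h1, h2, mul_zero, mul_zero, add_zero, zero_mul]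
  · obtain ⟨r, hr⟩ := Fin.exists_succAbove_eq hi
    refine mul_eq_zero_of_right _ (B.horizontal j _ ⟨r, ?_⟩)
    rw [Fin.removeNth_apply, hr, hi₀]

/-- The form on the suspension with given coefficients. -/
noncomputable def form : (Fin m → SmoothTorus2) →ₗ[ℂ] RoughForm Cov Suspension ℂ k where
  toFun g := descend (B.coverForm g)
  map_add' g g' := lift_injective <| by
    rw [lift_add, lift_descend (B.isDeckInvariant_coverForm _),
      lift_descend (B.isDeckInvariant_coverForm _), lift_descend (B.isDeckInvariant_coverForm _)]
    funext x
    refine ContinuousAlternatingMap.ext fun u => ?_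
    rw [Pi.add_apply, ContinuousAlternatingMap.add_apply]
    simp only [coverForm_apply, Pi.add_apply, periodic_add, add_mul, Finset.sum_add_distrib]
  map_smul' c g := lift_injective <| by
    rw [RingHom.id_apply, lift_smul, lift_descend (B.isDeckInvariant_coverForm _),
      lift_descend (B.isDeckInvariant_coverForm _)]
    funext x
    simp only [coverForm, Pi.smul_apply, periodic_smul, mul_smul, Finset.smul_sum]

theorem lift_form (g : Fin m → SmoothTorus2) : lift (B.form g) = B.coverForm g :=
  lift_descend (B.isDeckInvariant_coverForm g)

theorem form_injective : Function.Injective B.form := fun g g' h =>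
  B.coverForm_injective (by rw [← lift_form, ← lift_form, h])

theorem form_mem_basicForms (g : Fin m → SmoothTorus2) :
    B.form g ∈ foliation.basicForms ℂ k := by
  rw [mem_basicForms_iff, lift_form]
  exact ⟨B.contDiff_coverForm g, B.coverForm_horizontal g, B.extDeriv_coverForm_horizontal g⟩

/-- At each point the lift is a horizontal invariant covector, hence a combination of the `T i`. By
`lift_eq` its coefficients are functions of `z`. So basic `k`-forms are exactly `m`-tuples of
functions on `𝕋²`. -/
theorem exists_form_eq {α : RoughForm Cov Suspension ℂ k} (hα : α ∈ foliation.basicForms ℂ k) :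
    ∃ g, B.form g = α := by
  have h1 : ∀ j, IsSmoothPeriodic fun z => B.coeff j (lift α ((0, z), 0)) := by
    intro j
    have h2 : ∀ z v, (∀ u, lift α ((0, z + v), 0) u = lift α ((0, z), 0) u) →
        B.coeff j (lift α ((0, z + v), 0)) = B.coeff j (lift α ((0, z), 0)) := fun z v h =>
      congrArg _ (ContinuousAlternatingMap.ext h)
    refine ⟨?_, fun z => h2 z 1 fun u => (isSmoothPeriodic_lift hα u).add_one z,
      fun z => h2 z _ fun u => (isSmoothPeriodic_lift hα u).add_I z⟩
    exact (B.coeff j).contDiff.comp ((mem_basicForms_iff.1 hα).1.comp (by fun_prop))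
  choose g hg using fun j => exists_periodic_eq (h1 j)
  refine ⟨g, lift_injective ?_⟩
  rw [lift_form]
  funext x
  rw [lift_eq hα x, B.sum_coeff (lift α ((0, x.1.2), 0))
    (fun u => (mem_basicForms_iff.1 hα).2.1 _ u) (lift_shear hα 1 _)]
  exact Finset.sum_congr rfl fun j _ => by rw [congrFun (hg j) x.1.2]

theorem d_form {m' : ℕ} (B' : InvariantBasis (k + 1) m') (g : Fin m → SmoothTorus2)
    (g' : Fin m' → SmoothTorus2)
    (h : ∀ x u, extDeriv (B.coverForm g) x u = B'.coverForm g' x u) :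
    RoughForm.d (B.form g) = B'.form g' := by
  refine lift_injective ?_
  rw [lift_d (B.form_mem_basicForms g).1, lift_form, lift_form]
  exact funext fun x => ContinuousAlternatingMap.ext (h x)

end InvariantBasis

/-! ### Closed and exact forms -/

theorem mem_closedForms_iff {α : RoughForm Cov Suspension ℂ k} :
    α ∈ foliation.closedForms ℂ k ↔ α ∈ foliation.basicForms ℂ k ∧ RoughForm.d α = 0 := by
  constructor
  · rintro ⟨β, hβ, rfl⟩
    exact ⟨β.2, hβ⟩
  · rintro ⟨h1, h2⟩
    exact ⟨⟨α, h1⟩, h2, rfl⟩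

theorem mem_exactForms_succ_iff {α : RoughForm Cov Suspension ℂ (k + 1)} :
    α ∈ foliation.exactForms ℂ (k + 1) ↔ ∃ β ∈ foliation.basicForms ℂ k, RoughForm.d β = α := by
  constructor
  · rintro ⟨β, rfl⟩
    exact ⟨β.1, β.2, rfl⟩
  · rintro ⟨β, h1, h2⟩
    exact ⟨⟨β, h1⟩, h2⟩

theorem exists_equiv_basicCohomology {C : Type*} [AddCommGroup C] [Module ℂ C]
    (L : C →ₗ[ℂ] RoughForm Cov Suspension ℂ k) (hL : ∀ c, L c ∈ foliation.closedForms ℂ k)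
    (hinj : ∀ c, L c ∈ foliation.exactForms ℂ k → c = 0)
    (hsurj : ∀ α ∈ foliation.closedForms ℂ k, ∃ c, α - L c ∈ foliation.exactForms ℂ k) :
    ∃ Φ : C ≃ₗ[ℂ] foliation.basicCohomology ℂ k, ∀ c,
      ∃ α : foliation.closedForms ℂ k, Submodule.Quotient.mk α = Φ c ∧ α.1 = L c := by
  let L' : C →ₗ[ℂ] foliation.closedForms ℂ k := L.codRestrict _ hL
  let Ψ := (Submodule.mkQ ((foliation.exactForms ℂ k).submoduleOf (foliation.closedForms ℂ k))).comp L'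
  refine ⟨LinearEquiv.ofBijective Ψ ⟨?_, ?_⟩, fun c => ⟨L' c, rfl, rfl⟩⟩
  · refine (injective_iff_map_eq_zero Ψ).2 fun c hc => hinj c ?_
    have h : L' c ∈ (foliation.exactForms ℂ k).submoduleOf (foliation.closedForms ℂ k) :=
      (Submodule.Quotient.mk_eq_zero _).1 hc
    exact h
  · intro q
    obtain ⟨α, rfl⟩ := Submodule.mkQ_surjective _ q
    obtain ⟨c, hc⟩ := hsurj α.1 α.2
    refine ⟨c, Eq.symm ?_⟩
    exact (Submodule.Quotient.eq _).2 hc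

end Suspension

namespace Suspension

/-! ### Wedge products of covectors as alternating maps -/

/-- `dw` as a real linear form. -/
noncomputable def dwL : Cov →L[ℝ] ℂ :=
  (ContinuousLinearMap.fst ℝ ℂ ℂ).comp (ContinuousLinearMap.fst ℝ (ℂ × ℂ) ℝ)

/-- `dz` as a real linear form. -/
noncomputable def dzL : Cov →L[ℝ] ℂ :=
  (ContinuousLinearMap.snd ℝ ℂ ℂ).comp (ContinuousLinearMap.fst ℝ (ℂ × ℂ) ℝ)

/-- `dw̄` as a real linear form. -/
noncomputable def dwBarL : Cov →L[ℝ] ℂ := (Complex.conjCLE : ℂ →L[ℝ] ℂ).comp dwL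

/-- `dz̄` as a real linear form. -/
noncomputable def dzBarL : Cov →L[ℝ] ℂ := (Complex.conjCLE : ℂ →L[ℝ] ℂ).comp dzL

/-- The wedge product of covectors as an alternating map. -/
noncomputable def wedgeForm {k : ℕ} (θ : Fin k → (Cov →L[ℝ] ℂ)) : Cov [⋀^Fin k]→L[ℝ] ℂ where
  toFun u := wedge (fun i => θ i) u
  map_update_add' {inst} u j a b := by
    -- The multilinearity fields quantify over an arbitrary decidability instance; it is identified
    -- with the standard one used in the matrix lemmas.
    have := Subsingleton.elim inst (instDecidableEqFin k)
    subst this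
    have h : ∀ c, (Matrix.of fun i j' => θ i (Function.update u j c j')) =
        (Matrix.of fun i j' => θ i (u j')).updateCol j (fun i => θ i c) := by
      intro c
      ext i j'
      by_cases hj : j' = j
      · subst hj; simp
      · simp [hj]
    simp only [wedge, h, map_add]
    exact Matrix.det_updateCol_add _ _ _ _
  map_update_smul' {inst} u j r a := by
    have := Subsingleton.elim inst (instDecidableEqFin k)
    subst this
    have h : ∀ c, (Matrix.of fun i j' => θ i (Function.update u j c j')) =
        (Matrix.of fun i j' => θ i (u j')).updateCol j (fun i => θ i c) := by
      intro c
      ext i j'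
      by_cases hj : j' = j
      · subst hj; simp
      · simp [hj]
    simp only [wedge, h, map_smul]
    exact Matrix.det_updateCol_smul _ _ (r : ℂ) _
  cont := by
    refine Continuous.matrix_det (continuous_matrix fun i j => ?_)
    exact (θ i).continuous.comp (continuous_apply j)
  map_eq_zero_of_eq' u i j hu hij := by
    refine Matrix.det_zero_of_column_eq hij fun r => ?_
    simp [hu]

theorem wedgeForm_apply {k : ℕ} (θ : Fin k → (Cov →L[ℝ] ℂ)) (u : Fin k → Cov) :
    wedgeForm θ u = wedge (fun i => θ i) u := rfl

theorem wedgeForm_horizontal {k : ℕ} (θ : Fin k → (Cov →L[ℝ] ℂ))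
    (hθ : ∀ i u, u.1 = 0 → θ i u = 0) (u : Fin k → Cov) (hu : ∃ i, (u i).1 = 0) :
    wedgeForm θ u = 0 := by
  obtain ⟨j, hj⟩ := hu
  exact Matrix.det_eq_zero_of_column_eq_zero j fun i => hθ i _ hj

/-! ### A criterion for equality of horizontal alternating forms -/

/-- The real coordinate vectors of `ℂ²`, lifted to the covering. -/
noncomputable def coordVec : Fin 4 → Cov :=
  ![((1, 0), 0), ((Complex.I, 0), 0), ((0, 1), 0), ((0, Complex.I), 0)]

/-- The real coordinate basis of the covering. -/
noncomputable def coordBasis : Module.Basis (Fin 4 ⊕ Unit) ℝ Cov :=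
  ((Complex.basisOneI.prod Complex.basisOneI).reindex finSumFinEquiv).prod
    (Module.Basis.singleton Unit ℝ)

theorem coordBasis_inl (i : Fin 4) : coordBasis (Sum.inl i) = coordVec i := by
  fin_cases i <;>
  simp [coordBasis, coordVec, finSumFinEquiv, Fin.addCases]

theorem coordBasis_inr (i : Unit) : (coordBasis (Sum.inr i)).1 = 0 := by
  simp [coordBasis]

/-- Basis tuples containing `∂ₛ` give zero. Any other injective tuple can be sorted, which changes
both sides by the same sign. -/
theorem ext_horizontal {k : ℕ} {θ θ' : Cov [⋀^Fin k]→L[ℝ] ℂ}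
    (hθ : ∀ u : Fin k → Cov, (∃ i, (u i).1 = 0) → θ u = 0)
    (hθ' : ∀ u : Fin k → Cov, (∃ i, (u i).1 = 0) → θ' u = 0)
    (h : ∀ v : Fin k → Fin 4, StrictMono v →
      θ (fun i => coordVec (v i)) = θ' (fun i => coordVec (v i))) : θ = θ' := by
  refine ContinuousAlternatingMap.toAlternatingMap_injective ?_
  refine Module.Basis.ext_alternating coordBasis fun v hv => ?_
  by_cases hr : ∃ i j, v i = Sum.inr j
  · obtain ⟨i, j, hij⟩ := hr
    have h0 : (coordBasis (v i)).1 = 0 := by rw [hij]; exact coordBasis_inr j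
    exact (hθ _ ⟨i, h0⟩).trans (hθ' _ ⟨i, h0⟩).symm
  · have hl : ∀ i, ∃ j, v i = Sum.inl j := by
      intro i
      rcases hvi : v i with j | j
      · exact ⟨j, rfl⟩
      · exact absurd ⟨i, j, hvi⟩ hr
    choose r hr using hl
    have hrinj : Function.Injective r := fun i j hij => hv (by rw [hr, hr, hij])
    let σ := Tuple.sort r
    have hmono : StrictMono (r ∘ σ) :=
      (Tuple.monotone_sort r).strictMono_of_injective (hrinj.comp σ.injective)
    have h1 := h (r ∘ σ) hmono
    have h2 : (fun i => coordBasis (v i)) = fun i => coordVec (r i) :=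
      funext fun i => by rw [hr, coordBasis_inl]
    rw [h2]
    have h3 := θ.toAlternatingMap.map_perm (fun i => coordVec (r i)) σ
    have h4 := θ'.toAlternatingMap.map_perm (fun i => coordVec (r i)) σ
    have h5 : θ.toAlternatingMap ((fun i => coordVec (r i)) ∘ σ) =
        θ'.toAlternatingMap ((fun i => coordVec (r i)) ∘ σ) := h1
    rw [h3, h4] at h5
    exact smul_left_cancel _ h5

theorem shear_coordVec : shearCLM 1 (coordVec 0) = coordVec 0 ∧
    shearCLM 1 (coordVec 1) = coordVec 1 ∧
    shearCLM 1 (coordVec 2) = coordVec 2 + coordVec 0 ∧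
    shearCLM 1 (coordVec 3) = coordVec 3 + coordVec 1 := by
  simp [shearCLM_apply, coordVec]

theorem map_slot_add {k : ℕ} (θ : Cov [⋀^Fin k]→L[ℝ] ℂ) (i : Fin k) (u u₁ u₂ : Fin k → Cov)
    (h1 : ∀ j, j ≠ i → u j = u₁ j) (h2 : ∀ j, j ≠ i → u j = u₂ j) (h : u i = u₁ i + u₂ i) :
    θ u = θ u₁ + θ u₂ := by
  have e : u = Function.update u i (u₁ i + u₂ i) := by rw [← h, Function.update_eq_self]
  have e1 : u₁ = Function.update u i (u₁ i) := by
    funext j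
    by_cases hj : j = i
    · subst hj; simp
    · simp [hj, h1 j hj]
  have e2 : u₂ = Function.update u i (u₂ i) := by
    funext j
    by_cases hj : j = i
    · subst hj; simp
    · simp [hj, h2 j hj]
  rw [e, θ.map_update_add, ← e1, ← e2]

end Suspension

namespace Suspension

/-! ### Invariant covectors -/

theorem dwL_apply (u : Cov) : dwL u = dw u := rfl

theorem dzL_apply (u : Cov) : dzL u = dz u := rfl

theorem dwBarL_apply (u : Cov) : dwBarL u = dwBar u := rfl

theorem dzBarL_apply (u : Cov) : dzBarL u = dzBar u := rfl

theorem dw_shear (n : ℤ) (u : Cov) : dw (shearCLM n u) = dw u + n * dz u := by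
  rw [shearCLM_apply]; rfl

theorem dz_shear (n : ℤ) (u : Cov) : dz (shearCLM n u) = dz u := by
  rw [shearCLM_apply]; rfl

theorem dwBar_shear (n : ℤ) (u : Cov) : dwBar (shearCLM n u) = dwBar u + n * dzBar u := by
  rw [shearCLM_apply]; simp [dwBar, dzBar]

theorem dzBar_shear (n : ℤ) (u : Cov) : dzBar (shearCLM n u) = dzBar u := by
  rw [shearCLM_apply]; rfl

theorem covector_coordVec : (∀ i, dw (coordVec i) = ![1, Complex.I, 0, 0] i) ∧
    (∀ i, dwBar (coordVec i) = ![1, -Complex.I, 0, 0] i) ∧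
    (∀ i, dz (coordVec i) = ![0, 0, 1, Complex.I] i) ∧
    (∀ i, dzBar (coordVec i) = ![0, 0, 1, -Complex.I] i) := by
  refine ⟨fun i => ?_, fun i => ?_, fun i => ?_, fun i => ?_⟩ <;> fin_cases i <;>
    simp [coordVec, dw, dz, dwBar, dzBar]

theorem covectorL_horizontal : (∀ u : Cov, u.1 = 0 → dwL u = 0) ∧ (∀ u : Cov, u.1 = 0 → dzL u = 0) ∧
    (∀ u : Cov, u.1 = 0 → dwBarL u = 0) ∧ (∀ u : Cov, u.1 = 0 → dzBarL u = 0) := by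
  refine ⟨fun u hu => ?_, fun u hu => ?_, fun u hu => ?_, fun u hu => ?_⟩ <;>
    simp [dwL, dzL, dwBarL, dzBarL, hu]

theorem wedge_one (a : Cov → ℂ) (u : Fin 1 → Cov) : wedge ![a] u = a (u 0) := by
  simp [wedge]

theorem wedge_two (a b : Cov → ℂ) (u : Fin 2 → Cov) :
    wedge ![a, b] u = a (u 0) * b (u 1) - a (u 1) * b (u 0) := by
  simp [wedge, Matrix.det_fin_two]

theorem wedge_three (a b c : Cov → ℂ) (u : Fin 3 → Cov) : wedge ![a, b, c] u =
    a (u 0) * b (u 1) * c (u 2) - a (u 0) * b (u 2) * c (u 1) - a (u 1) * b (u 0) * c (u 2)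
    + a (u 1) * b (u 2) * c (u 0) + a (u 2) * b (u 0) * c (u 1) - a (u 2) * b (u 1) * c (u 0) := by
  simp [wedge, Matrix.det_fin_three]

theorem wedge_four (a b c d : Cov → ℂ) (u : Fin 4 → Cov) : wedge ![a, b, c, d] u =
    a (u 0) * wedge ![b, c, d] ![u 1, u 2, u 3] - a (u 1) * wedge ![b, c, d] ![u 0, u 2, u 3]
    + a (u 2) * wedge ![b, c, d] ![u 0, u 1, u 3] - a (u 3) * wedge ![b, c, d] ![u 0, u 1, u 2] := by
  simp only [wedge_three]
  simp [wedge, Matrix.det_succ_row_zero, Fin.sum_univ_succ, Fin.succAbove]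
  ring

theorem wedgeForm_one (a : Cov →L[ℝ] ℂ) (u : Fin 1 → Cov) :
    wedgeForm ![a] u = wedge ![⇑a] u := by
  rw [wedgeForm_apply]; congr 1; funext i; fin_cases i; rfl

theorem wedgeForm_two (a b : Cov →L[ℝ] ℂ) (u : Fin 2 → Cov) :
    wedgeForm ![a, b] u = wedge ![⇑a, ⇑b] u := by
  rw [wedgeForm_apply]; congr 1; funext i; fin_cases i <;> rfl

theorem wedgeForm_three (a b c : Cov →L[ℝ] ℂ) (u : Fin 3 → Cov) :
    wedgeForm ![a, b, c] u = wedge ![⇑a, ⇑b, ⇑c] u := by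
  rw [wedgeForm_apply]; congr 1; funext i; fin_cases i <;> rfl

theorem wedgeForm_four (a b c d : Cov →L[ℝ] ℂ) (u : Fin 4 → Cov) :
    wedgeForm ![a, b, c, d] u = wedge ![⇑a, ⇑b, ⇑c, ⇑d] u := by
  rw [wedgeForm_apply]; congr 1; funext i; fin_cases i <;> rfl

theorem sum_smul_horizontal {k m : ℕ} {T : Fin m → Cov [⋀^Fin k]→L[ℝ] ℂ}
    (hT : ∀ j (u : Fin k → Cov), (∃ i, (u i).1 = 0) → T j u = 0) (c : Fin m → ℂ)
    (u : Fin k → Cov) (hu : ∃ i, (u i).1 = 0) : (∑ j, c j • T j) u = 0 := by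
  rw [ContinuousAlternatingMap.sum_apply]
  exact Finset.sum_eq_zero fun j _ => by
    rw [ContinuousAlternatingMap.smul_apply, hT j u hu, smul_zero]

/-- Evaluation of alternating forms on coordinate vectors. -/
noncomputable def evalCoord {k : ℕ} (v : Fin k → Fin 4) : (Cov [⋀^Fin k]→L[ℝ] ℂ) →L[ℝ] ℂ :=
  ContinuousAlternatingMap.apply ℝ Cov ℂ fun i => coordVec (v i)

theorem evalCoord_apply {k : ℕ} (v : Fin k → Fin 4) (θ : Cov [⋀^Fin k]→L[ℝ] ℂ) :
    evalCoord v θ = θ fun i => coordVec (v i) := rfl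

/-- Degree `0`: the constant `1`. -/
noncomputable def basisZero : InvariantBasis 0 1 where
  T := ![wedgeForm ![]]
  coeff := ![evalCoord ![]]
  horizontal := fun _ _ ⟨i, _⟩ => i.elim0
  shear j n u := congrArg _ (Subsingleton.elim _ _)
  coeff_sum c j := by
    fin_cases j
    simp [evalCoord_apply, wedgeForm_apply, wedge]
  sum_coeff θ _ _ := by
    refine ContinuousAlternatingMap.ext fun u => ?_
    have : u = fun i : Fin 0 => coordVec ((![] : Fin 0 → Fin 4) i) := Subsingleton.elim _ _
    rw [this]
    simp [evalCoord_apply, wedgeForm_apply, wedge]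

theorem coordVec_comp_two (a b : Fin 4) :
    (fun i => coordVec ((![a, b] : Fin 2 → Fin 4) i)) = ![coordVec a, coordVec b] := by
  funext i; fin_cases i <;> rfl

theorem coordVec_comp_three (a b c : Fin 4) :
    (fun i => coordVec ((![a, b, c] : Fin 3 → Fin 4) i)) =
      ![coordVec a, coordVec b, coordVec c] := by
  funext i; fin_cases i <;> rfl

theorem coordVec_comp_four (a b c d : Fin 4) :
    (fun i => coordVec ((![a, b, c, d] : Fin 4 → Fin 4) i)) =
      ![coordVec a, coordVec b, coordVec c, coordVec d] := by
  funext i; fin_cases i <;> rfl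

/-- Degree `1`: the covectors `dz` and `dz̄`. -/
noncomputable def basisOne : InvariantBasis 1 2 where
  T := ![wedgeForm ![dzL], wedgeForm ![dzBarL]]
  -- For `θ = a dz + b dz̄` the values on coordinate vectors 2 and 3 are `a + b` and `i(a - b)`;
  -- this inverts that system.
  coeff := ![(1 / 2 : ℂ) • evalCoord ![2] - (Complex.I / 2) • evalCoord ![3],
    (1 / 2 : ℂ) • evalCoord ![2] + (Complex.I / 2) • evalCoord ![3]]
  horizontal j u := by
    obtain ⟨h1, h2, h3, h4⟩ := covectorL_horizontal
    fin_cases j <;> refine wedgeForm_horizontal _ ?_ u <;> intro i <;> fin_cases i <;> assumption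
  shear j n u := by
    fin_cases j <;> simp [wedgeForm_one, wedge_one, dzL_apply, dzBarL_apply, dz_shear, dzBar_shear]
  coeff_sum c j := by
    obtain ⟨h1, h2, h3, h4⟩ := covector_coordVec
    fin_cases j <;> simp [evalCoord_apply, wedgeForm_one, wedge_one, dzL_apply, dzBarL_apply, h3, h4]
    · linear_combination ((c 1 - c 0) / 2) * Complex.I_mul_I
    · linear_combination ((c 0 - c 1) / 2) * Complex.I_mul_I
  sum_coeff θ hθ hs := by
    obtain ⟨h1, h2, h3, h4⟩ := covector_coordVec
    obtain ⟨s0, s1, s2, s3⟩ := shear_coordVec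
    have hs' : ∀ a, θ (fun _ => shearCLM 1 a) = θ fun _ => a := fun a => hs fun _ => a
    have hadd : ∀ a b, θ (fun _ => a + b) = θ (fun _ => a) + θ fun _ => b := fun a b =>
      map_slot_add θ 0 _ _ _ (by simp) (by simp) rfl
    -- The shear adds coordinate vector 0 to vector 2, and 1 to 3, so invariance forces the added
    -- vectors to be annihilated.
    have r0 : θ (fun _ => coordVec 0) = 0 := by
      have := hs' (coordVec 2)
      rwa [s2, hadd, add_eq_left] at this
    have r1 : θ (fun _ => coordVec 1) = 0 := by
      have := hs' (coordVec 3)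
      rwa [s3, hadd, add_eq_left] at this
    have hT : ∀ j (u : Fin 1 → Cov), (∃ i, (u i).1 = 0) →
        (![wedgeForm ![dzL], wedgeForm ![dzBarL]] : Fin 2 → Cov [⋀^Fin 1]→L[ℝ] ℂ) j u = 0 := by
      obtain ⟨h1, h2, h3, h4⟩ := covectorL_horizontal
      intro j u
      fin_cases j <;> refine wedgeForm_horizontal _ ?_ u <;> intro i <;> fin_cases i <;> assumption
    refine ext_horizontal hθ (sum_smul_horizontal hT _) fun v _ => ?_
    obtain ⟨a, rfl⟩ : ∃ a, v = ![a] := ⟨v 0, by funext i; fin_cases i; rfl⟩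
    fin_cases a <;> simp [evalCoord_apply, wedgeForm_one, wedge_one, dzL_apply,
      dzBarL_apply, h3, h4, r0, r1]
    all_goals grind [Complex.I_mul_I]

/-- Degree `2`: the covectors `dw ∧ dz`, `dw ∧ dz̄ + dw̄ ∧ dz`, `dw̄ ∧ dz̄` and `dz ∧ dz̄`. -/
noncomputable def covectorsTwo : Fin 4 → Cov [⋀^Fin 2]→L[ℝ] ℂ :=
  ![wedgeForm ![dwL, dzL], wedgeForm ![dwL, dzBarL] + wedgeForm ![dwBarL, dzL],
    wedgeForm ![dwBarL, dzBarL], wedgeForm ![dzL, dzBarL]]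

theorem covectorsTwo_horizontal (j : Fin 4) (u : Fin 2 → Cov) (hu : ∃ i, (u i).1 = 0) :
    covectorsTwo j u = 0 := by
  obtain ⟨h1, h2, h3, h4⟩ := covectorL_horizontal
  have key : ∀ a b : Cov →L[ℝ] ℂ, (∀ u : Cov, u.1 = 0 → a u = 0) → (∀ u : Cov, u.1 = 0 → b u = 0) →
      wedgeForm ![a, b] u = 0 := fun a b ha hb =>
    wedgeForm_horizontal _ (by intro i; fin_cases i <;> assumption) u hu
  fin_cases j
  · exact key _ _ h1 h2
  · change wedgeForm ![dwL, dzBarL] u + wedgeForm ![dwBarL, dzL] u = 0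
    rw [key _ _ h1 h4, key _ _ h3 h2, add_zero]
  · exact key _ _ h3 h4
  · exact key _ _ h2 h4

/-- Degree `2`: `covectorsTwo` as a basis. -/
noncomputable def basisTwo : InvariantBasis 2 4 where
  T := covectorsTwo
  -- With coefficients `a, c, e, l`, the values at the index pairs 02, 13, 03, 23 are `a + 2c + e`,
  -- `-a + 2c - e`, `i(a - e)`, `-2i l`; these functionals invert the system.
  coeff := ![(1 / 4 : ℂ) • evalCoord ![0, 2] - (1 / 4 : ℂ) • evalCoord ![1, 3] -
      (Complex.I / 2) • evalCoord ![0, 3],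
    (1 / 4 : ℂ) • evalCoord ![0, 2] + (1 / 4 : ℂ) • evalCoord ![1, 3],
    (1 / 4 : ℂ) • evalCoord ![0, 2] - (1 / 4 : ℂ) • evalCoord ![1, 3] +
      (Complex.I / 2) • evalCoord ![0, 3],
    (Complex.I / 2) • evalCoord ![2, 3]]
  horizontal := covectorsTwo_horizontal
  shear j n u := by
    -- The shear adds `n dz ∧ dz̄` to `dw ∧ dz̄` and `n dz̄ ∧ dz` to `dw̄ ∧ dz`; only in the sum do
    -- these cancel.
    fin_cases j <;> simp [covectorsTwo, wedgeForm_two, wedge_two, dwL_apply, dwBarL_apply,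
      dzL_apply, dzBarL_apply, dw_shear, dwBar_shear, dz_shear, dzBar_shear] <;> ring
  coeff_sum c j := by
    obtain ⟨h1, h2, h3, h4⟩ := covector_coordVec
    fin_cases j <;> simp [covectorsTwo, Fin.sum_univ_four, evalCoord_apply, wedgeForm_two,
      wedge_two, dwL_apply, dwBarL_apply, dzL_apply, dzBarL_apply, h1, h2, h3, h4]
    all_goals grind [Complex.I_mul_I]
  sum_coeff θ hθ hs := by
    obtain ⟨h1, h2, h3, h4⟩ := covector_coordVec
    obtain ⟨s0, s1, s2, s3⟩ := shear_coordVec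
    have hs' : ∀ a b, θ ![shearCLM 1 a, shearCLM 1 b] = θ ![a, b] := fun a b => by
      rw [← hs ![a, b]]; congr 1; funext i; fin_cases i <;> rfl
    have hl : ∀ a a' b, θ ![a + a', b] = θ ![a, b] + θ ![a', b] := fun a a' b =>
      map_slot_add θ 0 _ _ _ (by simp) (by simp) rfl
    have hr : ∀ a b b', θ ![a, b + b'] = θ ![a, b] + θ ![a, b'] := fun a b b' =>
      map_slot_add θ 1 _ _ _ (by simp) (by simp) rfl
    have hself : ∀ a, θ ![a, a] = 0 := fun a =>
      θ.map_eq_zero_of_eq ![a, a] (i := 0) (j := 1) rfl (by decide)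
    have hswap : ∀ a b, θ ![b, a] = -θ ![a, b] := fun a b => by
      have := hself (a + b)
      rw [hl, hr, hr, hself, hself] at this
      linear_combination this
    have r01 : θ ![coordVec 0, coordVec 1] = 0 := by
      have := hs' (coordVec 2) (coordVec 1)
      rwa [s2, s1, hl, add_eq_left] at this
    -- Together with `r01` this reduces the six coordinate values of an invariant 2-covector to the
    -- four that the coefficients use.
    have r12 : θ ![coordVec 1, coordVec 2] = θ ![coordVec 0, coordVec 3] := by
      have := hs' (coordVec 2) (coordVec 3)
      rw [s2, s3, hl, hr, hr, r01, hswap (coordVec 1) (coordVec 2)] at this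
      linear_combination -this
    refine ext_horizontal hθ (sum_smul_horizontal covectorsTwo_horizontal _) fun v hv => ?_
    obtain ⟨a, b, rfl⟩ : ∃ a b, v = ![a, b] := ⟨v 0, v 1, by funext i; fin_cases i <;> rfl⟩
    have hab : a < b := hv (show (0 : Fin 2) < 1 by decide)
    fin_cases a <;> fin_cases b <;> simp at hab <;>
      simp [covectorsTwo, Fin.sum_univ_four, evalCoord_apply, coordVec_comp_two, wedgeForm_two,
        wedge_two, dwL_apply, dwBarL_apply, dzL_apply, dzBarL_apply, h1, h2, h3, h4, r01, r12]
    all_goals grind [Complex.I_mul_I]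

/-- Degree `3`: the covectors `dw ∧ dz ∧ dz̄` and `dw̄ ∧ dz ∧ dz̄`. -/
noncomputable def covectorsThree : Fin 2 → Cov [⋀^Fin 3]→L[ℝ] ℂ :=
  ![wedgeForm ![dwL, dzL, dzBarL], wedgeForm ![dwBarL, dzL, dzBarL]]

theorem covectorsThree_horizontal (j : Fin 2) (u : Fin 3 → Cov) (hu : ∃ i, (u i).1 = 0) :
    covectorsThree j u = 0 := by
  obtain ⟨h1, h2, h3, h4⟩ := covectorL_horizontal
  fin_cases j <;> refine wedgeForm_horizontal _ ?_ u hu <;> intro i <;> fin_cases i <;> assumption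

/-- Degree `3`: `covectorsThree` as a basis. -/
noncomputable def basisThree : InvariantBasis 3 2 where
  T := covectorsThree
  -- With coefficients `a, b`, the values at 023 and 123 are `-2i(a + b)` and `2(a - b)`. Invariance
  -- kills the values at 012 and 013 (`r012`, `r013`).
  coeff := ![(Complex.I / 4) • evalCoord ![0, 2, 3] + (1 / 4 : ℂ) • evalCoord ![1, 2, 3],
    (Complex.I / 4) • evalCoord ![0, 2, 3] - (1 / 4 : ℂ) • evalCoord ![1, 2, 3]]
  horizontal := covectorsThree_horizontal
  shear j n u := by
    fin_cases j <;> simp [covectorsThree, wedgeForm_three, wedge_three, dwL_apply, dwBarL_apply,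
      dzL_apply, dzBarL_apply, dw_shear, dwBar_shear, dz_shear, dzBar_shear] <;> ring
  coeff_sum c j := by
    obtain ⟨h1, h2, h3, h4⟩ := covector_coordVec
    fin_cases j <;> simp [covectorsThree, evalCoord_apply, wedgeForm_three,
      wedge_three, dwL_apply, dwBarL_apply, dzL_apply, dzBarL_apply, h1, h2, h3, h4]
    all_goals grind [Complex.I_mul_I]
  sum_coeff θ hθ hs := by
    obtain ⟨h1, h2, h3, h4⟩ := covector_coordVec
    obtain ⟨s0, s1, s2, s3⟩ := shear_coordVec
    have hs' : ∀ a b c, θ ![shearCLM 1 a, shearCLM 1 b, shearCLM 1 c] = θ ![a, b, c] :=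
      fun a b c => by
        rw [← hs ![a, b, c]]; congr 1; funext i; fin_cases i <;> rfl
    have hadd₀ : ∀ a a' b c, θ ![a + a', b, c] = θ ![a, b, c] + θ ![a', b, c] := fun a a' b c =>
      map_slot_add θ 0 _ _ _ (by simp [Fin.forall_fin_succ]) (by simp [Fin.forall_fin_succ]) rfl
    have hadd₁ : ∀ a b b' c, θ ![a, b + b', c] = θ ![a, b, c] + θ ![a, b', c] := fun a b b' c =>
      map_slot_add θ 1 _ _ _ (by simp [Fin.forall_fin_succ]) (by simp [Fin.forall_fin_succ]) rfl
    have hadd₂ : ∀ a b c c', θ ![a, b, c + c'] = θ ![a, b, c] + θ ![a, b, c'] := fun a b c c' =>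
      map_slot_add θ 2 _ _ _ (by simp [Fin.forall_fin_succ]) (by simp [Fin.forall_fin_succ]) rfl
    have h01 : ∀ a b, θ ![a, a, b] = 0 := fun a b =>
      θ.map_eq_zero_of_eq ![a, a, b] (i := 0) (j := 1) rfl (by decide)
    have h02 : ∀ a b, θ ![a, b, a] = 0 := fun a b =>
      θ.map_eq_zero_of_eq ![a, b, a] (i := 0) (j := 2) rfl (by decide)
    have h12 : ∀ a b, θ ![b, a, a] = 0 := fun a b =>
      θ.map_eq_zero_of_eq ![b, a, a] (i := 1) (j := 2) rfl (by decide)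
    have r012 : θ ![coordVec 0, coordVec 1, coordVec 2] = 0 := by
      have := hs' (coordVec 0) (coordVec 3) (coordVec 2)
      rw [s0, s2, s3, hadd₁, hadd₂, hadd₂, h02, h02] at this
      linear_combination this
    have r013 : θ ![coordVec 0, coordVec 1, coordVec 3] = 0 := by
      have := hs' (coordVec 2) (coordVec 1) (coordVec 3)
      rw [s1, s2, s3, hadd₀, hadd₂, hadd₂, h12, h12] at this
      linear_combination this
    refine ext_horizontal hθ (sum_smul_horizontal covectorsThree_horizontal _) fun v hv => ?_
    obtain ⟨a, b, c, rfl⟩ : ∃ a b c, v = ![a, b, c] :=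
      ⟨v 0, v 1, v 2, by funext i; fin_cases i <;> rfl⟩
    have hab : a < b := hv (show (0 : Fin 3) < 1 by decide)
    have hbc : b < c := hv (show (1 : Fin 3) < 2 by decide)
    have hcases : (a = 0 ∧ b = 1 ∧ c = 2) ∨ (a = 0 ∧ b = 1 ∧ c = 3) ∨ (a = 0 ∧ b = 2 ∧ c = 3) ∨
        (a = 1 ∧ b = 2 ∧ c = 3) := by
      clear hv
      decide +revert
    rcases hcases with ⟨rfl, rfl, rfl⟩ | ⟨rfl, rfl, rfl⟩ | ⟨rfl, rfl, rfl⟩ | ⟨rfl, rfl, rfl⟩ <;>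
      simp [covectorsThree, evalCoord_apply, coordVec_comp_three, wedgeForm_three,
        wedge_three, dwL_apply, dwBarL_apply, dzL_apply, dzBarL_apply, h1, h2, h3, h4, r012, r013]
    all_goals grind [Complex.I_mul_I]

/-- Degree `4`: the covector `dw ∧ dz ∧ dw̄ ∧ dz̄`. -/
noncomputable def covectorFour : Fin 1 → Cov [⋀^Fin 4]→L[ℝ] ℂ :=
  ![wedgeForm ![dwL, dzL, dwBarL, dzBarL]]

theorem covectorFour_horizontal (j : Fin 1) (u : Fin 4 → Cov) (hu : ∃ i, (u i).1 = 0) :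
    covectorFour j u = 0 := by
  obtain ⟨h1, h2, h3, h4⟩ := covectorL_horizontal
  fin_cases j; refine wedgeForm_horizontal _ ?_ u hu; intro i; fin_cases i <;> assumption

theorem covectorFour_coordVec :
    covectorFour 0 (fun i => coordVec ((![0, 1, 2, 3] : Fin 4 → Fin 4) i)) = 4 := by
  obtain ⟨h1, h2, h3, h4⟩ := covector_coordVec
  simp [covectorFour, coordVec_comp_four, wedgeForm_four,
    wedge_four, wedge_three, dwL_apply, dwBarL_apply, dzL_apply, dzBarL_apply, h1, h2, h3, h4]
  grind [Complex.I_mul_I]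

/-- Degree `4`: `covectorFour` as a basis. -/
noncomputable def basisFour : InvariantBasis 4 1 where
  T := covectorFour
  coeff := ![(1 / 4 : ℂ) • evalCoord ![0, 1, 2, 3]]
  horizontal := covectorFour_horizontal
  shear j n u := by
    fin_cases j; simp [covectorFour, wedgeForm_four, wedge_four, wedge_three, dwL_apply,
      dwBarL_apply, dzL_apply, dzBarL_apply, dw_shear, dwBar_shear, dz_shear, dzBar_shear]; ring
  coeff_sum c j := by
    fin_cases j
    simp only [Fin.sum_univ_one, Fin.zero_eta, Matrix.cons_val_zero, smul_apply, evalCoord_apply,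
      ContinuousAlternatingMap.smul_apply, covectorFour_coordVec, smul_eq_mul]
    ring
  sum_coeff θ hθ hs := by
    refine ext_horizontal hθ (sum_smul_horizontal covectorFour_horizontal _) fun v hv => ?_
    have hv' : v = ![0, 1, 2, 3] := by
      have h01 := hv (show (0 : Fin 4) < 1 by decide)
      have h12 := hv (show (1 : Fin 4) < 2 by decide)
      have h23 := hv (show (2 : Fin 4) < 3 by decide)
      funext i
      fin_cases i <;> simp <;> omega
    subst hv'
    simp only [Fin.sum_univ_one, Matrix.cons_val_zero, smul_apply, evalCoord_apply,
      ContinuousAlternatingMap.smul_apply, covectorFour_coordVec, smul_eq_mul]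
    ring

end Suspension

namespace Suspension

/-! ### The exterior derivative in terms of coefficients -/

theorem coverForm_basisZero (g : Fin 1 → SmoothTorus2) (x : Cov) (u : Fin 0 → Cov) :
    basisZero.coverForm g x u = periodic (g 0) x.1.2 := by
  rw [InvariantBasis.coverForm_apply]
  simp [basisZero, wedgeForm_apply, wedge]

theorem coverForm_basisOne (g : Fin 2 → SmoothTorus2) (x : Cov) (u : Fin 1 → Cov) :
    basisOne.coverForm g x u =
      periodic (g 0) x.1.2 * wedge ![dz] u + periodic (g 1) x.1.2 * wedge ![dzBar] u := by
  rw [InvariantBasis.coverForm_apply, Fin.sum_univ_two]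
  simp only [basisOne, Matrix.cons_val_zero, Matrix.cons_val_one, wedgeForm_one]
  rfl

theorem coverForm_basisTwo (g : Fin 4 → SmoothTorus2) (x : Cov) (u : Fin 2 → Cov) :
    basisTwo.coverForm g x u = periodic (g 0) x.1.2 * wedge ![dw, dz] u
      + periodic (g 1) x.1.2 * (wedge ![dw, dzBar] u + wedge ![dwBar, dz] u)
      + periodic (g 2) x.1.2 * wedge ![dwBar, dzBar] u
      + periodic (g 3) x.1.2 * wedge ![dz, dzBar] u := by
  rw [InvariantBasis.coverForm_apply, Fin.sum_univ_four]
  simp only [basisTwo, covectorsTwo, Matrix.cons_val, ContinuousAlternatingMap.add_apply,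
    wedgeForm_two]
  rfl

theorem coverForm_basisThree (g : Fin 2 → SmoothTorus2) (x : Cov) (u : Fin 3 → Cov) :
    basisThree.coverForm g x u = periodic (g 0) x.1.2 * wedge ![dw, dz, dzBar] u
      + periodic (g 1) x.1.2 * wedge ![dwBar, dz, dzBar] u := by
  rw [InvariantBasis.coverForm_apply, Fin.sum_univ_two]
  simp only [basisThree, covectorsThree, Matrix.cons_val, wedgeForm_three]
  rfl

theorem coverForm_basisFour (g : Fin 1 → SmoothTorus2) (x : Cov) (u : Fin 4 → Cov) :
    basisFour.coverForm g x u =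
      periodic (g 0) x.1.2 * wedge ![dw, dz, dwBar, dzBar] u := by
  rw [InvariantBasis.coverForm_apply, Fin.sum_univ_one]
  simp only [basisFour, covectorFour, Matrix.cons_val, wedgeForm_four]
  rfl

theorem d_form_basisZero (g : Fin 1 → SmoothTorus2) :
    RoughForm.d (basisZero.form g) = basisOne.form ![delZ (g 0), delZBar (g 0)] := by
  refine InvariantBasis.d_form _ _ _ _ fun x u => ?_
  rw [InvariantBasis.extDeriv_coverForm_apply, coverForm_basisOne]
  simp [basisZero, wedgeForm_apply, wedge]

theorem d_form_basisOne (g : Fin 2 → SmoothTorus2) :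
    RoughForm.d (basisOne.form g) = basisTwo.form ![0, 0, 0, delZ (g 1) - delZBar (g 0)] := by
  refine InvariantBasis.d_form _ _ _ _ fun x u => ?_
  rw [InvariantBasis.extDeriv_coverForm_apply, coverForm_basisTwo]
  simp [Fin.sum_univ_two, basisOne, wedgeForm_one, wedge_one, wedge_two, periodic_zero,
    periodic_sub, Fin.removeNth_apply, dzL_apply, dzBarL_apply]
  ring

theorem d_form_basisTwo (g : Fin 4 → SmoothTorus2) :
    RoughForm.d (basisTwo.form g) =
      basisThree.form ![delZBar (g 0) - delZ (g 1), delZBar (g 1) - delZ (g 2)] := by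
  refine InvariantBasis.d_form _ _ _ _ fun x u => ?_
  rw [InvariantBasis.extDeriv_coverForm_apply, coverForm_basisThree]
  simp [Fin.sum_univ_three, Fin.sum_univ_four, basisTwo, covectorsTwo, wedgeForm_two, wedge_two,
    wedge_three, periodic_sub, Fin.removeNth_apply, dzL_apply, dzBarL_apply, dwL_apply,
    dwBarL_apply, Fin.succAbove]
  ring

/-- Both basis covectors already contain `dz ∧ dz̄`, so wedging with the differential of a function
of `z` gives zero. -/
theorem d_form_basisThree (g : Fin 2 → SmoothTorus2) :
    RoughForm.d (basisThree.form g) = 0 := by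
  rw [← map_zero basisFour.form]
  refine InvariantBasis.d_form _ _ _ _ fun x u => ?_
  rw [InvariantBasis.extDeriv_coverForm_apply, coverForm_basisFour]
  simp [Fin.sum_univ_four, basisThree, covectorsThree, wedgeForm_three,
    wedge_three, periodic_zero, Fin.removeNth_apply, dzL_apply, dzBarL_apply, dwL_apply,
    dwBarL_apply, Fin.succAbove]
  ring

theorem d_form_basisFour (g : Fin 1 → SmoothTorus2) :
    RoughForm.d (basisFour.form g) = 0 := by
  refine lift_injective ?_
  rw [lift_d (basisFour.form_mem_basicForms g).1, InvariantBasis.lift_form]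
  funext x
  refine ext_horizontal (basisFour.extDeriv_coverForm_horizontal g x) (fun u _ => rfl) fun v hv => ?_
  -- There is no strictly increasing 5-tuple in `Fin 4`: a horizontal 5-form vanishes.
  simpa using Fintype.card_le_of_injective v hv.injective

end Suspension

/-! ### Dimensions -/

/-- The characters `exp (2 π i n x)` of `𝕋²`, as homomorphisms. -/
noncomputable def torusCharacter (n : ℤ) : Multiplicative ℂ →* ℂ where
  toFun z := Complex.exp (2 * Real.pi * Complex.I * n * (Multiplicative.toAdd z).re)
  map_one' := by simp
  map_mul' z w := by
    rw [← Complex.exp_add, toAdd_mul, Complex.add_re]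
    push_cast
    congr 1
    ring

/-- The derivative at `0` along the real axis is `2πi n`, which recovers `n`. -/
theorem torusCharacter_injective : Function.Injective torusCharacter := by
  intro m n h
  have h1 : ∀ x : ℝ, HasDerivAt (fun t : ℝ => (Complex.exp (2 * Real.pi * Complex.I * x * t)))
      (2 * Real.pi * Complex.I * x) 0 := by
    intro x
    have h2 : HasDerivAt (fun t : ℝ => 2 * Real.pi * Complex.I * x * (t : ℂ))
        (2 * Real.pi * Complex.I * x * 1) 0 :=
      (Complex.ofRealCLM.hasDerivAt (x := (0 : ℝ))).const_mul _
    simpa using h2.cexp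
  have h3 : (fun t : ℝ => (Complex.exp (2 * Real.pi * Complex.I * (m : ℝ) * t))) =
      fun t : ℝ => (Complex.exp (2 * Real.pi * Complex.I * (n : ℝ) * t)) := by
    funext t
    simpa [torusCharacter] using DFunLike.congr_fun h (Multiplicative.ofAdd (t : ℂ))
  have h4 := (h1 m).unique (h3 ▸ h1 n)
  have h5 : (2 * Real.pi * Complex.I : ℂ) ≠ 0 := Complex.two_pi_I_ne_zero
  exact_mod_cast mul_left_cancel₀ h5 h4

theorem isSmoothPeriodic_torusCharacter (n : ℤ) :
    IsSmoothPeriodic fun z => torusCharacter n (Multiplicative.ofAdd z) := by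
  refine ⟨?_, fun z => ?_, fun z => ?_⟩
  · exact (contDiff_const.mul (Complex.ofRealCLM.contDiff.comp Complex.reCLM.contDiff)).cexp
  · rw [ofAdd_add, map_mul]
    have : torusCharacter n (Multiplicative.ofAdd 1) = 1 := by
      change Complex.exp _ = 1
      rw [Complex.exp_eq_one_iff]
      exact ⟨n, by simp; ring⟩
    rw [this, mul_one]
  · rw [ofAdd_add, map_mul]
    have : torusCharacter n (Multiplicative.ofAdd Complex.I) = 1 := by
      change Complex.exp _ = 1
      simp
    rw [this, mul_one]

/-- Distinct characters are linearly independent (Dedekind). They depend on the real part of `z`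
only, so their derivative along `i` vanishes. -/
theorem exists_linearIndependent_torus2 : ∃ e : ℤ → SmoothTorus2, LinearIndependent ℂ e ∧
    ∀ n z, fderiv ℝ (periodic (e n)) z Complex.I = 0 := by
  choose e he using fun n => exists_periodic_eq (isSmoothPeriodic_torusCharacter n)
  refine ⟨e, ?_, fun n z => ?_⟩
  · let P : SmoothTorus2 →ₗ[ℂ] (Multiplicative ℂ → ℂ) :=
      { toFun := fun g z => periodic g (Multiplicative.toAdd z)
        map_add' := fun _ _ => rfl
        map_smul' := fun _ _ => rfl }
    refine LinearIndependent.of_comp P ?_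
    have h1 := (linearIndependent_monoidHom (Multiplicative ℂ) ℂ).comp _ torusCharacter_injective
    have h2 : P ∘ e = (fun f : Multiplicative ℂ →* ℂ => (f : Multiplicative ℂ → ℂ)) ∘
        torusCharacter := funext fun n => funext fun z => congrFun (he n) (Multiplicative.toAdd z)
    rw [h2]
    exact h1
  · rw [he n, ← ((isSmoothPeriodic_torusCharacter n).differentiable z).lineDeriv_eq_fderiv]
    have h1 : ∀ t : ℝ, torusCharacter n (Multiplicative.ofAdd (z + t • Complex.I)) =
        torusCharacter n (Multiplicative.ofAdd z) := fun t => by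
      simp [torusCharacter]
    simp only [lineDeriv, h1, deriv_const]

theorem not_finite_smoothTorus2 : ¬ Module.Finite ℂ SmoothTorus2 := by
  intro h
  obtain ⟨e, he, -⟩ := exists_linearIndependent_torus2
  exact not_finite_iff_infinite.2 inferInstance he.finite

theorem not_finite_spaceV : ¬ Module.Finite ℂ spaceV := by
  intro h
  obtain ⟨e, he, hI⟩ := exists_linearIndependent_torus2
  -- On functions of the real part alone `∂` and `∂̄` coincide, so the diagonal triple satisfies
  -- both equations of `V`.
  let v : ℤ → spaceV := fun n => ⟨(e n, e n, e n), fun z => by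
    simp only [wirtinger, wirtingerBar, hI]
    simp⟩
  have hv : LinearIndependent ℂ v :=
    LinearIndependent.of_comp ((LinearMap.fst ℂ _ _).comp spaceV.subtype) he
  exact not_finite_iff_infinite.2 inferInstance hv.finite

theorem isConst_of_wirtinger_eq_zero {g : SmoothTorus2} (h : ∀ z, wirtinger (periodic g) z = 0)
    (h' : ∀ z, wirtingerBar (periodic g) z = 0) : ∃ l, g = constTorus2 l := by
  refine ⟨periodic g 0, smoothTorus2_ext fun z => ?_⟩
  rw [periodic_const]
  refine is_const_of_fderiv_eq_zero (𝕜 := ℝ) (differentiable_periodic g) (fun z => ?_) z 0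
  ext v
  rw [fderiv_eq_wirtinger, h, h']
  simp

namespace Suspension

/-! ### The foliation is transversely holomorphic -/

theorem mdifferentiable_torusShear_zpow (n : ℤ) :
    MDifferentiable 𝓘(ℂ, ℂ × ℂ) 𝓘(ℂ, ℂ × ℂ) (torusShear ^ n) := by
  have h : ContMDiff 𝓘(ℂ, ℂ × ℂ) 𝓘(ℂ, ℂ × ℂ) ω (torusShear ^ n) := by
    intro q
    refine (uniformization_torus4 ℂ).contMDiffAt_of_comp fun y _ => ?_
    have : (torusShear ^ n) ∘ (QuotientAddGroup.mk : ℂ × ℂ → Torus4) =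
        (QuotientAddGroup.mk : ℂ × ℂ → Torus4) ∘ fun x => (x.1 + (n : ℂ) * x.2, x.2) :=
      funext fun x => torusShear_zpow_mk n x
    rw [this]
    refine ContMDiffAt.comp y ((uniformization_torus4 ℂ).contMDiff.contMDiffAt) ?_
    refine ContDiffAt.contMDiffAt ?_
    fun_prop
  exact h.mdifferentiable (by simp)

theorem isTransverselyHolomorphic_foliation : foliation.IsTransverselyHolomorphic := by
  refine ⟨inferInstance, fun (a b : ℝ) _ => ⟨?_, ?_⟩⟩
  · exact (mdifferentiable_torusShear_zpow (round (b - a))).mdifferentiableOn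
  · have h : ⇑(torusShear ^ round (b - a)).toOpenPartialHomeomorph.symm =
        ⇑(torusShear ^ (-round (b - a))) := by rw [zpow_neg]; rfl
    change MDifferentiableOn _ _ (torusShear ^ round (b - a)).toOpenPartialHomeomorph.symm _
    rw [h]
    exact (mdifferentiable_torusShear_zpow _).mdifferentiableOn

theorem codimension_foliation : foliation.codimension = 4 := by
  change Module.finrank ℝ (ℂ × ℂ) = 4
  rw [Module.finrank_prod, Complex.finrank_real_complex]

/-! ### The cohomology -/

theorem form_mem_closedForms {k m : ℕ} {B : InvariantBasis k m} {g : Fin m → SmoothTorus2}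
    (h : RoughForm.d (B.form g) = 0) : B.form g ∈ foliation.closedForms ℂ k :=
  mem_closedForms_iff.2 ⟨B.form_mem_basicForms g, h⟩

theorem exists_form_of_mem_closedForms {k m : ℕ} (B : InvariantBasis k m)
    {α : RoughForm Cov Suspension ℂ k} (h : α ∈ foliation.closedForms ℂ k) :
    ∃ g, B.form g = α ∧ RoughForm.d (B.form g) = 0 := by
  obtain ⟨h1, h2⟩ := mem_closedForms_iff.1 h
  obtain ⟨g, rfl⟩ := B.exists_form_eq h1
  exact ⟨g, rfl, h2⟩

theorem mem_exactForms_succ_iff_exists_form {k m : ℕ} (B : InvariantBasis k m)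
    {α : RoughForm Cov Suspension ℂ (k + 1)} :
    α ∈ foliation.exactForms ℂ (k + 1) ↔ ∃ g, RoughForm.d (B.form g) = α := by
  rw [mem_exactForms_succ_iff]
  constructor
  · rintro ⟨β, hβ, rfl⟩
    obtain ⟨g, rfl⟩ := B.exists_form_eq hβ
    exact ⟨g, rfl⟩
  · rintro ⟨g, rfl⟩
    exact ⟨_, B.form_mem_basicForms g, rfl⟩

/-- The representatives in degree `0`. -/
noncomputable def coeffZero : ℂ →ₗ[ℂ] (Fin 1 → SmoothTorus2) where
  toFun l := ![constTorus2 l]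
  map_add' _ _ := by ext i; fin_cases i; rfl
  map_smul' _ _ := by ext i; fin_cases i; rfl

/-- The representatives in degrees `1` and `3`. -/
noncomputable def coeffPair : ℂ × ℂ →ₗ[ℂ] (Fin 2 → SmoothTorus2) where
  toFun p := ![constTorus2 p.1, constTorus2 p.2]
  map_add' _ _ := by ext i; fin_cases i <;> rfl
  map_smul' _ _ := by ext i; fin_cases i <;> rfl

/-- The representatives in degree `2`. -/
noncomputable def coeffTwo : spaceV × ℂ →ₗ[ℂ] (Fin 4 → SmoothTorus2) where
  toFun p := ![p.1.1.1, p.1.1.2.1, p.1.1.2.2, constTorus2 p.2]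
  map_add' _ _ := by ext i; fin_cases i <;> rfl
  map_smul' _ _ := by ext i; fin_cases i <;> rfl

/-- The representatives in degree `4`. -/
noncomputable def coeffFour : SmoothTorus2 →ₗ[ℂ] (Fin 1 → SmoothTorus2) where
  toFun g := ![g]
  map_add' _ _ := by ext i; fin_cases i; rfl
  map_smul' _ _ := by ext i; fin_cases i; rfl

/-- Common frame for all degrees: a linear family of closed representatives that meets the exact
forms only in zero and exhausts the closed forms modulo them. -/
theorem exists_cohomology_equiv {k m : ℕ} (B : InvariantBasis k m) {C : Type*} [AddCommGroup C]
    [Module ℂ C] (c : C →ₗ[ℂ] (Fin m → SmoothTorus2)) (hc : ∀ p, RoughForm.d (B.form (c p)) = 0)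
    (hinj : ∀ p, B.form (c p) ∈ foliation.exactForms ℂ k → p = 0)
    (hsurj : ∀ g, RoughForm.d (B.form g) = 0 →
      ∃ p, B.form g - B.form (c p) ∈ foliation.exactForms ℂ k)
    {η : C → Cov → (Fin k → Cov) → ℂ} (hη : ∀ p x u, B.coverForm (c p) x u = η p x u) :
    ∃ Φ : C ≃ₗ[ℂ] foliation.basicCohomology ℂ k, ∀ p, IsRepresentedBy (Φ p) (η p) := by
  obtain ⟨Φ, hΦ⟩ := exists_equiv_basicCohomology (B.form.comp c)
    (fun p => form_mem_closedForms (hc p)) hinj (fun α hα => by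
      obtain ⟨g, rfl, hg⟩ := exists_form_of_mem_closedForms B hα
      exact hsurj g hg)
  refine ⟨Φ, fun p => ?_⟩
  obtain ⟨α, h1, h2⟩ := hΦ p
  refine ⟨α, h1, fun x u => ?_⟩
  rw [← hη, ← B.lift_form]
  rw [h2]
  rfl

theorem cohomology_zero : ∃ Φ : ℂ ≃ₗ[ℂ] foliation.basicCohomology ℂ 0,
    ∀ l, IsRepresentedBy (Φ l) fun _ _ => l := by
  refine exists_cohomology_equiv basisZero coeffZero (fun l => ?_) (fun l hl => ?_)
    (fun g hg => ?_) (fun l x u => ?_)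
  · rw [d_form_basisZero, ← map_zero basisOne.form]
    congr 1
    funext i
    fin_cases i
    · exact smoothTorus2_ext fun z => (periodic_delZ _ z).trans (wirtinger_const l z)
    · exact smoothTorus2_ext fun z => (periodic_delZBar _ z).trans (wirtingerBar_const l z)
  · have h1 : basisZero.form (coeffZero l) = 0 := hl
    rw [← map_zero basisZero.form] at h1
    have h2 := congrFun (basisZero.form_injective h1) 0
    exact congrArg (fun f => periodic f 0) h2
  · rw [d_form_basisZero, ← map_zero basisOne.form] at hg
    have h1 := basisOne.form_injective hg
    obtain ⟨l, hl⟩ := isConst_of_wirtinger_eq_zero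
      (fun z => (periodic_delZ (g 0) z).symm.trans (congrArg (periodic · z) (congrFun h1 0)))
      (fun z => (periodic_delZBar (g 0) z).symm.trans (congrArg (periodic · z) (congrFun h1 1)))
    refine ⟨l, ?_⟩
    have h2 : g = coeffZero l := by
      funext i; fin_cases i; exact hl
    rw [h2, sub_self]
    exact Submodule.zero_mem _
  · exact coverForm_basisZero _ x u

/-- The complex in degrees 0 and 1 is the de Rham complex of `𝕋²`, and closedness is the same
condition, so this is the first cohomology of `𝕋²`. -/
theorem cohomology_one : ∃ Φ : (ℂ × ℂ) ≃ₗ[ℂ] foliation.basicCohomology ℂ 1,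
    ∀ p, IsRepresentedBy (Φ p) fun _ u => p.1 * wedge ![dz] u + p.2 * wedge ![dzBar] u := by
  refine exists_cohomology_equiv basisOne coeffPair (fun p => ?_) (fun p hp => ?_)
    (fun g hg => ?_) (fun p x u => coverForm_basisOne _ x u)
  · rw [d_form_basisOne, ← map_zero basisTwo.form]
    congr 1
    funext i
    fin_cases i
    · rfl
    · rfl
    · rfl
    · refine smoothTorus2_ext fun z => ?_
      change periodic (delZ (constTorus2 p.2) - delZBar (constTorus2 p.1)) z = 0
      rw [periodic_sub, periodic_delZ, periodic_delZBar, wirtinger_const, wirtingerBar_const,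
        sub_zero]
  · obtain ⟨f, hf⟩ := (mem_exactForms_succ_iff_exists_form basisZero).1 hp
    rw [d_form_basisZero] at hf
    have h1 := basisOne.form_injective hf
    have h2 := isSmoothPeriodic_periodic (f 0)
    have h3 : ∀ z, wirtinger (periodic (f 0)) z = p.1 := fun z =>
      (periodic_delZ (f 0) z).symm.trans (congrArg (periodic · z) (congrFun h1 0))
    have h4 : ∀ z, wirtingerBar (periodic (f 0)) z = p.2 := fun z =>
      (periodic_delZBar (f 0) z).symm.trans (congrArg (periodic · z) (congrFun h1 1))
    -- A constant `∂f` or `∂̄f` is zero: apply the divergence lemma with `b = 0`, which produces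
    -- `-∂f`, or with `c = 0`.
    refine Prod.ext (neg_eq_zero.1 ?_) ?_
    · refine eq_zero_of_wirtinger_divergence (IsSmoothPeriodic.const 0) h2 fun z => ?_
      rw [h3]
      simp [wirtingerBar]
    · refine eq_zero_of_wirtinger_divergence h2 (IsSmoothPeriodic.const 0) fun z => ?_
      rw [h4]
      simp [wirtinger]
  · rw [d_form_basisOne, ← map_zero basisTwo.form] at hg
    have h1 := congrFun (basisTwo.form_injective hg) 3
    have h2 : ∀ z, wirtingerBar (periodic (g 0)) z - wirtinger (periodic (g 1)) z = 0 := by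
      intro z
      have h3 : periodic (delZ (g 1) - delZBar (g 0)) z = 0 := congrArg (periodic · z) h1
      rw [periodic_sub, periodic_delZ, periodic_delZBar] at h3
      linear_combination -h3
    obtain ⟨f, l, m, hf, hfg⟩ := exists_wirtinger_primitive (isSmoothPeriodic_periodic (g 0))
      (isSmoothPeriodic_periodic (g 1)) h2
    obtain ⟨f, rfl⟩ := exists_periodic_eq hf
    refine ⟨(l, m), (mem_exactForms_succ_iff_exists_form basisZero).2 ⟨![f], ?_⟩⟩
    rw [d_form_basisZero, ← map_sub]
    congr 1
    funext i
    refine smoothTorus2_ext fun z => ?_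
    rw [Pi.sub_apply, periodic_sub]
    fin_cases i
    · exact (periodic_delZ f z).trans (eq_sub_of_add_eq' (hfg z).1.symm)
    · exact (periodic_delZBar f z).trans (eq_sub_of_add_eq' (hfg z).2.symm)

/-- Closedness restricts only the first three coefficients, to `V`, and exactness alters only the
fourth, by functions `∂c - ∂̄b`, which leaves a constant. -/
theorem cohomology_two : ∃ Φ : (spaceV × ℂ) ≃ₗ[ℂ] foliation.basicCohomology ℂ 2,
    ∀ p, IsRepresentedBy (Φ p) fun x u =>
      periodic p.1.1.1 x.1.2 * wedge ![dw, dz] u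
      + periodic p.1.1.2.1 x.1.2 * (wedge ![dw, dzBar] u + wedge ![dwBar, dz] u)
      + periodic p.1.1.2.2 x.1.2 * wedge ![dwBar, dzBar] u
      + p.2 * wedge ![dz, dzBar] u := by
  refine exists_cohomology_equiv (C := spaceV × ℂ) basisTwo coeffTwo (fun p => ?_) (fun p hp => ?_)
    (fun g hg => ?_) (fun p x u => coverForm_basisTwo _ x u)
  · rw [d_form_basisTwo, ← map_zero basisThree.form]
    congr 1
    funext i
    refine smoothTorus2_ext fun z => ?_
    fin_cases i
    · change periodic (delZBar p.1.1.1 - delZ p.1.1.2.1) z = 0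
      rw [periodic_sub, periodic_delZ, periodic_delZBar]
      exact (p.1.2 z).1
    · change periodic (delZBar p.1.1.2.1 - delZ p.1.1.2.2) z = 0
      rw [periodic_sub, periodic_delZ, periodic_delZBar]
      exact (p.1.2 z).2
  · obtain ⟨f, hf⟩ := (mem_exactForms_succ_iff_exists_form basisOne).1 hp
    rw [d_form_basisOne] at hf
    have h1 := basisTwo.form_injective hf
    refine Prod.ext (Subtype.ext (Prod.ext (congrFun h1 0).symm
      (Prod.ext (congrFun h1 1).symm (congrFun h1 2).symm))) (neg_eq_zero.1 ?_)
    refine eq_zero_of_wirtinger_divergence (isSmoothPeriodic_periodic (f 0))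
      (isSmoothPeriodic_periodic (f 1)) fun z => ?_
    have h2 : periodic (delZ (f 1) - delZBar (f 0)) z = p.2 :=
      congrArg (periodic · z) (congrFun h1 3)
    rw [periodic_sub, periodic_delZ, periodic_delZBar] at h2
    linear_combination -h2
  · rw [d_form_basisTwo, ← map_zero basisThree.form] at hg
    have h1 := basisThree.form_injective hg
    have h2 : (g 0, g 1, g 2) ∈ spaceV := by
      intro z
      have h3 : periodic (delZBar (g 0) - delZ (g 1)) z = 0 :=
        congrArg (periodic · z) (congrFun h1 0)
      have h4 : periodic (delZBar (g 1) - delZ (g 2)) z = 0 :=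
        congrArg (periodic · z) (congrFun h1 1)
      rw [periodic_sub, periodic_delZ, periodic_delZBar] at h3 h4
      exact ⟨h3, h4⟩
    -- The differential produces `∂c - ∂̄b`, the opposite of the divergence in the lemma. Hence the
    -- factor `-1` here and the representative `-l` below.
    obtain ⟨b, c, l, hb, hc, hbc⟩ := exists_wirtinger_divergence
      ((isSmoothPeriodic_periodic (g 3)).const_mul (-1))
    obtain ⟨b, rfl⟩ := exists_periodic_eq hb
    obtain ⟨c, rfl⟩ := exists_periodic_eq hc
    refine ⟨(⟨_, h2⟩, -l), (mem_exactForms_succ_iff_exists_form basisOne).2 ⟨![b, c], ?_⟩⟩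
    rw [d_form_basisOne, ← map_sub]
    congr 1
    funext i
    refine smoothTorus2_ext fun z => ?_
    rw [Pi.sub_apply, periodic_sub]
    fin_cases i
    · exact (sub_self _).symm
    · exact (sub_self _).symm
    · exact (sub_self _).symm
    · change periodic (delZ c - delZBar b) z = periodic (g 3) z - -l
      rw [periodic_sub, periodic_delZ, periodic_delZBar]
      linear_combination hbc z

/-- Every basic 3-form is closed. Finiteness comes from `exists_wirtinger_divergence_pair`: three
functions suffice to solve both equations at once, up to a constant in each. -/
theorem cohomology_three : ∃ Φ : (ℂ × ℂ) ≃ₗ[ℂ] foliation.basicCohomology ℂ 3,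
    ∀ p, IsRepresentedBy (Φ p) fun _ u =>
      p.1 * wedge ![dw, dz, dzBar] u + p.2 * wedge ![dwBar, dz, dzBar] u := by
  refine exists_cohomology_equiv basisThree coeffPair (fun p => d_form_basisThree _)
    (fun p hp => ?_) (fun g _ => ?_) (fun p x u => coverForm_basisThree _ x u)
  · obtain ⟨f, hf⟩ := (mem_exactForms_succ_iff_exists_form basisTwo).1 hp
    rw [d_form_basisTwo] at hf
    have h1 := basisThree.form_injective hf
    refine Prod.ext ?_ ?_
    · refine eq_zero_of_wirtinger_divergence (isSmoothPeriodic_periodic (f 0))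
        (isSmoothPeriodic_periodic (f 1)) fun z => ?_
      rw [← periodic_delZ, ← periodic_delZBar]
      exact congrArg (periodic · z) (congrFun h1 0)
    · refine eq_zero_of_wirtinger_divergence (isSmoothPeriodic_periodic (f 1))
        (isSmoothPeriodic_periodic (f 2)) fun z => ?_
      rw [← periodic_delZ, ← periodic_delZBar]
      exact congrArg (periodic · z) (congrFun h1 1)
  · obtain ⟨b, c, e, l, m, hb, hc, he, h⟩ := exists_wirtinger_divergence_pair
      (isSmoothPeriodic_periodic (g 0)) (isSmoothPeriodic_periodic (g 1))
    obtain ⟨b, rfl⟩ := exists_periodic_eq hb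
    obtain ⟨c, rfl⟩ := exists_periodic_eq hc
    obtain ⟨e, rfl⟩ := exists_periodic_eq he
    refine ⟨(l, m), (mem_exactForms_succ_iff_exists_form basisTwo).2 ⟨![b, c, e, 0], ?_⟩⟩
    rw [d_form_basisTwo, ← map_sub]
    congr 1
    funext i
    refine smoothTorus2_ext fun z => ?_
    rw [Pi.sub_apply, periodic_sub]
    fin_cases i
    · change periodic (delZBar b - delZ c) z = periodic (g 0) z - l
      rw [periodic_sub, periodic_delZ, periodic_delZBar, (h z).1, add_sub_cancel_left]
    · change periodic (delZBar c - delZ e) z = periodic (g 1) z - m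
      rw [periodic_sub, periodic_delZ, periodic_delZBar, (h z).2, add_sub_cancel_left]

/-- The differential vanishes on basic 3-forms and on basic 4-forms, so the cohomology is the whole
space of basic 4-forms. -/
theorem cohomology_four : ∃ Φ : SmoothTorus2 ≃ₗ[ℂ] foliation.basicCohomology ℂ 4,
    ∀ g, IsRepresentedBy (Φ g) fun x u =>
      periodic g x.1.2 * wedge ![dw, dz, dwBar, dzBar] u := by
  refine exists_cohomology_equiv basisFour coeffFour (fun p => d_form_basisFour _)
    (fun p hp => ?_) (fun g _ => ⟨g 0, ?_⟩) (fun p x u => coverForm_basisFour _ x u)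
  · obtain ⟨f, hf⟩ := (mem_exactForms_succ_iff_exists_form basisThree).1 hp
    rw [d_form_basisThree, ← map_zero basisFour.form] at hf
    exact (congrFun (basisFour.form_injective hf) 0).symm
  · have h : g = coeffFour (g 0) := by
      funext i; fin_cases i; rfl
    rw [← h, sub_self]
    exact Submodule.zero_mem _

end Suspension

/-! ### The main theorem. -/

open Suspension in
theorem mainTheorem6 :
    foliation.codimension = 4 ∧
    foliation.IsTransverselyHolomorphic ∧
    -- degree 0: constants
    (∃ Φ : ℂ ≃ₗ[ℂ] foliation.basicCohomology ℂ 0,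
      ∀ l, IsRepresentedBy (Φ l) fun _ _ => l) ∧
    -- degree 1: `l dz + m dz̄`
    (∃ Φ : (ℂ × ℂ) ≃ₗ[ℂ] foliation.basicCohomology ℂ 1,
      ∀ l m, IsRepresentedBy (Φ (l, m)) fun _ u =>
        l * wedge ![dz] u + m * wedge ![dzBar] u) ∧
    -- degree 2: `b dw ∧ dz + c (dw ∧ dz̄ + dw̄ ∧ dz) + e dw̄ ∧ dz̄ + l dz ∧ dz̄`
    (∃ Φ : (spaceV × ℂ) ≃ₗ[ℂ] foliation.basicCohomology ℂ 2,
      ∀ (v : spaceV) (l : ℂ), IsRepresentedBy (Φ (v, l)) fun x u =>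
        periodic v.1.1 x.1.2 * wedge ![dw, dz] u
        + periodic v.1.2.1 x.1.2 * (wedge ![dw, dzBar] u + wedge ![dwBar, dz] u)
        + periodic v.1.2.2 x.1.2 * wedge ![dwBar, dzBar] u
        + l * wedge ![dz, dzBar] u) ∧
    -- degree 3: `l dw ∧ dz ∧ dz̄ + m dw̄ ∧ dz ∧ dz̄`
    (∃ Φ : (ℂ × ℂ) ≃ₗ[ℂ] foliation.basicCohomology ℂ 3,
      ∀ l m, IsRepresentedBy (Φ (l, m)) fun _ u =>
        l * wedge ![dw, dz, dzBar] u + m * wedge ![dwBar, dz, dzBar] u) ∧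
    -- degree 4: `g dw ∧ dz ∧ dw̄ ∧ dz̄`
    (∃ Φ : SmoothTorus2 ≃ₗ[ℂ] foliation.basicCohomology ℂ 4,
      ∀ g, IsRepresentedBy (Φ g) fun x u =>
        periodic g x.1.2 * wedge ![dw, dz, dwBar, dzBar] u) ∧
    ¬ Module.Finite ℂ spaceV ∧
    ¬ Module.Finite ℂ (foliation.basicCohomology ℂ 2) ∧
    Module.Finite ℂ (foliation.basicCohomology ℂ 3) ∧
    ¬ Module.Finite ℂ (foliation.basicCohomology ℂ 4) := by

  obtain ⟨Φ0, h0⟩ := cohomology_zero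
  obtain ⟨Φ1, h1⟩ := cohomology_one
  obtain ⟨Φ2, h2⟩ := cohomology_two
  obtain ⟨Φ3, h3⟩ := cohomology_three
  obtain ⟨Φ4, h4⟩ := cohomology_four
  refine ⟨codimension_foliation, isTransverselyHolomorphic_foliation, ⟨Φ0, h0⟩,
    ⟨Φ1, fun l m => h1 (l, m)⟩, ⟨Φ2, fun v l => h2 (v, l)⟩, ⟨Φ3, fun l m => h3 (l, m)⟩, ⟨Φ4, h4⟩,
    not_finite_spaceV, fun h => ?_, Module.Finite.equiv Φ3, fun h => ?_⟩
  · have : Module.Finite ℂ (spaceV × ℂ) := Module.Finite.equiv Φ2.symm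
    exact not_finite_spaceV
      (Module.Finite.of_surjective (LinearMap.fst ℂ spaceV ℂ) LinearMap.fst_surjective)
  · exact not_finite_smoothTorus2 (Module.Finite.equiv Φ4.symm)
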